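/- Let $n\ge 0$, let $q\in L_{1,\mathrm{loc}}([0,\infty);\mathbb C^{n\times n})$ be Hermitian almost everywhere, and let $\mathcal H=L_2([0,\infty);\mathbb C^n)$. Let $L_{\max}y=-y''+qy$ on $$\operatorname{Dom}L_{\max}=\{y\in L_2([0,\infty);\mathbb C^n)\cap W^2_{1,\mathrm{loc}}([0,\infty);\mathbb C^n): -y''+qy\in L_2([0,\infty);\mathbb C^n)\},$$ let $L_{\min}$ be its restriction to the functions whose support is a compact subset of $(0,\infty)$, and let $L_0$ be the closure of $L_{\min}$. Assume that $L_0$ is positive definite: there is $\kappa>0$ with $(L_0y,y)\ge\kappa\|y\|^2$ for all $y\in\operatorname{Dom}L_0$. Then there is a continuous function $w:\{(x,t):0\le x\le t<\infty\}\to\mathbb C^{n\times n}$, unique on this set, that is the generalized solution of the Goursat problem $w_{tt}-w_{xx}+qw=0$ for $0<x<t$, $w(0,t)=0$, $w(x,x)=-\frac12\int_0^xq(s)\,ds$, in the sense that $v(\xi,\eta)=w\left(\frac{\eta-\xi}2,\frac{\eta+\xi}2\right)$ satisfies, for all $0\le\xi\le\eta$, $$v(\xi,\eta)=-\frac12\int_{\xi/2}^{\eta/2}q(s)\,ds-\frac14\int_0^{\xi}d\xi_1\int_{\xi}^{\eta}d\eta_1\,q\left(\tfrac{\eta_1-\xi_1}2\right)v(\xi_1,\eta_1).$$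 Let $T>0$ and let $f\in C^\infty([0,T];\mathbb C^n)$ with $\operatorname{supp}f\subset(0,T]$, continued by zero to the negative half-line. For $x\ge0$, $t\in[0,T]$ put $$u(x,t)=f(t-x)+\int_x^tw(x,s)f(t-s)\,ds .$$ Then $u$ is the unique solution of the abstract system $$\begin{aligned} &u(\cdot,t)\in\operatorname{Dom}L_0^*, && t\in[0,T],\\ &\ddot u(x,t)-u_{xx}(x,t)+q(x)u(x,t)=0, && t\in(0,T),\ \text{a.e. }x\in(0,\infty),\\ &u(x,0)=\dot u(x,0)=0, && x\in[0,\infty),\\ &u(0,t)=f(t), && t\in[0,T]. \end{aligned}$$ Here a solution is a function $u(x,t)$ such that $u(\cdot,t)$ lies in $\operatorname{Dom}L_0^*$ and in $\operatorname{Dom}L_{\max}$ and is the $W^2_{1,\mathrm{loc}}$ representative of its class, for every $t\in[0,T]$; dots denote derivatives in $t$ of the $\mathcal H$-valued function $t\mapsto u(\cdot,t)$, which is required to be continuously differentiable on $[0,T]$ and twice differentiable on $(0,T)$; and $u_{xx}$ is the partial derivative (which exists for almost every $x$). The condition $\dot u(x,0)=0$ is understood in $\mathcal H$. Moreover, for the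 function $u$ given by the formula the partial derivatives $u_t(x,t)$ and $u_{tt}(x,t)$ exist for all $x\ge0$, $t\in[0,T]$ (one-sided at $t=0$ and $t=T$), the $\mathcal H$-valued derivatives $\dot u(t)$ and $\ddot u(t)$ exist for all $t\in[0,T]$ (one-sided at the endpoints), and $\dot u(t)=u_t(\cdot,t)$, $\ddot u(t)=u_{tt}(\cdot,t)$ in $\mathcal H$. -/

import Mathlib

open MeasureTheory Set
open scoped ContDiff LinearPMap Matrix.Norms.L2Operator

noncomputable section

namespace HalfLine

/-- The space `ℂⁿ` with its Euclidean norm. -/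
abbrev Vec (n : ℕ) : Type := EuclideanSpace ℂ (Fin n)

/-- Lebesgue measure on the half-line `[0, ∞)`. -/
abbrev mu : Measure ℝ := volume.restrict (Ici (0 : ℝ))

/-- The Hilbert space `L₂([0, ∞); ℂⁿ)`. -/
abbrev Hil (n : ℕ) : Type := Lp (Vec n) 2 mu

variable {n : ℕ}

/-- The action of a complex `n × n` matrix on `ℂⁿ`. -/
abbrev act (A : Matrix (Fin n) (Fin n) ℂ) : Vec n →L[ℂ] Vec n :=
  Matrix.toEuclideanCLM (n := Fin n) (𝕜 := ℂ) A

/-- `y` belongs to `W²₁,loc([0, ∞); ℂⁿ)`, with first derivative `y₁` and second derivative `y₂`: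
`y` is continuously differentiable on `[0, ∞)` (one-sidedly at `0`) with derivative `y₁`, and `y₁`
is locally absolutely continuous on `[0, ∞)` with locally summable derivative `y₂`. -/
structure IsW21Loc (y y₁ y₂ : ℝ → Vec n) : Prop where
  locInt : LocallyIntegrableOn y₂ (Ici 0)
  hasDeriv : ∀ x, 0 ≤ x → HasDerivWithinAt y (y₁ x) (Ici 0) x
  eq_integral : ∀ x, 0 ≤ x → y₁ x = y₁ 0 + ∫ s in (0 : ℝ)..x, y₂ s

namespace IsW21Loc

variable {y y₁ y₂ z z₁ z₂ : ℝ → Vec n}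

lemma intervalIntegrable (h : IsW21Loc y y₁ y₂) {x : ℝ} (hx : 0 ≤ x) :
    IntervalIntegrable y₂ volume 0 x := by
  rw [intervalIntegrable_iff_integrableOn_Icc_of_le hx]
  exact h.locInt.integrableOn_compact_subset (fun s hs => hs.1) isCompact_Icc

lemma zero : IsW21Loc (0 : ℝ → Vec n) 0 0 where
  locInt := locallyIntegrableOn_zero
  hasDeriv x _ := hasDerivWithinAt_const x _ (0 : Vec n)
  eq_integral x _ := by simp

lemma add (h : IsW21Loc y y₁ y₂) (k : IsW21Loc z z₁ z₂) :
    IsW21Loc (y + z) (y₁ + z₁) (y₂ + z₂) where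
  locInt := h.locInt.add k.locInt
  hasDeriv x hx := (h.hasDeriv x hx).add (k.hasDeriv x hx)
  eq_integral x hx := by
    simp only [Pi.add_apply]
    rw [intervalIntegral.integral_add (h.intervalIntegrable hx) (k.intervalIntegrable hx),
      h.eq_integral x hx, k.eq_integral x hx]
    abel

lemma smul (c : ℂ) (h : IsW21Loc y y₁ y₂) : IsW21Loc (c • y) (c • y₁) (c • y₂) where
  locInt := h.locInt.smul c
  hasDeriv x hx := (h.hasDeriv x hx).const_smul c
  eq_integral x hx := by
    simp only [Pi.smul_apply]
    rw [intervalIntegral.integral_smul, h.eq_integral x hx, smul_add]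

lemma continuousOn (h : IsW21Loc y y₁ y₂) : ContinuousOn y (Ici 0) :=
  fun x hx => (h.hasDeriv x hx).continuousWithinAt

/-- The first derivative is the usual one. -/
lemma deriv_eq (h : IsW21Loc y y₁ y₂) {x : ℝ} (hx : 0 < x) : deriv y x = y₁ x :=
  ((h.hasDeriv x hx.le).hasDerivAt (Ici_mem_nhds hx)).deriv

/-- The second derivative is the usual one at almost every point. -/
lemma ae_deriv_deriv (h : IsW21Loc y y₁ y₂) :
    ∀ᵐ x ∂mu, HasDerivAt (deriv y) (y₂ x) x := by
  have key : ∀ᵐ x : ℝ, ∀ N : ℕ, x ∈ uIcc (0 : ℝ) N → ∀ c ∈ uIcc (0 : ℝ) N,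
      HasDerivAt (fun b => ∫ s in c..b, y₂ s) (y₂ x) x := by
    rw [ae_all_iff]
    intro N
    exact (h.intervalIntegrable (Nat.cast_nonneg N)).ae_hasDerivAt_integral
  have h0 : ∀ᵐ x ∂mu, x ≠ 0 := ae_restrict_of_ae (by simp [ae_iff])
  filter_upwards [ae_restrict_of_ae key, ae_restrict_mem measurableSet_Ici, h0] with x hk hx hx0
  have hxp : 0 < x := lt_of_le_of_ne hx (Ne.symm hx0)
  obtain ⟨N, hN⟩ := exists_nat_ge x
  have hd := hk N (by rw [uIcc_of_le (Nat.cast_nonneg N)]; exact ⟨hx, hN⟩) 0 left_mem_uIcc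
  refine (hd.const_add (y₁ 0)).congr_of_eventuallyEq ?_
  filter_upwards [Ioi_mem_nhds hxp] with s hs
  rw [h.deriv_eq hs, h.eq_integral s (le_of_lt hs)]

/-- The second derivative is determined by the almost everywhere class of `y`. -/
lemma ae_eq_zero (h : IsW21Loc y y₁ y₂) (hy : y =ᵐ[mu] 0) : y₂ =ᵐ[mu] 0 := by
  have hy0 : ∀ x ∈ Ioi (0 : ℝ), y x = 0 := by
    have h1 : y =ᵐ[volume.restrict (Ioi 0)] 0 :=
      ae_restrict_of_ae_restrict_of_subset Ioi_subset_Ici_self hy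
    exact Measure.eqOn_open_of_ae_eq h1 isOpen_Ioi
      (h.continuousOn.mono Ioi_subset_Ici_self) continuousOn_const
  have h1 : ∀ x ∈ Ioi (0 : ℝ), deriv y x = 0 := by
    intro x hx
    have : y =ᶠ[nhds x] fun _ => 0 := by
      filter_upwards [Ioi_mem_nhds hx] with s hs using hy0 s hs
    rw [this.deriv_eq]; simp
  have h0 : ∀ᵐ x ∂mu, x ≠ 0 := ae_restrict_of_ae (by simp [ae_iff])
  filter_upwards [h.ae_deriv_deriv, ae_restrict_mem measurableSet_Ici, h0] with x hd hx hx0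
  have hxp : 0 < x := lt_of_le_of_ne hx (Ne.symm hx0)
  have : deriv y =ᶠ[nhds x] fun _ => 0 := by
    filter_upwards [Ioi_mem_nhds hxp] with s hs using h1 s hs
  have h2 := this.deriv_eq
  rw [hd.deriv] at h2
  simpa using h2

end IsW21Loc

/-- The pair `(Y, Z)` of elements of `L₂([0, ∞); ℂⁿ)` belongs to the graph of the maximal operator:
`Y` has a representative `y` in `W²₁,loc([0, ∞); ℂⁿ)`, and `Z` is the class of `-y'' + q y`. -/
def MaxRel (q : ℝ → Matrix (Fin n) (Fin n) ℂ) (Y Z : Hil n) (y : ℝ → Vec n) : Prop :=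
  ∃ y₁ y₂ : ℝ → Vec n, IsW21Loc y y₁ y₂ ∧ Y =ᵐ[mu] y ∧
    Z =ᵐ[mu] fun x => -y₂ x + act (q x) (y x)

lemma MaxRel.zero (q : ℝ → Matrix (Fin n) (Fin n) ℂ) : MaxRel q 0 0 0 := by
  refine ⟨0, 0, IsW21Loc.zero, Lp.coeFn_zero _ _ _, ?_⟩
  filter_upwards [Lp.coeFn_zero (Vec n) 2 mu] with x hx
  rw [hx]
  simp

lemma MaxRel.add {q : ℝ → Matrix (Fin n) (Fin n) ℂ} {Y Z Y' Z' : Hil n} {y y' : ℝ → Vec n}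
    (h : MaxRel q Y Z y) (h' : MaxRel q Y' Z' y') : MaxRel q (Y + Y') (Z + Z') (y + y') := by
  obtain ⟨y₁, y₂, hy, hY, hZ⟩ := h
  obtain ⟨z₁, z₂, hy', hY', hZ'⟩ := h'
  refine ⟨_, _, hy.add hy', (Lp.coeFn_add Y Y').trans (hY.add hY'), ?_⟩
  filter_upwards [Lp.coeFn_add Z Z', hZ, hZ'] with x h1 h2 h3
  rw [h1, Pi.add_apply, h2, h3]
  simp only [Pi.add_apply, map_add]
  abel

lemma MaxRel.smul {q : ℝ → Matrix (Fin n) (Fin n) ℂ} {Y Z : Hil n} {y : ℝ → Vec n} (c : ℂ)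
    (h : MaxRel q Y Z y) : MaxRel q (c • Y) (c • Z) (c • y) := by
  obtain ⟨y₁, y₂, hy, hY, hZ⟩ := h
  refine ⟨_, _, hy.smul c, (Lp.coeFn_smul c Y).trans (hY.const_smul c), ?_⟩
  filter_upwards [Lp.coeFn_smul c Z, hZ] with x h1 h2
  rw [h1, Pi.smul_apply, h2]
  simp only [Pi.smul_apply, map_smul, smul_add, smul_neg]

lemma MaxRel.eq_zero {q : ℝ → Matrix (Fin n) (Fin n) ℂ} {Z : Hil n} {y : ℝ → Vec n}
    (h : MaxRel q 0 Z y) : Z = 0 := by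
  obtain ⟨y₁, y₂, hy, hY, hZ⟩ := h
  have hy0 : y =ᵐ[mu] 0 := hY.symm.trans (Lp.coeFn_zero _ _ _)
  rw [Lp.eq_zero_iff_ae_eq_zero]
  filter_upwards [hZ, hy0, hy.ae_eq_zero hy0] with x h1 h2 h3
  rw [h1, h2, h3]
  simp

/-- The graph of the maximal operator. -/
def maxGraph (q : ℝ → Matrix (Fin n) (Fin n) ℂ) : Submodule ℂ (Hil n × Hil n) where
  carrier := {p | ∃ y, MaxRel q p.1 p.2 y}
  zero_mem' := ⟨0, MaxRel.zero q⟩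
  add_mem' := by
    rintro p p' ⟨y, h⟩ ⟨y', h'⟩
    exact ⟨_, h.add h'⟩
  smul_mem' := by
    rintro c p ⟨y, h⟩
    exact ⟨_, h.smul c⟩

/-- The graph of the minimal operator: in addition, `y` has compact support in `(0, ∞)`. -/
def minGraph (q : ℝ → Matrix (Fin n) (Fin n) ℂ) : Submodule ℂ (Hil n × Hil n) where
  carrier := {p | ∃ y, MaxRel q p.1 p.2 y ∧
    ∃ a b : ℝ, 0 < a ∧ ∀ x, 0 ≤ x → x ∉ Icc a b → y x = 0}
  zero_mem' := ⟨0, MaxRel.zero q, 1, 1, one_pos, fun _ _ _ => rfl⟩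
  add_mem' := by
    rintro p p' ⟨y, h, a, b, ha, hs⟩ ⟨y', h', a', b', ha', hs'⟩
    refine ⟨_, h.add h', min a a', max b b', lt_min ha ha', fun x hx hx' => ?_⟩
    rw [Pi.add_apply, hs x hx fun hh => hx' ⟨min_le_of_left_le hh.1, le_max_of_le_left hh.2⟩,
      hs' x hx fun hh => hx' ⟨min_le_of_right_le hh.1, le_max_of_le_right hh.2⟩, add_zero]
  smul_mem' := by
    rintro c p ⟨y, h, a, b, ha, hs⟩
    refine ⟨_, h.smul c, a, b, ha, fun x hx hx' => ?_⟩
    rw [Pi.smul_apply, hs x hx hx', smul_zero]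

/-- The maximal operator `L_max y = -y'' + q y`. -/
def Lmax (q : ℝ → Matrix (Fin n) (Fin n) ℂ) : Hil n →ₗ.[ℂ] Hil n := (maxGraph q).toLinearPMap

/-- The operator `L_min`, the restriction of `L_max` to the functions with compact support in
`(0, ∞)`. -/
def Lmin (q : ℝ → Matrix (Fin n) (Fin n) ℂ) : Hil n →ₗ.[ℂ] Hil n := (minGraph q).toLinearPMap

/-- The minimal operator `L₀`, the closure of `L_min`. -/
def L0 (q : ℝ → Matrix (Fin n) (Fin n) ℂ) : Hil n →ₗ.[ℂ] Hil n := (Lmin q).closure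

lemma Lmax_graph (q : ℝ → Matrix (Fin n) (Fin n) ℂ) : (Lmax q).graph = maxGraph q :=
  Submodule.toLinearPMap_graph_eq _ fun p ⟨y, h⟩ h0 => by
    rw [h0] at h
    exact h.eq_zero

lemma Lmin_graph (q : ℝ → Matrix (Fin n) (Fin n) ℂ) : (Lmin q).graph = minGraph q :=
  Submodule.toLinearPMap_graph_eq _ fun p ⟨y, h, _⟩ h0 => by
    rw [h0] at h
    exact h.eq_zero

/-- Positive definiteness of an operator: `(L y, y) ≥ κ ‖y‖²` on its domain, for some `κ > 0`. -/
def PosDef (L : Hil n →ₗ.[ℂ] Hil n) : Prop :=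
  ∃ κ : ℝ, 0 < κ ∧ ∀ y : L.domain, κ * ‖(y : Hil n)‖ ^ 2 ≤ RCLike.re (inner ℂ (L y) (y : Hil n))

/-- The domain `0 ≤ x ≤ t` of the kernel. -/
def wedge : Set (ℝ × ℝ) := {p | 0 ≤ p.1 ∧ p.1 ≤ p.2}

/-- `w` is a continuous generalized solution of the Goursat problem
`w_tt - w_xx + q w = 0` for `0 < x < t`, `w (0, t) = 0`, `w (x, x) = -½ ∫₀ˣ q`, that is, a
continuous solution of the corresponding integral equation in the variables
`ξ = t - x`, `η = t + x`. -/
structure IsGoursatKernel (q : ℝ → Matrix (Fin n) (Fin n) ℂ)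
    (w : ℝ → ℝ → Matrix (Fin n) (Fin n) ℂ) : Prop where
  cont : ContinuousOn (fun p : ℝ × ℝ => w p.1 p.2) wedge
  eq : ∀ ξ η : ℝ, 0 ≤ ξ → ξ ≤ η →
    w ((η - ξ) / 2) ((η + ξ) / 2) =
      -(1 / 2 : ℝ) • (∫ s in (ξ / 2)..(η / 2), q s) -
        (1 / 4 : ℝ) • ∫ ξ₁ in (0 : ℝ)..ξ, ∫ η₁ in ξ..η,
          q ((η₁ - ξ₁) / 2) * w ((η₁ - ξ₁) / 2) ((η₁ + ξ₁) / 2)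

/-- Continuation of a function by zero to the negative half-line. -/
def zeroExt (f : ℝ → Vec n) (t : ℝ) : Vec n := if 0 ≤ t then f t else 0

/-- The function `u(x, t) = f(t - x) + ∫ₓᵗ w(x, s) f(t - s) ds`. For `x > t` both terms vanish,
because `f` is continued by zero. -/
def uBeta (w : ℝ → ℝ → Matrix (Fin n) (Fin n) ℂ) (f : ℝ → Vec n) (x t : ℝ) : Vec n :=
  zeroExt f (t - x) + ∫ s in x..t, act (w x s) (zeroExt f (t - s))

/-- A smooth boundary control on `[0, T]` with support in `(0, T]`. -/
def IsControl (T : ℝ) (f : ℝ → Vec n) : Prop :=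
  ContDiffOn ℝ ∞ f (Icc 0 T) ∧ ∃ δ : ℝ, 0 < δ ∧ ∀ t ∈ Icc 0 T, t < δ → f t = 0

/-- `U (x, t)` solves the abstract system on `[0, T]` with boundary control `f`. Here `u t` is the
element of `L₂([0, ∞); ℂⁿ)` given by `U (·, t)`, and `u₁`, `u₂` are the first and the second
derivatives of the `L₂`-valued function `u`. -/
structure IsSolution (q : ℝ → Matrix (Fin n) (Fin n) ℂ) (T : ℝ) (f : ℝ → Vec n)
    (U : ℝ → ℝ → Vec n) (u u₁ u₂ : ℝ → Hil n) : Prop where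
  rep : ∀ t ∈ Icc 0 T, u t =ᵐ[mu] fun x => U x t
  hasDeriv : ∀ t ∈ Icc 0 T, HasDerivWithinAt u (u₁ t) (Icc 0 T) t
  cont : ContinuousOn u₁ (Icc 0 T)
  hasDeriv₂ : ∀ t ∈ Ioo 0 T, HasDerivAt u₁ (u₂ t) t
  /-- `u(·, t) ∈ Dom L₀*` -/
  mem_adjoint : ∀ t ∈ Icc 0 T, u t ∈ (L0 q)†.domain
  /-- `u(·, t) ∈ Dom L_max` -/
  mem_max : ∀ t ∈ Icc 0 T, u t ∈ (Lmax q).domain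
  /-- Of the almost everywhere class, `U (·, t)` is the representative in `W²₁,loc`. -/
  w21 : ∀ t ∈ Icc 0 T, ∃ y₁ y₂ : ℝ → Vec n, IsW21Loc (fun x => U x t) y₁ y₂
  /-- `ü - u_xx + q u = 0` -/
  equation : ∀ t ∈ Ioo 0 T, ∀ᵐ x ∂mu,
    u₂ t x - deriv (fun x₁ => deriv (fun x₂ => U x₂ t) x₁) x + act (q x) (U x t) = 0
  init : ∀ x, 0 ≤ x → U x 0 = 0
  init₁ : u₁ 0 = 0
  boundary : ∀ t ∈ Icc 0 T, U 0 t = f t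

end HalfLine

end

/-!
The proof has two independent halves, the kernel with the solution it gives, and uniqueness.

**Kernel and solution.** In the variables `x` and `r = t - x` the integral equation of the Goursat
problem becomes the Volterra equation `IsVolterraKernel` on the quadrant `x, r ≥ 0`
(`goursat_integral_eq`). Since `q` is only locally summable and depends on `x` alone, the double
integral is written with the integration in `r` inside, where `q` is constant; the primitive of
`W(y, ·)` is then a continuous function, and the integral operator is a contraction in the weight
`λ e^{λ r}`, where `λ` is one plus the integral of `‖q‖` over `[0, x + r / 2]`
(`norm_volterra_le`). This gives existence and uniqueness (`exists_isVolterraKernel`,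
`IsVolterraKernel.eq`).

The function `u` is a convolution with the control, so its derivatives in `t`, pointwise and in
`L₂`, are obtained by differentiating the control (`hasDerivAt_sol`, `hasDerivAt_Lp`), and the
kernel need not be differentiable. For the equation in `x`, the Volterra equation convolved with the
control gives Duhamel's formula for `u` (`sol_eq_duhamel`). Expanding the travelling waves in it to
second order, and using it once more for the control `f''`, one obtains the wave equation integrated
twice in `x`, `u(x, t) = f(t) + c x + ∫₀ˣ (x - s) (q u + u_tt)(s, t) ds` (`sol_eq_integral`), which
contains `u(·, t) ∈ W²₁,loc`, the equation almost everywhere, and the boundary condition. Hence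
`u(·, t) ∈ Dom L_max`, and Green's formula shows `Dom L_max ⊆ Dom L₀*` (`mem_adjoint_domain`).

**Uniqueness.** Positivity of `L₀` forces the limit point case at infinity: for `y ∈ Dom L_max` the
functions `χ e^{± i x} y` with cutoff functions `χ` belong to `Dom L_min`, and positivity of the
form on them bounds the integral over long intervals of the flux `Im (y, y')`, with both signs
(`cutoff_inequality`). By Green's formula the flux has a limit at infinity, which is therefore zero,
and so the restriction of `L_max` to the functions with `y(0) = 0` is symmetric
(`inner_symm_of_dirichlet`). The difference `d` of two solutions takes values in the domain of this
restriction, and `(ḋ(τ), d(S - τ)) + (d(τ), ḋ(S - τ))` does not depend on `τ`. It vanishes when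
`d(τ) = ḋ(τ) = 0`, so at `τ = S / 2` the derivative of `‖d‖²` is zero; this propagates `d = 0` from
`[0, a]` to `[0, (a + T) / 2]`, and thereby to `[0, T]` (`wave_zero_step`, `wave_zero`).
-/

noncomputable section

namespace HalfLine

/-! ### Integration by parts for absolutely continuous functions -/

section General

variable {E F G : Type*} [NormedAddCommGroup E] [NormedSpace ℝ E] [NormedAddCommGroup F]
  [NormedSpace ℝ F] [NormedAddCommGroup G] [NormedSpace ℝ G]

lemma integral_indicator_lt {g : ℝ → G} {s x : ℝ} (hs : s ∈ Ioc 0 x) :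
    ∫ τ in (0 : ℝ)..x, (Ioi s).indicator g τ = ∫ τ in s..x, g τ := by
  rw [intervalIntegral.integral_of_le (hs.1.le.trans hs.2), intervalIntegral.integral_of_le hs.2,
    setIntegral_indicator measurableSet_Ioi]
  congr 2
  ext τ
  simp only [mem_inter_iff, mem_Ioc, mem_Ioi]
  exact ⟨fun h => ⟨h.2, h.1.2⟩, fun h => ⟨⟨hs.1.trans h.1, h.2⟩, h.1⟩⟩

lemma integral_indicator_gt {g : ℝ → G} {τ x : ℝ} (hτ : τ ∈ Ioc 0 x) :
    ∫ s in (0 : ℝ)..x, (Iio τ).indicator g s = ∫ s in (0 : ℝ)..τ, g s := by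
  rw [intervalIntegral.integral_of_le (hτ.1.le.trans hτ.2), intervalIntegral.integral_of_le hτ.1.le,
    setIntegral_indicator measurableSet_Iio, integral_Ioc_eq_integral_Ioo]
  congr 2
  ext s
  simp only [mem_inter_iff, mem_Ioc, mem_Iio, mem_Ioo]
  exact ⟨fun h => ⟨h.1.1, h.2⟩, fun h => ⟨⟨h.1, h.2.le.trans hτ.2⟩, h.2⟩⟩

/-- Fubini's theorem for the triangle `0 < s < τ < x`. -/
lemma integral_integral_triangle {k : ℝ → ℝ → G} {x : ℝ} (hx : 0 ≤ x)
    (hk : Integrable (Function.uncurry k)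
      ((volume.restrict (Ioc 0 x)).prod (volume.restrict (Ioc 0 x)))) :
    ∫ s in (0 : ℝ)..x, ∫ τ in s..x, k s τ = ∫ τ in (0 : ℝ)..x, ∫ s in (0 : ℝ)..τ, k s τ := by
  have h1 : ∫ s in (0 : ℝ)..x, ∫ τ in s..x, k s τ =
      ∫ s in (0 : ℝ)..x, ∫ τ in (0 : ℝ)..x, (Ioi s).indicator (k s) τ := by
    rw [intervalIntegral.integral_of_le hx, intervalIntegral.integral_of_le hx]
    exact setIntegral_congr_fun measurableSet_Ioc fun s hs => (integral_indicator_lt hs).symm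
  have h2 : ∫ τ in (0 : ℝ)..x, ∫ s in (0 : ℝ)..τ, k s τ =
      ∫ τ in (0 : ℝ)..x, ∫ s in (0 : ℝ)..x, (Iio τ).indicator (fun s => k s τ) s := by
    rw [intervalIntegral.integral_of_le hx, intervalIntegral.integral_of_le hx]
    exact setIntegral_congr_fun measurableSet_Ioc fun s hs => (integral_indicator_gt hs).symm
  have hm : MeasurableSet {p : ℝ × ℝ | p.1 < p.2} := measurableSet_lt measurable_fst measurable_snd
  rw [h1, h2]
  simp only [intervalIntegral.integral_of_le hx]
  rw [integral_integral_swap]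
  · rfl
  · exact hk.indicator hm

lemma HasDerivWithinAt.integral_eq_sub_Ici [CompleteSpace E] {y y₁ : ℝ → E} {a b x : ℝ}
    (hy : ∀ s ∈ Icc 0 x, HasDerivWithinAt y (y₁ s) (Ici 0) s) (hy₁ : ContinuousOn y₁ (Icc 0 x))
    (ha : 0 ≤ a) (hab : a ≤ b) (hb : b ≤ x) : ∫ s in a..b, y₁ s = y b - y a := by
  have hsub : Icc a b ⊆ Icc 0 x := Icc_subset_Icc ha hb
  refine intervalIntegral.integral_eq_sub_of_hasDeriv_right_of_le hab
    (fun s hs => ((hy s (hsub hs)).continuousWithinAt).mono fun r hr => ha.trans hr.1)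
    (fun s hs => (hy s (hsub (Ioo_subset_Icc_self hs))).mono
      fun r (hr : s < r) => (ha.trans (hs.1.le.trans hr.le)))
    ((hy₁.mono hsub).intervalIntegrable_of_Icc hab)

/-- Integration by parts for a bilinear pairing of a continuously differentiable function with an
absolutely continuous one. -/
lemma bilin_eq_add_integral [CompleteSpace E] [CompleteSpace F] [CompleteSpace G]
    (B : E →L[ℝ] F →L[ℝ] G) {y y₁ : ℝ → E}
    {Z h : ℝ → F} {x : ℝ} (hx : 0 ≤ x)
    (hy : ∀ s ∈ Icc 0 x, HasDerivWithinAt y (y₁ s) (Ici 0) s) (hy₁ : ContinuousOn y₁ (Icc 0 x))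
    (hh : IntervalIntegrable h volume 0 x)
    (hZ : ∀ s ∈ Icc 0 x, Z s = Z 0 + ∫ r in (0 : ℝ)..s, h r) :
    IntervalIntegrable (fun s => B (y₁ s) (Z s) + B (y s) (h s)) volume 0 x ∧
    B (y x) (Z x) = B (y 0) (Z 0) + ∫ s in (0 : ℝ)..x, (B (y₁ s) (Z s) + B (y s) (h s)) := by
  have hyc : ContinuousOn y (Icc 0 x) := fun s hs =>
    ((hy s hs).continuousWithinAt).mono Icc_subset_Ici_self
  have hZc : ContinuousOn Z (Icc 0 x) := by
    have : ContinuousOn (fun s => Z 0 + ∫ r in (0 : ℝ)..s, h r) (Icc 0 x) := by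
      have := intervalIntegral.continuousOn_primitive_interval (a := 0) (b := x) (μ := volume)
        (f := h) (by
          rw [uIcc_of_le hx]
          exact (intervalIntegrable_iff_integrableOn_Icc_of_le hx).1 hh)
      rw [uIcc_of_le hx] at this
      exact continuousOn_const.add this
    exact this.congr hZ
  have hi1 : IntervalIntegrable (fun s => B (y₁ s) (Z s)) volume 0 x :=
    ((B.continuous.comp_continuousOn hy₁).clm_apply hZc).intervalIntegrable_of_Icc hx
  have hi1' : IntervalIntegrable (fun s => B (y₁ s) (Z 0)) volume 0 x :=
    ((B.continuous.comp_continuousOn hy₁).clm_apply continuousOn_const).intervalIntegrable_of_Icc hx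
  have hyi : IntegrableOn y₁ (Ioc 0 x) :=
    (intervalIntegrable_iff_integrableOn_Ioc_of_le hx).1 (hy₁.intervalIntegrable_of_Icc hx)
  have hhi : IntegrableOn h (Ioc 0 x) := (intervalIntegrable_iff_integrableOn_Ioc_of_le hx).1 hh
  have hi2 : IntervalIntegrable (fun s => B (y s) (h s)) volume 0 x := by
    rw [intervalIntegrable_iff_integrableOn_Ioc_of_le hx]
    obtain ⟨C, hC⟩ := isCompact_Icc.exists_bound_of_continuousOn hyc
    refine Integrable.mono' ((hhi.norm.const_mul C).const_mul ‖B‖) ?_ ?_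
    · exact B.aestronglyMeasurable_comp₂
        ((hyc.mono Ioc_subset_Icc_self).aestronglyMeasurable measurableSet_Ioc)
        hhi.aestronglyMeasurable
    · refine (ae_restrict_iff' measurableSet_Ioc).2 (.of_forall fun s hs => ?_)
      refine (B.le_opNorm₂ _ _).trans ?_
      rw [mul_assoc]
      gcongr
      exact hC s (Ioc_subset_Icc_self hs)
  have hk : Integrable (Function.uncurry fun s τ => B (y₁ τ) (h s))
      ((volume.restrict (Ioc 0 x)).prod (volume.restrict (Ioc 0 x))) := by
    have := Integrable.op_fst_snd (op := fun (a : F) (b : E) => B b a)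
      (μ := volume.restrict (Ioc 0 x)) (ν := volume.restrict (Ioc 0 x)) (by fun_prop)
      (f := h) (g := y₁)
      ⟨‖B‖, fun a b => (B.le_opNorm₂ _ _).trans (le_of_eq (by ring))⟩ hhi hyi
    exact this
  have hsw := integral_integral_triangle hx hk
  have hL : ∫ s in (0 : ℝ)..x, ∫ τ in s..x, B (y₁ τ) (h s) =
      B (y x) (∫ s in (0 : ℝ)..x, h s) - ∫ s in (0 : ℝ)..x, B (y s) (h s) := by
    rw [← ContinuousLinearMap.intervalIntegral_comp_comm _ hh,
      ← intervalIntegral.integral_sub ⟨(B (y x)).integrable_comp hh.1,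
        (B (y x)).integrable_comp hh.2⟩ hi2]
    refine intervalIntegral.integral_congr fun s hs => ?_
    rw [uIcc_of_le hx] at hs
    have h3 : IntervalIntegrable y₁ volume s x :=
      (hy₁.mono (Icc_subset_Icc_left hs.1)).intervalIntegrable_of_Icc hs.2
    have := (B.flip (h s)).intervalIntegral_comp_comm h3
    simp only [ContinuousLinearMap.flip_apply] at this
    simp only [this, HasDerivWithinAt.integral_eq_sub_Ici hy hy₁ hs.1 hs.2 le_rfl, map_sub,
      _root_.sub_apply]
  have hR : ∫ τ in (0 : ℝ)..x, ∫ s in (0 : ℝ)..τ, B (y₁ τ) (h s) =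
      (∫ s in (0 : ℝ)..x, B (y₁ s) (Z s)) - (B (y x) (Z 0) - B (y 0) (Z 0)) := by
    have h4 : ∫ s in (0 : ℝ)..x, B (y₁ s) (Z 0) = B (y x) (Z 0) - B (y 0) (Z 0) := by
      have := (B.flip (Z 0)).intervalIntegral_comp_comm
        (hy₁.intervalIntegrable_of_Icc (μ := volume) hx)
      simp only [ContinuousLinearMap.flip_apply] at this
      rw [this, HasDerivWithinAt.integral_eq_sub_Ici hy hy₁ le_rfl hx le_rfl]
      simp
    rw [← h4, ← intervalIntegral.integral_sub hi1 hi1']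
    refine intervalIntegral.integral_congr fun s hs => ?_
    rw [uIcc_of_le hx] at hs
    have h3 : IntervalIntegrable h volume 0 s :=
      hh.mono_set (by rw [uIcc_of_le hs.1, uIcc_of_le hx]; exact Icc_subset_Icc_right hs.2)
    simp only [(B (y₁ s)).intervalIntegral_comp_comm h3, hZ s hs, map_add, add_sub_cancel_left]
  rw [hL, hR] at hsw
  refine ⟨hi1.add hi2, ?_⟩
  rw [intervalIntegral.integral_add hi1 hi2, hZ x ⟨hx, le_rfl⟩, map_add]
  have : (∫ s in (0 : ℝ)..x, B (y₁ s) (Z s)) = B (y x) (∫ s in (0 : ℝ)..x, h s)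
      - (∫ s in (0 : ℝ)..x, B (y s) (h s)) + (B (y x) (Z 0) - B (y 0) (Z 0)) := by
    rw [hsw]; abel
  rw [this]; abel

end General

/-- A function that is given as the solution of `U'' = h` with data `U(0) = a`, `U'(0) = c`,
integrated twice, belongs to `W²₁,loc`. The interchange of the two integrations is
`bilin_eq_add_integral`. -/
lemma isW21Loc_of_eq_integral {n : ℕ} {U h : ℝ → Vec n} {a c : Vec n}
    (hh : LocallyIntegrableOn h (Ici 0))
    (hU : ∀ x, 0 ≤ x → U x = a + x • c + ∫ s in (0 : ℝ)..x, (x - s) • h s) :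
    IsW21Loc U (fun x => c + ∫ s in (0 : ℝ)..x, h s) h := by
  have hi : ∀ {x : ℝ}, 0 ≤ x → IntervalIntegrable h volume 0 x := fun {x} hx => by
    rw [intervalIntegrable_iff_integrableOn_Icc_of_le hx]
    exact hh.integrableOn_compact_subset (fun s hs => hs.1) isCompact_Icc
  have hc : ContinuousOn (fun x => c + ∫ s in (0 : ℝ)..x, h s) (Ici 0) := by
    intro x hx
    have h1 := intervalIntegral.continuousOn_primitive_interval (a := 0) (b := x + 1) (μ := volume)
      (f := h) (by
        rw [uIcc_of_le (by linarith [mem_Ici.1 hx])]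
        exact (intervalIntegrable_iff_integrableOn_Icc_of_le
          (by linarith [mem_Ici.1 hx])).1 (hi (by linarith [mem_Ici.1 hx])))
    rw [uIcc_of_le (by linarith [mem_Ici.1 hx])] at h1
    refine ((h1 x ⟨hx, by linarith⟩).mono_of_mem_nhdsWithin ?_).const_add c
    filter_upwards [self_mem_nhdsWithin, mem_nhdsWithin_of_mem_nhds (Iio_mem_nhds (lt_add_one x))]
      with s h1 h2 using ⟨h1, h2.le⟩
  have hc' : Continuous (fun x => c + ∫ s in (0 : ℝ)..(max x 0), h s) :=
    hc.comp_continuous (continuous_id.max continuous_const) fun x => mem_Ici.2 (le_max_right _ _)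
  have hU' : ∀ x, 0 ≤ x →
      U x = a + ∫ τ in (0 : ℝ)..x, (c + ∫ s in (0 : ℝ)..(max τ 0), h s) := by
    intro x hx
    have := (bilin_eq_add_integral (ContinuousLinearMap.lsmul ℝ ℝ : ℝ →L[ℝ] Vec n →L[ℝ] Vec n)
      (y := fun s => x - s) (y₁ := fun _ => -1) (Z := fun x => ∫ s in (0 : ℝ)..x, h s) (h := h) hx
      (fun s _ => ((hasDerivAt_id s).const_sub x).hasDerivWithinAt) continuousOn_const (hi hx)
      (fun s hs => by simp))
    obtain ⟨h1, h2⟩ := this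
    simp only [ContinuousLinearMap.lsmul_apply, sub_self, zero_smul, intervalIntegral.integral_same,
      smul_zero, zero_add, neg_smul, one_smul] at h1 h2
    have hz : IntervalIntegrable (fun τ => ∫ s in (0 : ℝ)..τ, h s) volume 0 x := by
      have : ContinuousOn (fun τ => ∫ s in (0 : ℝ)..τ, h s) (Icc 0 x) :=
        ((hc.sub (continuousOn_const (c := c))).mono (Icc_subset_Ici_self : Icc 0 x ⊆ Ici 0)).congr
          fun τ _ => (add_sub_cancel_left _ _).symm
      exact this.intervalIntegrable_of_Icc hx
    have h3 : IntervalIntegrable (fun s => (x - s) • h s) volume 0 x := by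
      simpa using h1.add hz
    have h4 := intervalIntegral.integral_add hz.neg h3
    simp only [Pi.neg_apply] at h4
    rw [h4, intervalIntegral.integral_neg] at h2
    have h5 : ∫ τ in (0 : ℝ)..x, (c + ∫ s in (0 : ℝ)..(max τ 0), h s) =
        ∫ τ in (0 : ℝ)..x, (c + ∫ s in (0 : ℝ)..τ, h s) := by
      refine intervalIntegral.integral_congr fun τ hτ => ?_
      rw [uIcc_of_le hx] at hτ
      simp only [max_eq_left hτ.1]
    rw [hU x hx, h5, intervalIntegral.integral_add (by simp) hz]
    simp only [intervalIntegral.integral_const, sub_zero]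
    rw [add_assoc]
    congr 2
    exact (neg_add_eq_zero.1 h2.symm).symm
  refine ⟨hh, fun x hx => ?_, fun x hx => by simp⟩
  have := ((hc'.integral_hasStrictDerivAt 0 x).hasDerivAt.const_add a).hasDerivWithinAt (s := Ici 0)
  rw [max_eq_left hx] at this
  exact this.congr (fun s hs => hU' s hs) (hU' x hx)

/-! ### Green's formula and the adjoint of the minimal operator -/

section Green

variable {n : ℕ}

/-- The complex inner product of `ℂⁿ` as a real bilinear map. -/
def innerReal (n : ℕ) : Vec n →L[ℝ] Vec n →L[ℝ] ℂ :=
  LinearMap.mkContinuous₂ (LinearMap.mk₂ ℝ (fun v w : Vec n => inner ℂ v w)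
    (fun _ _ _ => inner_add_left _ _ _) (fun c v w => by
      rw [← algebraMap_smul ℂ c v, inner_smul_left]; simp)
    (fun _ _ _ => inner_add_right _ _ _) (fun c v w => by
      rw [← algebraMap_smul ℂ c w, inner_smul_right]; simp)) 1
    (fun v w => by simpa using norm_inner_le_norm (𝕜 := ℂ) v w)

@[simp] lemma innerReal_apply (v w : Vec n) : innerReal n v w = inner ℂ v w := rfl

namespace IsW21Loc

variable {y y₁ y₂ z z₁ z₂ : ℝ → Vec n}

lemma continuousOn_deriv (h : IsW21Loc y y₁ y₂) : ContinuousOn y₁ (Ici 0) := by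
  intro x hx
  have hx1 : (0 : ℝ) ≤ x + 1 := by linarith [mem_Ici.1 hx]
  have h1 := intervalIntegral.continuousOn_primitive_interval (a := 0) (b := x + 1) (μ := volume)
    (f := y₂) (by
      rw [uIcc_of_le hx1]
      exact (intervalIntegrable_iff_integrableOn_Icc_of_le hx1).1 (h.intervalIntegrable hx1))
  rw [uIcc_of_le hx1] at h1
  have h2 : ContinuousWithinAt (fun x => y₁ 0 + ∫ s in (0 : ℝ)..x, y₂ s) (Ici 0) x := by
    refine ((h1 x ⟨hx, by linarith⟩).mono_of_mem_nhdsWithin ?_).const_add _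
    filter_upwards [self_mem_nhdsWithin, mem_nhdsWithin_of_mem_nhds (Iio_mem_nhds (lt_add_one x))]
      with s h1 h2 using ⟨h1, h2.le⟩
  exact h2.congr (fun s hs => h.eq_integral s hs) (h.eq_integral x hx)

lemma eq_add_integral (h : IsW21Loc y y₁ y₂) {x : ℝ} (hx : 0 ≤ x) :
    y x = y 0 + ∫ s in (0 : ℝ)..x, y₁ s := by
  rw [HasDerivWithinAt.integral_eq_sub_Ici (fun s hs => h.hasDeriv s hs.1)
    (h.continuousOn_deriv.mono Icc_subset_Ici_self) le_rfl hx le_rfl]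
  abel

/-- The product rule for a bilinear pairing of `y` with the derivative of `z`. -/
lemma bilin_deriv {G : Type*} [NormedAddCommGroup G] [NormedSpace ℝ G] [CompleteSpace G]
    (B : Vec n →L[ℝ] Vec n →L[ℝ] G) (h : IsW21Loc y y₁ y₂) (k : IsW21Loc z z₁ z₂) {x : ℝ}
    (hx : 0 ≤ x) :
    IntervalIntegrable (fun s => B (y₁ s) (z₁ s) + B (y s) (z₂ s)) volume 0 x ∧
    B (y x) (z₁ x) = B (y 0) (z₁ 0) + ∫ s in (0 : ℝ)..x, (B (y₁ s) (z₁ s) + B (y s) (z₂ s)) :=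
  bilin_eq_add_integral B hx (fun s hs => h.hasDeriv s hs.1)
    (h.continuousOn_deriv.mono Icc_subset_Ici_self) (k.intervalIntegrable hx)
    (fun s hs => k.eq_integral s hs.1)

/-- Lagrange's identity. -/
lemma lagrange (h : IsW21Loc y y₁ y₂) (k : IsW21Loc z z₁ z₂) {x : ℝ} (hx : 0 ≤ x) :
    inner ℂ (y x) (z₁ x) - inner ℂ (y₁ x) (z x) =
      inner ℂ (y 0) (z₁ 0) - inner ℂ (y₁ 0) (z 0) +
        ∫ s in (0 : ℝ)..x, (inner ℂ (y s) (z₂ s) - inner ℂ (y₂ s) (z s)) := by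
  obtain ⟨hi, h1⟩ := bilin_deriv (innerReal n) h k hx
  obtain ⟨hi', h2⟩ := bilin_deriv (innerReal n).flip k h hx
  simp only [innerReal_apply, ContinuousLinearMap.flip_apply] at h1 h2 hi hi'
  rw [h1, h2, add_sub_add_comm, ← intervalIntegral.integral_sub hi hi']
  simp only [add_sub_add_left_eq_sub]

/-- `W²₁,loc` is stable under multiplication by `C²` functions. -/
lemma smul_fun {θ θ₁ θ₂ : ℝ → ℂ} (hθ : ∀ x, HasDerivAt θ (θ₁ x) x)
    (hθ₁ : ∀ x, HasDerivAt θ₁ (θ₂ x) x) (hθ₂ : Continuous θ₂) (h : IsW21Loc y y₁ y₂) :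
    IsW21Loc (fun x => θ x • y x) (fun x => θ₁ x • y x + θ x • y₁ x)
      (fun x => (θ₂ x • y x + θ₁ x • y₁ x) + (θ₁ x • y₁ x + θ x • y₂ x)) := by
  have c0 : Continuous θ := continuous_iff_continuousAt.2 fun x => (hθ x).continuousAt
  have c1 : Continuous θ₁ := continuous_iff_continuousAt.2 fun x => (hθ₁ x).continuousAt
  have hy := h.continuousOn
  have hy₁ := h.continuousOn_deriv
  have li1 : LocallyIntegrableOn (fun x => θ₂ x • y x + θ₁ x • y₁ x) (Ici 0) :=
    ContinuousOn.locallyIntegrableOn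
      ((hθ₂.continuousOn.smul hy).add (c1.continuousOn.smul hy₁)) measurableSet_Ici
  have li2 : LocallyIntegrableOn (fun x => θ₁ x • y₁ x) (Ici 0) :=
    ContinuousOn.locallyIntegrableOn (c1.continuousOn.smul hy₁) measurableSet_Ici
  have li3 : LocallyIntegrableOn (fun x => θ x • y₂ x) (Ici 0) :=
    h.locInt.continuousOn_smul isLocallyClosed_Ici c0.continuousOn
  refine ⟨li1.add (li2.add li3), fun x hx => ?_, fun x hx => ?_⟩
  · have := ((hθ x).hasDerivWithinAt (s := Ici 0)).smul (h.hasDeriv x hx)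
    rw [add_comm] at this
    exact this
  · obtain ⟨i1, e1⟩ := bilin_eq_add_integral
      (ContinuousLinearMap.lsmul ℝ ℂ : ℂ →L[ℝ] Vec n →L[ℝ] Vec n) hx
      (fun s _ => (hθ s).hasDerivWithinAt) c1.continuousOn (h.intervalIntegrable hx)
      (fun s hs => h.eq_integral s hs.1)
    obtain ⟨i2, e2⟩ := bilin_eq_add_integral
      (ContinuousLinearMap.lsmul ℝ ℂ : ℂ →L[ℝ] Vec n →L[ℝ] Vec n) hx
      (fun s _ => (hθ₁ s).hasDerivWithinAt) hθ₂.continuousOn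
      ((hy₁.mono Icc_subset_Ici_self).intervalIntegrable_of_Icc hx)
      (fun s hs => h.eq_add_integral hs.1)
    simp only [ContinuousLinearMap.lsmul_apply] at i1 e1 i2 e2
    rw [e1, e2, intervalIntegral.integral_add i2 i1]
    abel

end IsW21Loc

lemma inner_act {A : Matrix (Fin n) (Fin n) ℂ} (hA : A.IsHermitian) (v w : Vec n) :
    inner ℂ (act A v) w = inner ℂ v (act A w) := by
  have : IsSelfAdjoint (act A) := by
    have h : IsSelfAdjoint A := hA
    exact h.map (Matrix.toEuclideanCLM (n := Fin n) (𝕜 := ℂ))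
  exact this.isSymmetric v w

lemma tendsto_integral_mu {G : Type*} [NormedAddCommGroup G] [NormedSpace ℝ G] {f : ℝ → G}
    (hf : Integrable f mu) :
    Filter.Tendsto (fun x => ∫ s in (0 : ℝ)..x, f s) Filter.atTop (nhds (∫ s, f s ∂mu)) := by
  rw [integral_Ici_eq_integral_Ioi]
  exact intervalIntegral_tendsto_integral_Ioi 0
    (IntegrableOn.mono_set (s := Ioi 0) (t := Ici 0) hf Ioi_subset_Ici_self) Filter.tendsto_id

/-- Green's formula on the half-line, with an explicit boundary term at infinity. That the Wronskian
has a limit at infinity is part of the claim. -/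
lemma tendsto_lagrange {q : ℝ → Matrix (Fin n) (Fin n) ℂ}
    (hherm : ∀ᵐ x ∂mu, (q x).IsHermitian) {Y Z Y' Z' : Hil n} {y y₁ y₂ z z₁ z₂ : ℝ → Vec n}
    (h : IsW21Loc y y₁ y₂) (hY : Y =ᵐ[mu] y) (hZ : Z =ᵐ[mu] fun x => -y₂ x + act (q x) (y x))
    (k : IsW21Loc z z₁ z₂) (hY' : Y' =ᵐ[mu] z)
    (hZ' : Z' =ᵐ[mu] fun x => -z₂ x + act (q x) (z x)) :
    Filter.Tendsto (fun x => inner ℂ (y x) (z₁ x) - inner ℂ (y₁ x) (z x)) Filter.atTop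
      (nhds (inner ℂ (y 0) (z₁ 0) - inner ℂ (y₁ 0) (z 0) + (inner ℂ Z Y' - inner ℂ Y Z'))) := by
  have hi1 := L2.integrable_inner (𝕜 := ℂ) Z Y'
  have hi2 := L2.integrable_inner (𝕜 := ℂ) Y Z'
  have key : ∀ᵐ x ∂mu, inner ℂ (Z x) (Y' x) - inner ℂ (Y x) (Z' x) =
      inner ℂ (y x) (z₂ x) - inner ℂ (y₂ x) (z x) := by
    filter_upwards [hherm, hY, hZ, hY', hZ'] with x h0 h1 h2 h3 h4
    rw [h1, h2, h3, h4]
    simp only [inner_add_left, inner_add_right, inner_neg_left, inner_neg_right, inner_act h0]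
    ring
  rw [L2.inner_def, L2.inner_def, ← integral_sub hi1 hi2]
  refine ((tendsto_integral_mu (hi1.sub hi2)).const_add _).congr' ?_
  filter_upwards [Filter.eventually_ge_atTop 0] with x hx
  rw [h.lagrange k hx]
  congr 1
  refine intervalIntegral.integral_congr_ae ?_
  have := ae_imp_of_ae_restrict key
  filter_upwards [this] with s hs hs'
  rw [uIoc_of_le hx] at hs'
  exact hs (le_of_lt hs'.1)

/-- `LinearPMap.closure` is by convention the operator itself if that is not closable, so the
inclusion needs no closability. -/
lemma mem_closure_graph {q : ℝ → Matrix (Fin n) (Fin n) ℂ} {p : Hil n × Hil n}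
    (hp : p ∈ (L0 q).graph) : p ∈ closure (minGraph q : Set (Hil n × Hil n)) := by
  rw [← Lmin_graph]
  unfold L0 at hp
  by_cases hc : (Lmin q).IsClosable
  · rw [← hc.graph_closure_eq_closure_graph] at hp
    exact hp
  · rw [LinearPMap.closure_def' hc] at hp
    exact subset_closure hp

/-- `Dom L_max` is contained in `Dom L₀*`. The domain of the adjoint consists of the elements whose
pairing with the values of `L₀` is continuous, and here this pairing is `(L₀ v, Y) = (v, Z)`: true
on the graph of `L_min` by Green's formula, and on its closure by continuity. -/
lemma mem_adjoint_domain {q : ℝ → Matrix (Fin n) (Fin n) ℂ}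
    (hherm : ∀ᵐ x ∂mu, (q x).IsHermitian) {Y Z : Hil n} {y : ℝ → Vec n} (h : MaxRel q Y Z y) :
    Y ∈ (L0 q)†.domain := by
  refine LinearPMap.mem_adjoint_domain_of_exists _ ⟨Z, fun p => ?_⟩
  have hclosed : IsClosed {p : Hil n × Hil n | inner ℂ Z p.1 = inner ℂ Y p.2} :=
    isClosed_eq (by fun_prop) (by fun_prop)
  have hsub : (minGraph q : Set (Hil n × Hil n)) ⊆ {p | inner ℂ Z p.1 = inner ℂ Y p.2} := by
    rintro ⟨Y', Z'⟩ ⟨z, ⟨z₁, z₂, k, hY', hZ'⟩, a, b, ha, hab⟩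
    obtain ⟨y₁, y₂, hy, hY, hZ⟩ := h
    have hz0 : z 0 = 0 := hab 0 le_rfl fun hh => by linarith [hh.1]
    have hz1 : ∀ x, 0 ≤ x → x ∉ Icc a b → z₁ x = 0 := by
      intro x hx hx'
      have h1 := k.hasDeriv x hx
      have h2 : HasDerivWithinAt z 0 (Ici 0) x := by
        refine (hasDerivWithinAt_const x (Ici 0) (0 : Vec n)).congr_of_eventuallyEq ?_
          (hab x hx hx')
        filter_upwards [self_mem_nhdsWithin, mem_nhdsWithin_of_mem_nhds
          (isClosed_Icc.isOpen_compl.mem_nhds hx')] with s h1 h2 using hab s h1 h2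
      exact (uniqueDiffOn_Ici 0 x hx).eq_deriv _ h1 h2
    have h3 := tendsto_lagrange hherm hy hY hZ k hY' hZ'
    rw [hz0, hz1 0 le_rfl fun hh => by linarith [hh.1]] at h3
    have h4 := tendsto_nhds_unique h3 (tendsto_const_nhds.congr' (f₁ := fun _ => (0 : ℂ)) (by
      filter_upwards [Filter.eventually_gt_atTop b, Filter.eventually_ge_atTop 0] with x hx hx0
      rw [hz1 x hx0 fun hh => by linarith [hh.2], hab x hx0 fun hh => by linarith [hh.2]]
      simp))
    simp only [inner_zero_right, sub_self, zero_add] at h4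
    exact sub_eq_zero.1 h4
  exact (hclosed.closure_subset_iff.2 hsub) (mem_closure_graph ((L0 q).mem_graph p))

lemma mem_Lmax_domain {q : ℝ → Matrix (Fin n) (Fin n) ℂ} {Y : Hil n} :
    Y ∈ (Lmax q).domain ↔ ∃ Z y, MaxRel q Y Z y := by
  rw [Lmax, Submodule.toLinearPMap_domain]
  simp [maxGraph]

/-- The form of `L_min` is nonnegative if `L₀` is positive definite. -/
lemma PosDef.re_inner_nonneg {q : ℝ → Matrix (Fin n) (Fin n) ℂ} (hpos : PosDef (L0 q))
    {p : Hil n × Hil n} (hp : p ∈ minGraph q) : 0 ≤ RCLike.re (inner ℂ p.2 p.1) := by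
  obtain ⟨κ, hκ, H⟩ := hpos
  have h1 : p ∈ (L0 q).graph := by
    rw [← Lmin_graph] at hp
    exact LinearPMap.le_graph_of_le (LinearPMap.le_closure _) hp
  obtain ⟨v, hv1, hv2⟩ := (LinearPMap.mem_graph_iff _).1 h1
  rw [← hv1, ← hv2]
  exact le_trans (by positivity) (H v)

end Green

/-! ### The limit point case at infinity -/

section LimitPoint

variable {n : ℕ}

lemma memLp_of_bounded_support {φ : ℝ → Vec n} {b C : ℝ} (hm : AEStronglyMeasurable φ mu)
    (hC : ∀ x ∈ Icc 0 b, ‖φ x‖ ≤ C) (h0 : ∀ x, 0 ≤ x → b < x → φ x = 0) : MemLp φ 2 mu := by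
  have h1 : MemLp ((Icc 0 b).indicator φ) 2 mu := by
    rw [memLp_indicator_iff_restrict measurableSet_Icc]
    have : IsFiniteMeasure (mu.restrict (Icc 0 b)) := ⟨by
      refine (Measure.restrict_apply_univ (μ := mu) (Icc 0 b)).trans_lt ?_
      exact (Measure.restrict_apply_le _ _).trans_lt measure_Icc_lt_top⟩
    exact MemLp.of_bound hm.restrict C ((ae_restrict_iff' measurableSet_Icc).2
      (.of_forall hC))
  refine (memLp_congr_ae ?_).1 h1
  filter_upwards [ae_restrict_mem measurableSet_Ici] with x hx
  by_cases hb : x ≤ b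
  · rw [indicator_of_mem (show x ∈ Icc 0 b from ⟨hx, hb⟩)]
  · rw [indicator_of_notMem (fun h => hb h.2), h0 x hx (not_le.1 hb)]

lemma memLp_of_continuousOn {φ : ℝ → Vec n} {b : ℝ} (hc : ContinuousOn φ (Ici 0))
    (h0 : ∀ x, 0 ≤ x → b < x → φ x = 0) : MemLp φ 2 mu := by
  obtain ⟨C, hC⟩ := isCompact_Icc.exists_bound_of_continuousOn
    (hc.mono (Icc_subset_Ici_self : Icc 0 b ⊆ Ici 0))
  exact memLp_of_bounded_support (hc.aestronglyMeasurable measurableSet_Ici) hC h0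

/-- Multiplication of a function from the maximal domain by a `C²` function with compact support in
`(0, ∞)` leads into the minimal domain. -/
lemma smul_mem_minGraph {q : ℝ → Matrix (Fin n) (Fin n) ℂ} {Y Z : Hil n} {y y₁ y₂ : ℝ → Vec n}
    (h : IsW21Loc y y₁ y₂) (hY : Y =ᵐ[mu] y) (hZ : Z =ᵐ[mu] fun x => -y₂ x + act (q x) (y x))
    {θ θ₁ θ₂ : ℝ → ℂ} (hθ : ∀ x, HasDerivAt θ (θ₁ x) x) (hθ₁ : ∀ x, HasDerivAt θ₁ (θ₂ x) x)
    (hθ₂ : Continuous θ₂) {a b : ℝ} (ha : 0 < a) (hab : ∀ x, x ∉ Icc a b → θ x = 0) :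
    ∃ p ∈ minGraph q, p.1 =ᵐ[mu] (fun x => θ x • Y x) ∧
      p.2 =ᵐ[mu] fun x => θ x • Z x - (2 * θ₁ x) • y₁ x - θ₂ x • y x := by
  have c0 : Continuous θ := continuous_iff_continuousAt.2 fun x => (hθ x).continuousAt
  have c1 : Continuous θ₁ := continuous_iff_continuousAt.2 fun x => (hθ₁ x).continuousAt
  have z1 : ∀ x, x ∉ Icc a b → θ₁ x = 0 := fun x hx => by
    refine (hθ x).unique ((hasDerivAt_const x (0 : ℂ)).congr_of_eventuallyEq ?_)
    filter_upwards [isClosed_Icc.isOpen_compl.mem_nhds hx] with s hs using hab s hs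
  have z2 : ∀ x, x ∉ Icc a b → θ₂ x = 0 := fun x hx => by
    refine (hθ₁ x).unique ((hasDerivAt_const x (0 : ℂ)).congr_of_eventuallyEq ?_)
    filter_upwards [isClosed_Icc.isOpen_compl.mem_nhds hx] with s hs using z1 s hs
  have m1 : MemLp (fun x => θ x • y x) 2 mu :=
    memLp_of_continuousOn (b := b) (c0.continuousOn.smul h.continuousOn)
      fun x _ hb => by rw [hab x fun hh => by linarith [hh.2], zero_smul]
  have m2 : MemLp (fun x => (2 * θ₁ x) • y₁ x + θ₂ x • y x) 2 mu :=
    memLp_of_continuousOn (b := b) (((continuous_const.mul c1).continuousOn.smul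
      h.continuousOn_deriv).add (hθ₂.continuousOn.smul h.continuousOn))
      fun x _ hb => by
        rw [z1 x fun hh => by linarith [hh.2], z2 x fun hh => by linarith [hh.2]]; simp
  obtain ⟨C, hC⟩ := isCompact_Icc.exists_bound_of_continuousOn (c0.continuousOn (s := Icc a b))
  have m3 : MemLp (fun x => θ x • Z x) 2 mu := by
    refine MemLp.of_le_mul (c := max C 0) (Lp.memLp Z)
      (c0.aestronglyMeasurable.smul (Lp.aestronglyMeasurable Z)) (.of_forall fun x => ?_)
    rw [norm_smul]
    gcongr
    by_cases hx : x ∈ Icc a b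
    · exact (hC x hx).trans (le_max_left _ _)
    · rw [hab x hx, norm_zero]; exact le_max_right _ _
  refine ⟨(m1.toLp _, (m3.sub m2).toLp _), ⟨fun x => θ x • y x, ⟨_, _, h.smul_fun hθ hθ₁ hθ₂,
    m1.coeFn_toLp, ?_⟩, a, b, ha, fun x _ hx => by simp only [hab x hx, zero_smul]⟩, ?_, ?_⟩
  · filter_upwards [(m3.sub m2).coeFn_toLp, hZ] with x h1 h2
    rw [h1]
    simp only [Pi.sub_apply, h2, map_smul, smul_add, smul_neg, two_mul, add_smul]
    abel
  · filter_upwards [m1.coeFn_toLp, hY] with x h1 h2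
    rw [h1, h2]
  · filter_upwards [(m3.sub m2).coeFn_toLp] with x h1
    rw [h1]
    simp only [Pi.sub_apply]
    abel

lemma integrable_of_continuousOn {φ : ℝ → ℝ} {b : ℝ} (hc : ContinuousOn φ (Ici 0))
    (h0 : ∀ x, 0 ≤ x → b < x → φ x = 0) : Integrable φ mu :=
  (((hc.mono (Icc_subset_Ici_self : Icc 0 b ⊆ Ici 0)).integrableOn_Icc
    (μ := volume)).of_forall_sdiff_eq_zero (t := Ici 0) measurableSet_Ici
    fun x hx => h0 x hx.1 (not_le.1 fun h => hx.2 ⟨hx.1, h⟩))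

/-- The integrand of `(L v, v)` for `v = c e^{iεx} g`, in terms of that of `(L g, g)`. Besides the
local terms that do not contain the derivative `g₁`, there is the flux `2 ε c² Im (g, g₁)` produced
by the oscillating factor, and the derivative of `c c₁ ‖g‖²`. Here `ε² = 1` is used in the
coefficient of the second derivative of the factor. -/
lemma re_inner_cutoff_mul_exp (Zv g g₁ : Vec n) (c c₁ c₂ ε x : ℝ) :
    RCLike.re (inner ℂ
      (((c : ℂ) * Complex.exp (ε * x * Complex.I)) • Zv -
        (2 * (((c₁ : ℂ) + c * ε * Complex.I) * Complex.exp (ε * x * Complex.I))) • g₁ -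
        (((c₂ : ℂ) + 2 * c₁ * ε * Complex.I - c) * Complex.exp (ε * x * Complex.I)) • g)
      (((c : ℂ) * Complex.exp (ε * x * Complex.I)) • g)) =
    c ^ 2 * RCLike.re (inner ℂ Zv g) + 2 * ε * c ^ 2 * RCLike.im (inner ℂ g g₁) +
      (c₁ ^ 2 + c ^ 2) * ‖g‖ ^ 2 -
      ((c₁ * c₁ + c * c₂) * ‖g‖ ^ 2 + c * c₁ * (2 * RCLike.re (inner ℂ g g₁))) := by
  have he : (starRingEnd ℂ) (Complex.exp (ε * x * Complex.I)) *
      Complex.exp (ε * x * Complex.I) = 1 := by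
    rw [← Complex.exp_conj, ← Complex.exp_add]
    simp
  have hs : inner ℂ g₁ g = (starRingEnd ℂ) (inner ℂ g g₁) := (inner_conj_symm _ _).symm
  set e := Complex.exp (ε * x * Complex.I)
  have hv : ((c : ℂ) * e) • Zv - (2 * (((c₁ : ℂ) + c * ε * Complex.I) * e)) • g₁ -
      (((c₂ : ℂ) + 2 * c₁ * ε * Complex.I - c) * e) • g =
      e • ((c : ℂ) • Zv - (2 * ((c₁ : ℂ) + c * ε * Complex.I)) • g₁ -
        ((c₂ : ℂ) + 2 * c₁ * ε * Complex.I - c) • g) := by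
    module
  have hw : ((c : ℂ) * e) • g = e • (c : ℂ) • g := by rw [smul_smul, mul_comm]
  rw [hv, hw, inner_smul_left, inner_smul_right, ← mul_assoc, he, one_mul]
  simp only [inner_sub_left, inner_smul_left, inner_smul_right, map_mul, hs,
    inner_self_eq_norm_sq_to_K]
  -- an identity between the real and the imaginary parts of the two remaining inner products
  generalize inner ℂ Zv g = A
  generalize inner ℂ g g₁ = P
  simp [pow_two]
  ring_nf

/-- The inequality that positivity of `L₀` gives for the function `χ e^{iεx} y` with `ε = ± 1`. -/
lemma cutoff_inequality {q : ℝ → Matrix (Fin n) (Fin n) ℂ} (hpos : PosDef (L0 q)) {Y Z : Hil n}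
    {y y₁ y₂ : ℝ → Vec n} (h : IsW21Loc y y₁ y₂) (hY : Y =ᵐ[mu] y)
    (hZ : Z =ᵐ[mu] fun x => -y₂ x + act (q x) (y x))
    {χ χ₁ χ₂ : ℝ → ℝ} (hχ : ∀ x, HasDerivAt χ (χ₁ x) x) (hχ₁ : ∀ x, HasDerivAt χ₁ (χ₂ x) x)
    (hχ₂ : Continuous χ₂) {a b ε : ℝ} (ha : 0 < a) (hab : ∀ x, x ∉ Icc a b → χ x = 0)
    (hε : ε ^ 2 = 1) :
    Integrable (fun x => χ x ^ 2 * RCLike.re (inner ℂ (Z x) (Y x)) +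
      2 * ε * χ x ^ 2 * RCLike.im (inner ℂ (y x) (y₁ x)) +
      (χ₁ x ^ 2 + χ x ^ 2) * ‖Y x‖ ^ 2) mu ∧
    0 ≤ ∫ x, (χ x ^ 2 * RCLike.re (inner ℂ (Z x) (Y x)) +
      2 * ε * χ x ^ 2 * RCLike.im (inner ℂ (y x) (y₁ x)) +
      (χ₁ x ^ 2 + χ x ^ 2) * ‖Y x‖ ^ 2) ∂mu := by
  have c0 : Continuous χ := continuous_iff_continuousAt.2 fun x => (hχ x).continuousAt
  have c1 : Continuous χ₁ := continuous_iff_continuousAt.2 fun x => (hχ₁ x).continuousAt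
  have he : ∀ x : ℝ, HasDerivAt (fun x : ℝ => Complex.exp (ε * x * Complex.I))
      (ε * Complex.I * Complex.exp (ε * x * Complex.I)) x := fun x => by
    have h1 : HasDerivAt (fun x : ℝ => (ε * x * Complex.I : ℂ)) (ε * Complex.I) x := by
      have := ((Complex.ofRealCLM.hasDerivAt (x := x)).const_mul (ε : ℂ)).mul_const Complex.I
      simpa using this
    have := h1.cexp
    rwa [mul_comm] at this
  have hε' : (ε : ℂ) ^ 2 = 1 := by exact_mod_cast hε
  obtain ⟨p, hp, hp1, hp2⟩ := smul_mem_minGraph (a := a) (b := b) h hY hZ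
    (θ := fun x => (χ x : ℂ) * Complex.exp (ε * x * Complex.I))
    (θ₁ := fun x => ((χ₁ x : ℂ) + χ x * ε * Complex.I) * Complex.exp (ε * x * Complex.I))
    (θ₂ := fun x => ((χ₂ x : ℂ) + 2 * χ₁ x * ε * Complex.I - χ x) *
      Complex.exp (ε * x * Complex.I))
    (fun x => by
      have := (hχ x).ofReal_comp.mul (he x)
      refine this.congr_deriv ?_
      ring)
    (fun x => by
      have := ((hχ₁ x).ofReal_comp.add (((hχ x).ofReal_comp.mul_const (ε : ℂ)).mul_const
        Complex.I)).mul (he x)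
      refine this.congr_deriv ?_
      simp only [Pi.add_apply]
      linear_combination (χ x : ℂ) * Complex.exp (ε * x * Complex.I) *
        (Complex.I ^ 2 * hε' + Complex.I_sq))
    (by fun_prop) ha (fun x hx => by simp [hab x hx])
  have hpos' := hpos.re_inner_nonneg hp
  have hint := (L2.integrable_inner (𝕜 := ℂ) p.2 p.1).re
  rw [L2.inner_def, ← integral_re (L2.integrable_inner p.2 p.1)] at hpos'
  have z1 : ∀ x, x ∉ Icc a b → χ x = 0 ∧ χ₁ x = 0 := fun x hx => by
    refine ⟨hab x hx, (hχ x).unique ((hasDerivAt_const x (0 : ℝ)).congr_of_eventuallyEq ?_)⟩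
    filter_upwards [isClosed_Icc.isOpen_compl.mem_nhds hx] with s hs using hab s hs
  -- the part of the integrand that is a derivative, of `χ χ₁ ‖y‖²`, and integrates to zero
  set D : ℝ → ℝ := fun x => (χ₁ x * χ₁ x + χ x * χ₂ x) * ‖y x‖ ^ 2 +
    χ x * χ₁ x * (2 * RCLike.re (inner ℂ (y x) (y₁ x))) with hD
  have hy := h.continuousOn
  have hy₁ := h.continuousOn_deriv
  have hDc : ContinuousOn D (Ici 0) :=
    (((c1.mul c1).add (c0.mul hχ₂)).continuousOn.mul (hy.norm.pow 2)).add
      ((c0.mul c1).continuousOn.mul (continuousOn_const.mul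
        (RCLike.continuous_re.comp_continuousOn (ContinuousOn.inner (𝕜 := ℂ) hy hy₁))))
  have hDi : Integrable D mu := by
    refine integrable_of_continuousOn (b := b) hDc fun x _ hx => ?_
    obtain ⟨h1, h2⟩ := z1 x fun hh => by linarith [hh.2]
    simp [hD, h1, h2]
  have hDd : ∀ x ∈ Ici (0 : ℝ), HasDerivWithinAt (fun x => χ x * χ₁ x * ‖y x‖ ^ 2)
      (D x) (Ici 0) x := by
    intro x hx
    have h0 : HasDerivWithinAt (fun x => ‖y x‖ ^ 2) (2 * RCLike.re (inner ℂ (y x) (y₁ x)))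
        (Ici 0) x := by
      have h2 := Complex.reCLM.hasFDerivAt.comp_hasDerivWithinAt x
        ((h.hasDeriv x hx).inner ℂ (h.hasDeriv x hx))
      refine (h2.congr_deriv ?_).congr (fun s _ => ?_) ?_
      · rw [← inner_conj_symm (y₁ x) (y x)]
        simp only [map_add, Complex.reCLM_apply, Complex.conj_re, two_mul, RCLike.re_to_complex]
      · exact (inner_self_eq_norm_sq (𝕜 := ℂ) _).symm
      · exact (inner_self_eq_norm_sq (𝕜 := ℂ) _).symm
    exact (((hχ x).mul (hχ₁ x)).hasDerivWithinAt (s := Ici 0)).mul h0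
  have hD0 : ∫ x, D x ∂mu = 0 := by
    refine tendsto_nhds_unique (tendsto_integral_mu hDi) (tendsto_const_nhds.congr' ?_)
    filter_upwards [Filter.eventually_gt_atTop b, Filter.eventually_ge_atTop 0] with x hx hx0
    rw [HasDerivWithinAt.integral_eq_sub_Ici (fun s hs => hDd s hs.1)
      (hDc.mono Icc_subset_Ici_self) le_rfl hx0 le_rfl, hab x fun hh => by linarith [hh.2],
      hab 0 fun hh => by linarith [hh.1]]
    simp
  have hae : ∀ᵐ x ∂mu, χ x ^ 2 * RCLike.re (inner ℂ (Z x) (Y x)) +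
      2 * ε * χ x ^ 2 * RCLike.im (inner ℂ (y x) (y₁ x)) +
      (χ₁ x ^ 2 + χ x ^ 2) * ‖Y x‖ ^ 2 = RCLike.re (inner ℂ (p.2 x) (p.1 x)) + D x := by
    filter_upwards [hp1, hp2, hY] with x h1 h2 h3
    rw [h1, h2, h3, re_inner_cutoff_mul_exp]
    simp only [hD]
    ring
  refine ⟨(hint.add hDi).congr (hae.mono fun x hx => hx.symm), ?_⟩
  rw [integral_congr_ae hae, integral_add hint hDi, hD0, add_zero]
  exact hpos'

/-- A twice continuously differentiable cutoff function, with its derivatives. -/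
lemma exists_plateau : ∃ (φ φ₁ φ₂ : ℝ → ℝ) (M : ℝ), (∀ x, HasDerivAt φ (φ₁ x) x) ∧
    (∀ x, HasDerivAt φ₁ (φ₂ x) x) ∧ Continuous φ₂ ∧ (∀ x, φ x ∈ Icc (0 : ℝ) 1) ∧
    (∀ x, |φ₁ x| ≤ M) ∧ (∀ x ∈ Icc (-1 : ℝ) 1, φ x = 1) ∧ ∀ x, x ∉ Icc (-2 : ℝ) 2 → φ x = 0 := by
  let b : ContDiffBump (0 : ℝ) := ⟨1, 2, one_pos, one_lt_two⟩
  have hb : ContDiff ℝ 2 b := b.contDiff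
  have hd : ContDiff ℝ 1 (deriv b) := (contDiff_succ_iff_deriv (n := 1).1 hb).2.2
  obtain ⟨M, hM⟩ := (b.hasCompactSupport.deriv).exists_bound_of_continuous hd.continuous
  refine ⟨b, deriv b, deriv (deriv b), M, fun x => (hb.differentiable (by simp) x).hasDerivAt,
    fun x => (hd.differentiable (by simp) x).hasDerivAt, hd.continuous_deriv le_rfl,
    fun x => ⟨b.nonneg, b.le_one⟩, hM, fun x hx => b.one_of_mem_closedBall ?_, fun x hx => ?_⟩
  · rw [Real.closedBall_eq_Icc]; simpa [b] using hx
  · refine b.zero_of_le_dist ?_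
    rw [Real.dist_eq, sub_zero]
    by_contra hc
    exact hx (abs_le.1 (not_le.1 hc).le)

/-- For `y` in the domain of `L_max` with `y(0) = 0`, the number `(L_max y, y)` is real. This says
that `L_max` is of limit point type at infinity.

By Green's formula `Im (y, y')` tends at infinity to `J = Im (L_max y, y)`. In the inequality
`cutoff_inequality` for a cutoff function that is one on an interval of length `2 R` far out, the
flux term contributes about `4 ε J R`, while the other terms are bounded by the norms of `y` and
`L_max y`, independently of `R`. With the sign `ε` for which `ε J < 0` this is a contradiction for
large `R`, unless `J = 0`. -/
lemma inner_self_symm_of_dirichlet {q : ℝ → Matrix (Fin n) (Fin n) ℂ}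
    (hherm : ∀ᵐ x ∂mu, (q x).IsHermitian) (hpos : PosDef (L0 q)) {Y Z : Hil n} {y : ℝ → Vec n}
    (h : MaxRel q Y Z y) (h0 : y 0 = 0) : inner ℂ Z Y = inner ℂ Y Z := by
  obtain ⟨y₁, y₂, hy, hY, hZ⟩ := h
  have hlim := tendsto_lagrange hherm hy hY hZ hy hY hZ
  simp only [h0, inner_zero_left, inner_zero_right, sub_self, zero_add] at hlim
  have hz : ∀ v w : Vec n, inner ℂ v w - inner ℂ w v = 2 * RCLike.im (inner ℂ v w) * Complex.I :=
    fun v w => by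
      rw [← inner_conj_symm w v, Complex.sub_conj]
      simp
  have hz' : inner ℂ Z Y - inner ℂ Y Z = 2 * RCLike.im (inner ℂ Z Y) * Complex.I := by
      rw [← inner_conj_symm Y Z, Complex.sub_conj]
      simp
  simp only [hz, hz'] at hlim
  have hlim' : Filter.Tendsto (fun x => RCLike.im (inner ℂ (y x) (y₁ x))) Filter.atTop
      (nhds (RCLike.im (inner ℂ Z Y))) := by
    have := ((Complex.continuous_im.tendsto _).comp hlim).div_const 2
    simpa using this
  by_contra hne
  set J := RCLike.im (inner ℂ Z Y) with hJ
  have hJ0 : J ≠ 0 := fun hh => hne (by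
    rw [← sub_eq_zero, hz', hh]; simp)
  obtain ⟨ε, hε, hεJ⟩ : ∃ ε : ℝ, ε ^ 2 = 1 ∧ ε * J < 0 := by
    rcases lt_or_gt_of_ne hJ0 with hlt | hgt
    · exact ⟨1, by norm_num, by linarith⟩
    · exact ⟨-1, by norm_num, by linarith⟩
  obtain ⟨m, hm1, hm2⟩ := exists_between hεJ
  obtain ⟨X, hX⟩ := Filter.eventually_atTop.1 ((hlim'.const_mul ε).eventually_lt_const hm1)
  obtain ⟨φ, φ₁, φ₂, M, d1, d2, c2, hφ, hM, hp1, hp0⟩ := exists_plateau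
  have hYi : Integrable (fun x => ‖Y x‖ ^ 2) mu := (Lp.memLp Y).integrable_norm_pow two_ne_zero
  have hRi := (L2.integrable_inner (𝕜 := ℂ) Z Y).norm
  set K := (∫ x, ‖inner ℂ (Z x) (Y x)‖ ∂mu) + (M ^ 2 + 1) * ∫ x, ‖Y x‖ ^ 2 ∂mu with hK
  obtain ⟨R, hR1, hR⟩ : ∃ R : ℝ, 1 ≤ R ∧ K + 4 * m * R < 0 := by
    refine ⟨max 1 ((K + 1) / (-4 * m)), le_max_left _ _, ?_⟩
    have h4 : 0 < -4 * m := by linarith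
    have := (div_le_iff₀ h4).1 (le_max_right 1 ((K + 1) / (-4 * m)))
    linarith
  have hR0 : 0 < R := by linarith
  -- the support `[c - 2R, c + 2R]` of the cutoff function lies to the right of `X` and of `0`
  set c := max X 0 + 2 * R + 1 with hc
  obtain ⟨hcutI, hcut⟩ := cutoff_inequality hpos hy hY hZ (χ := fun x => φ ((x - c) / R))
    (χ₁ := fun x => φ₁ ((x - c) / R) * (1 / R))
    (χ₂ := fun x => φ₂ ((x - c) / R) * (1 / R) * (1 / R))
    (a := max X 0 + 1) (b := c + 2 * R) (ε := ε)
    (fun x => (d1 _).comp x (((hasDerivAt_id x).sub_const c).div_const R))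
    (fun x => ((d2 _).comp x (((hasDerivAt_id x).sub_const c).div_const R)).mul_const _)
    (by fun_prop) (by positivity) (fun x hx => hp0 _ fun hh => hx (by
      obtain ⟨h1, h2⟩ := hh
      rw [le_div_iff₀ hR0] at h1
      rw [div_le_iff₀ hR0] at h2
      constructor <;> linarith)) hε
  have hI : Integrable ((Icc (c - R) (c + R)).indicator (fun _ => 2 * m)) mu :=
    (integrable_indicator_iff measurableSet_Icc).2 (integrableOn_const (by
      exact ((Measure.restrict_apply_le _ _).trans_lt measure_Icc_lt_top).ne))
  have hle : ∫ x, (φ ((x - c) / R) ^ 2 * RCLike.re (inner ℂ (Z x) (Y x)) +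
      2 * ε * φ ((x - c) / R) ^ 2 * RCLike.im (inner ℂ (y x) (y₁ x)) +
      ((φ₁ ((x - c) / R) * (1 / R)) ^ 2 + φ ((x - c) / R) ^ 2) * ‖Y x‖ ^ 2) ∂mu ≤
      ∫ x, (‖inner ℂ (Z x) (Y x)‖ + (M ^ 2 + 1) * ‖Y x‖ ^ 2 +
        (Icc (c - R) (c + R)).indicator (fun _ => 2 * m) x) ∂mu := by
    refine integral_mono_ae hcutI ((hRi.add (hYi.const_mul _)).add hI) ?_
    refine .of_forall fun x => ?_
    have b0 := hφ ((x - c) / R)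
    have b1 : φ ((x - c) / R) ^ 2 ≤ 1 := pow_le_one₀ b0.1 b0.2
    have t1 : φ ((x - c) / R) ^ 2 * RCLike.re (inner ℂ (Z x) (Y x)) ≤ ‖inner ℂ (Z x) (Y x)‖ := by
      calc _ ≤ φ ((x - c) / R) ^ 2 * ‖inner ℂ (Z x) (Y x)‖ := by
            gcongr; exact RCLike.re_le_norm _
        _ ≤ ‖inner ℂ (Z x) (Y x)‖ := mul_le_of_le_one_left (norm_nonneg _) b1
    have t2 : 2 * ε * φ ((x - c) / R) ^ 2 * RCLike.im (inner ℂ (y x) (y₁ x)) ≤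
        (Icc (c - R) (c + R)).indicator (fun _ => 2 * m) x := by
      have e1 : 2 * ε * φ ((x - c) / R) ^ 2 * RCLike.im (inner ℂ (y x) (y₁ x)) =
          2 * φ ((x - c) / R) ^ 2 * (ε * RCLike.im (inner ℂ (y x) (y₁ x))) := by ring
      have e2 : 2 * φ ((x - c) / R) ^ 2 * (ε * RCLike.im (inner ℂ (y x) (y₁ x))) ≤
          2 * φ ((x - c) / R) ^ 2 * m := by
        by_cases hx : X ≤ x
        · gcongr
          exact (hX x hx).le
        · rw [hp0 _ fun hh => hx ?_]
          · simp
          · have := (le_div_iff₀ hR0).1 hh.1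
            have := le_max_left X 0
            linarith
      rw [e1]
      refine e2.trans ?_
      by_cases hx : x ∈ Icc (c - R) (c + R)
      · rw [indicator_of_mem hx, hp1 _ ⟨?_, ?_⟩]
        · simp
        · rw [le_div_iff₀ hR0]; linarith [hx.1]
        · rw [div_le_iff₀ hR0]; linarith [hx.2]
      · rw [indicator_of_notMem hx]
        have : 0 ≤ 2 * φ ((x - c) / R) ^ 2 := by positivity
        exact mul_nonpos_of_nonneg_of_nonpos this hm2.le
    have t3 : ((φ₁ ((x - c) / R) * (1 / R)) ^ 2 + φ ((x - c) / R) ^ 2) * ‖Y x‖ ^ 2 ≤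
        (M ^ 2 + 1) * ‖Y x‖ ^ 2 := by
      have b2 : (φ₁ ((x - c) / R) * (1 / R)) ^ 2 ≤ M ^ 2 := by
        have h1 := hM ((x - c) / R)
        have h2 : |φ₁ ((x - c) / R) * (1 / R)| ≤ M := by
          rw [abs_mul, abs_of_pos (by positivity : 0 < 1 / R)]
          calc _ ≤ |φ₁ ((x - c) / R)| * 1 := by
                gcongr; exact (div_le_one hR0).2 hR1
            _ ≤ M := by linarith
        exact sq_le_sq' (abs_le.1 h2).1 (abs_le.1 h2).2
      gcongr
    beta_reduce
    linarith
  have hsum : ∫ x, (‖inner ℂ (Z x) (Y x)‖ + (M ^ 2 + 1) * ‖Y x‖ ^ 2 +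
        (Icc (c - R) (c + R)).indicator (fun _ => 2 * m) x) ∂mu =
      K + ∫ x, (Icc (c - R) (c + R)).indicator (fun _ => 2 * m) x ∂mu := by
    rw [hK, ← integral_const_mul, ← integral_add hRi (hYi.const_mul _)]
    exact integral_add (hRi.add (hYi.const_mul _)) hI
  rw [hsum, integral_indicator measurableSet_Icc] at hle
  have hv : ∫ x in Icc (c - R) (c + R), 2 * m ∂mu = 4 * m * R := by
    rw [Measure.restrict_restrict measurableSet_Icc,
      inter_eq_left.2 fun x hx => mem_Ici.2 (by
        have := hx.1
        have := le_max_right X 0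
        linarith)]
    simp [hR0.le]
    ring
  rw [hv] at hle
  linarith

end LimitPoint

/-! ### Uniqueness for the wave equation -/

section Abstract

variable {H : Type*} [NormedAddCommGroup H] [InnerProductSpace ℂ H] {d d₁ d₂ : ℝ → H} {T : ℝ}

lemma eq_of_hasDerivAt_zero {G : Type*} [NormedAddCommGroup G] [NormedSpace ℝ G] [CompleteSpace G]
    {Φ : ℝ → G} {a b : ℝ} (hab : a ≤ b) (hc : ContinuousOn Φ (Icc a b))
    (hd : ∀ x ∈ Ioo a b, HasDerivAt Φ 0 x) : Φ b = Φ a := by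
  have := intervalIntegral.integral_eq_sub_of_hasDerivAt_of_le hab hc hd (by simp)
  simp only [intervalIntegral.integral_zero] at this
  exact (sub_eq_zero.1 this.symm)

/-- One step of the uniqueness argument: the symmetry of `d ↦ d₂` makes
`(ḋ(τ), d(S - τ)) + (d(τ), ḋ(S - τ))` independent of `τ`, and for `τ = S / 2` this is the derivative
of `‖d‖²` at `S / 2`. In contrast to the energy, this expression does not contain `d₂` and does not
need differentiability of `(d₂, d)`. -/
lemma wave_zero_step
    (hd : ∀ t ∈ Icc 0 T, HasDerivWithinAt d (d₁ t) (Icc 0 T) t) (hc : ContinuousOn d₁ (Icc 0 T))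
    (hd₁ : ∀ t ∈ Ioo 0 T, HasDerivAt d₁ (d₂ t) t)
    (hsymm : ∀ s ∈ Ioo 0 T, ∀ t ∈ Ioo 0 T, inner ℂ (d₂ s) (d t) = inner ℂ (d s) (d₂ t))
    {a : ℝ} (ha : 0 ≤ a) (haT : a < T) (h0 : ∀ t ∈ Icc 0 a, d t = 0 ∧ d₁ t = 0) :
    ∀ t ∈ Icc 0 ((a + T) / 2), d t = 0 ∧ d₁ t = 0 := by
  have hdc : ContinuousOn d (Icc 0 T) := fun t ht => (hd t ht).continuousWithinAt
  have hd' : ∀ t ∈ Ioo 0 T, HasDerivAt d (d₁ t) t := fun t ht =>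
    (hd t (Ioo_subset_Icc_self ht)).hasDerivAt (Icc_mem_nhds ht.1 ht.2)
  have key : ∀ s ∈ Ioc 0 ((a + T) / 2), inner ℂ (d₁ s) (d s) + inner ℂ (d s) (d₁ s) = 0 := by
    intro s hs
    -- `τ` runs from `τ₀` to `s`, so that `2 * s - τ` stays below `T`; and `τ₀ ≤ a`, where `d`
    -- is known to vanish, because `s ≤ (a + T) / 2`
    set τ₀ := max 0 (2 * s - T) with hτ₀
    have hs2 : s ≤ T := by linarith [hs.2]
    have h1 : τ₀ ≤ a := max_le ha (by linarith [hs.2])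
    have h2 : τ₀ ≤ s := max_le hs.1.le (by linarith)
    have h3 : 0 ≤ τ₀ := le_max_left _ _
    have h4 : 2 * s - T ≤ τ₀ := le_max_right _ _
    have m1 : MapsTo (fun τ => τ) (Icc τ₀ s) (Icc 0 T) := fun τ hτ =>
      ⟨h3.trans hτ.1, hτ.2.trans hs2⟩
    have m2 : MapsTo (fun τ => 2 * s - τ) (Icc τ₀ s) (Icc 0 T) := fun τ hτ => by
      constructor <;> linarith [hτ.1, hτ.2, hs.1]
    have hsub : Continuous fun τ : ℝ => 2 * s - τ := by fun_prop
    have := eq_of_hasDerivAt_zero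
      (Φ := fun τ => inner ℂ (d₁ τ) (d (2 * s - τ)) + inner ℂ (d τ) (d₁ (2 * s - τ))) h2
      (((hc.comp continuousOn_id m1).inner (hdc.comp hsub.continuousOn m2)).add
        ((hdc.comp continuousOn_id m1).inner (hc.comp hsub.continuousOn m2)))
      (fun τ hτ => by
        have i1 : τ ∈ Ioo 0 T := ⟨h3.trans_lt hτ.1, hτ.2.trans_le hs2⟩
        have i2 : 2 * s - τ ∈ Ioo 0 T := by constructor <;> linarith [hτ.1, hτ.2, hs.1]
        have e0 : HasDerivAt (fun τ : ℝ => 2 * s - τ) (-1) τ := (hasDerivAt_id τ).const_sub _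
        have e1 := (hd' _ i2).scomp τ e0
        have e2 := (hd₁ _ i2).scomp τ e0
        refine (((hd₁ τ i1).inner ℂ e1).add ((hd' τ i1).inner ℂ e2)).congr_deriv ?_
        simp only [Function.comp_apply, neg_smul, one_smul, inner_neg_right, hsymm τ i1 _ i2]
        ring)
    rw [(h0 τ₀ ⟨h3, h1⟩).1, (h0 τ₀ ⟨h3, h1⟩).2, show 2 * s - s = s by ring] at this
    simpa using this
  have hz : ∀ t ∈ Icc 0 ((a + T) / 2), d t = 0 := by
    intro t ht
    have hsub : Icc 0 t ⊆ Icc 0 T := Icc_subset_Icc_right (by linarith [ht.2])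
    have := eq_of_hasDerivAt_zero (Φ := fun t => inner ℂ (d t) (d t)) ht.1
      ((hdc.mono hsub).inner (hdc.mono hsub)) (fun s hs => by
        refine ((hd' s ⟨hs.1, ?_⟩).inner ℂ (hd' s ⟨hs.1, ?_⟩)).congr_deriv ?_
        · linarith [hs.2, ht.2]
        · linarith [hs.2, ht.2]
        · rw [add_comm]
          exact key s ⟨hs.1, hs.2.le.trans ht.2⟩)
    rw [(h0 0 ⟨le_rfl, ha⟩).1] at this
    simpa using this
  intro t ht
  refine ⟨hz t ht, ?_⟩
  have hsub : Icc 0 ((a + T) / 2) ⊆ Icc 0 T := Icc_subset_Icc_right (by linarith)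
  refine (uniqueDiffOn_Icc (by linarith : (0 : ℝ) < (a + T) / 2) t ht).eq_deriv _
    ((hd t (hsub ht)).mono hsub) ?_
  exact (hasDerivWithinAt_const t _ (0 : H)).congr (fun s hs => hz s hs) (hz t ht)

/-- The abstract wave equation with a symmetric operator and zero initial data has only the zero
solution. Each application of `wave_zero_step` halves the distance to `T` of the interval on which
`d` is known to vanish. -/
lemma wave_zero (hT : 0 < T)
    (hd : ∀ t ∈ Icc 0 T, HasDerivWithinAt d (d₁ t) (Icc 0 T) t) (hc : ContinuousOn d₁ (Icc 0 T))
    (hd₁ : ∀ t ∈ Ioo 0 T, HasDerivAt d₁ (d₂ t) t)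
    (hsymm : ∀ s ∈ Ioo 0 T, ∀ t ∈ Ioo 0 T, inner ℂ (d₂ s) (d t) = inner ℂ (d s) (d₂ t))
    (h0 : d 0 = 0) (h1 : d₁ 0 = 0) : ∀ t ∈ Icc 0 T, d t = 0 := by
  have hk : ∀ k : ℕ, ∀ t ∈ Icc 0 (T - T * (1 / 2) ^ k), d t = 0 ∧ d₁ t = 0 := by
    intro k
    induction k with
    | zero =>
      intro t ht
      have : t = 0 := le_antisymm (by simpa using ht.2) ht.1
      rw [this]
      exact ⟨h0, h1⟩
    | succ k ih =>
      have hp : (0 : ℝ) < (1 / 2) ^ k := by positivity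
      have hp1 : ((1 : ℝ) / 2) ^ k ≤ 1 := pow_le_one₀ (by norm_num) (by norm_num)
      have := wave_zero_step hd hc hd₁ hsymm (a := T - T * (1 / 2) ^ k) (by nlinarith)
        (by nlinarith) ih
      intro t ht
      refine this t ⟨ht.1, ht.2.trans (le_of_eq ?_)⟩
      rw [pow_succ]
      ring
  have hlt : ∀ t ∈ Ico 0 T, d t = 0 := by
    intro t ht
    obtain ⟨k, hk'⟩ := exists_pow_lt_of_lt_one (div_pos (sub_pos.2 ht.2) hT)
      (by norm_num : (1 : ℝ) / 2 < 1)
    rw [lt_div_iff₀ hT] at hk'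
    exact (hk k t ⟨ht.1, by linarith⟩).1
  have hdc : ContinuousOn d (Icc 0 T) := fun t ht => (hd t ht).continuousWithinAt
  intro t ht
  have hE : EqOn d (fun _ => 0) (Icc 0 T) := by
    refine EqOn.of_subset_closure (s := Ico 0 T) hlt hdc continuousOn_const Ico_subset_Icc_self ?_
    rw [closure_Ico hT.ne]
  exact hE ht

end Abstract

section Uniqueness

variable {n : ℕ} {q : ℝ → Matrix (Fin n) (Fin n) ℂ}

/-- The maximal operator with the boundary condition `y(0) = 0` is symmetric: the polarized form of
`inner_self_symm_of_dirichlet`. -/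
lemma inner_symm_of_dirichlet (hherm : ∀ᵐ x ∂mu, (q x).IsHermitian) (hpos : PosDef (L0 q))
    {Y Z Y' Z' : Hil n} {y y' : ℝ → Vec n} (h : MaxRel q Y Z y) (h' : MaxRel q Y' Z' y')
    (h0 : y 0 = 0) (h0' : y' 0 = 0) : inner ℂ Z Y' = inner ℂ Y Z' := by
  have e1 := inner_self_symm_of_dirichlet hherm hpos h h0
  have e2 := inner_self_symm_of_dirichlet hherm hpos h' h0'
  have e3 := inner_self_symm_of_dirichlet hherm hpos (h.add h') (by simp [h0, h0'])
  have e4 := inner_self_symm_of_dirichlet hherm hpos (h.add (h'.smul Complex.I)) (by simp [h0, h0'])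
  simp only [inner_add_left, inner_add_right, inner_smul_left, inner_smul_right,
    Complex.conj_I] at e3 e4
  -- polarization with the factors `1` and `i`
  linear_combination (1 / 2) * (e3 - e1 - e2) - (Complex.I / 2) * (e4 - e1) +
    (1 / 2 * Complex.I * e2 * (-Complex.I * Complex.I)) +
    (1 / 2) * (inner ℂ Z Y' - inner ℂ Y Z' - inner ℂ Z' Y + inner ℂ Y' Z) * Complex.I_sq

/-- At the times where the equation holds, it says that `L_max u = -ü`. -/
lemma IsSolution.maxRel {T : ℝ} {f : ℝ → Vec n} {U : ℝ → ℝ → Vec n} {u u₁ u₂ : ℝ → Hil n}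
    (h : IsSolution q T f U u u₁ u₂) {t : ℝ} (ht : t ∈ Ioo 0 T) :
    MaxRel q (u t) (-u₂ t) (fun x => U x t) := by
  obtain ⟨y₁, y₂, hy⟩ := h.w21 t (Ioo_subset_Icc_self ht)
  refine ⟨y₁, y₂, hy, h.rep t (Ioo_subset_Icc_self ht), ?_⟩
  filter_upwards [h.equation t ht, hy.ae_deriv_deriv, Lp.coeFn_neg (u₂ t)] with x h1 h2 h3
  rw [h3, Pi.neg_apply]
  have h4 : deriv (fun x₁ => deriv (fun x₂ => U x₂ t) x₁) x = y₂ x := h2.deriv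
  rw [h4] at h1
  rw [neg_eq_iff_add_eq_zero, ← h1]
  abel

/-- The difference of two solutions satisfies the wave equation for the symmetric operator of
`inner_symm_of_dirichlet`, so it vanishes in `L₂` at each time. Pointwise equality follows because
both functions are continuous in `x`. -/
lemma IsSolution.eq_of_isSolution (hherm : ∀ᵐ x ∂mu, (q x).IsHermitian) (hpos : PosDef (L0 q))
    {T : ℝ} (hT : 0 < T) {f : ℝ → Vec n} {U U' : ℝ → ℝ → Vec n} {u u₁ u₂ u' u₁' u₂' : ℝ → Hil n}
    (h : IsSolution q T f U u u₁ u₂) (h' : IsSolution q T f U' u' u₁' u₂') {x t : ℝ} (hx : 0 ≤ x)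
    (ht : t ∈ Icc 0 T) : U x t = U' x t := by
  have T0 : (0 : ℝ) ∈ Icc 0 T := ⟨le_rfl, hT.le⟩
  have hm : ∀ t ∈ Ioo 0 T, MaxRel q (u t - u' t) (-(u₂ t - u₂' t))
      (fun x => U x t - U' x t) := by
    intro t ht
    have h1 := (h.maxRel ht).add ((h'.maxRel ht).smul (-1))
    have e1 : u t + (-1 : ℂ) • u' t = u t - u' t := by module
    have e2 : -u₂ t + (-1 : ℂ) • -u₂' t = -(u₂ t - u₂' t) := by module
    have e3 : ((fun x => U x t) + (-1 : ℂ) • fun x => U' x t) = fun x => U x t - U' x t := by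
      ext x : 1
      simp [sub_eq_add_neg]
    rwa [e1, e2, e3] at h1
  have hz := wave_zero (d := fun t => u t - u' t) (d₁ := fun t => u₁ t - u₁' t)
    (d₂ := fun t => u₂ t - u₂' t) hT
    (fun t ht => (h.hasDeriv t ht).sub (h'.hasDeriv t ht)) (h.cont.sub h'.cont)
    (fun t ht => (h.hasDeriv₂ t ht).sub (h'.hasDeriv₂ t ht))
    (fun s hs t ht => by
      have := inner_symm_of_dirichlet hherm hpos (hm s hs) (hm t ht)
        (by simp [h.boundary s (Ioo_subset_Icc_self hs), h'.boundary s (Ioo_subset_Icc_self hs)])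
        (by simp [h.boundary t (Ioo_subset_Icc_self ht), h'.boundary t (Ioo_subset_Icc_self ht)])
      rwa [inner_neg_left, inner_neg_right, neg_inj] at this)
    (by
      refine sub_eq_zero.2 (Lp.ext ((h.rep 0 T0).trans (.trans ?_ (h'.rep 0 T0).symm)))
      filter_upwards [ae_restrict_mem measurableSet_Ici] with x hx
      rw [h.init x hx, h'.init x hx])
    (by simp [h.init₁, h'.init₁]) t ht
  have hu : u t = u' t := sub_eq_zero.1 hz
  have hae : (fun x => U x t) =ᵐ[mu] fun x => U' x t :=
    (h.rep t ht).symm.trans (hu ▸ h'.rep t ht)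
  obtain ⟨_, _, hy⟩ := h.w21 t ht
  obtain ⟨_, _, hy'⟩ := h'.w21 t ht
  rcases hx.eq_or_lt with rfl | hx
  · rw [h.boundary t ht, h'.boundary t ht]
  · have h1 : (fun x => U x t) =ᵐ[volume.restrict (Ioi 0)] fun x => U' x t :=
      ae_restrict_of_ae_restrict_of_subset Ioi_subset_Ici_self hae
    exact Measure.eqOn_open_of_ae_eq h1 isOpen_Ioi (hy.continuousOn.mono Ioi_subset_Ici_self)
      (hy'.continuousOn.mono Ioi_subset_Ici_self) hx

end Uniqueness

/-! ### The Volterra equation of the kernel -/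

section Kernel

variable {𝔸 : Type*} [NormedRing 𝔸] [NormedAlgebra ℝ 𝔸] {q : ℝ → 𝔸} {W : ℝ → ℝ → 𝔸}

lemma intervalIntegrable_of_locallyIntegrableOn {F : Type*} [NormedAddCommGroup F] {q : ℝ → F}
    (hq : LocallyIntegrableOn q (Ici 0)) {a b : ℝ} (ha : 0 ≤ a) (hb : 0 ≤ b) :
    IntervalIntegrable q volume a b := by
  have h : ∀ {x : ℝ}, 0 ≤ x → IntervalIntegrable q volume 0 x := fun {x} hx => by
    rw [intervalIntegrable_iff_integrableOn_Icc_of_le hx]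
    exact hq.integrableOn_compact_subset (fun s hs => hs.1) isCompact_Icc
  exact (h ha).symm.trans (h hb)

/-- The primitive in `r` of `W (y, r)`, continued by zero to `r < 0`. -/
def prim {F : Type*} [NormedAddCommGroup F] [NormedSpace ℝ F] (W : ℝ → ℝ → F) (y r : ℝ) : F :=
  ∫ ρ in (0 : ℝ)..max r 0, W y ρ

lemma prim_of_nonpos {y r : ℝ} (hr : r ≤ 0) : prim W y r = 0 := by
  simp [prim, max_eq_right hr]

lemma continuous_prim (hW : Continuous fun p : ℝ × ℝ => W p.1 p.2) :
    Continuous fun p : ℝ × ℝ => prim W p.1 p.2 :=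
  intervalIntegral.continuous_parametric_intervalIntegral_of_continuous
    (f := fun p : ℝ × ℝ => W p.1) (by
      exact hW.comp ((continuous_fst.comp continuous_fst).prodMk continuous_snd)) (by fun_prop)

lemma prim_sub {W' : ℝ → ℝ → 𝔸} (hW : Continuous fun p : ℝ × ℝ => W p.1 p.2)
    (hW' : Continuous fun p : ℝ × ℝ => W' p.1 p.2) (y r : ℝ) :
    prim (fun y r => W y r - W' y r) y r = prim W y r - prim W' y r :=
  intervalIntegral.integral_sub ((hW.comp (Continuous.prodMk_right y)).intervalIntegrable _ _)
    ((hW'.comp (Continuous.prodMk_right y)).intervalIntegrable _ _)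

/-- The integral of `W (y, ·)` over the slice at `y` of the backward characteristic rectangle of
`(x, r)`, written as an increment of the primitive. -/
def incr (W : ℝ → ℝ → 𝔸) (x r y : ℝ) : 𝔸 :=
  prim W y (r - 2 * max 0 (y - x)) - prim W y (r - 2 * y)

lemma continuous_incr (hW : Continuous fun p : ℝ × ℝ => W p.1 p.2) :
    Continuous fun p : (ℝ × ℝ) × ℝ => incr W p.1.1 p.1.2 p.2 := by
  have h := continuous_prim hW
  exact (h.comp (f := fun p : (ℝ × ℝ) × ℝ => (p.2, p.1.2 - 2 * max 0 (p.2 - p.1.1)))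
    (by fun_prop)).sub (h.comp (f := fun p : (ℝ × ℝ) × ℝ => (p.2, p.1.2 - 2 * p.2)) (by fun_prop))

lemma incr_eq_zero {x r y : ℝ} (hx : 0 ≤ x) (hy : x + r / 2 ≤ y) : incr W x r y = 0 := by
  rw [incr, prim_of_nonpos, prim_of_nonpos, sub_zero]
  · linarith
  · linarith [le_max_right 0 (y - x)]

/-- The integral operator of the Goursat problem, in the variables `x` and `r = t - x`. The factor
`incr` contains the integration along the characteristics; it vanishes for `y ≥ x + r / 2`. -/
def volterra (q : ℝ → 𝔸) (W : ℝ → ℝ → 𝔸) (x r : ℝ) : 𝔸 :=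
  ∫ y in (0 : ℝ)..(x + r / 2), q y * incr W x r y

lemma intervalIntegrable_mul_incr (hq : LocallyIntegrableOn q (Ici 0))
    (hW : Continuous fun p : ℝ × ℝ => W p.1 p.2) (x r : ℝ) {b : ℝ} (hb : 0 ≤ b) :
    IntervalIntegrable (fun y => q y * incr W x r y) volume 0 b :=
  (intervalIntegrable_of_locallyIntegrableOn hq le_rfl hb).mul_continuousOn
    ((continuous_incr hW).comp (Continuous.prodMk_right (x, r))).continuousOn

lemma volterra_eq (hq : LocallyIntegrableOn q (Ici 0))
    (hW : Continuous fun p : ℝ × ℝ => W p.1 p.2) {x r b : ℝ} (hx : 0 ≤ x) (hr : 0 ≤ r)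
    (hb : x + r / 2 ≤ b) : volterra q W x r = ∫ y in (0 : ℝ)..b, q y * incr W x r y := by
  have h0 : 0 ≤ x + r / 2 := by positivity
  have h1 := intervalIntegrable_mul_incr hq hW x r h0
  have h2 := intervalIntegrable_mul_incr hq hW x r (h0.trans hb)
  rw [volterra, ← sub_eq_zero, intervalIntegral.integral_interval_sub_left h1 h2]
  refine intervalIntegral.integral_zero_ae (.of_forall fun y hy => ?_)
  rw [uIoc_comm, uIoc_of_le hb] at hy
  rw [incr_eq_zero hx hy.1.le, mul_zero]

lemma volterra_sub (hq : LocallyIntegrableOn q (Ici 0)) {W' : ℝ → ℝ → 𝔸}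
    (hW : Continuous fun p : ℝ × ℝ => W p.1 p.2) (hW' : Continuous fun p : ℝ × ℝ => W' p.1 p.2)
    {x r : ℝ} (hx : 0 ≤ x) (hr : 0 ≤ r) :
    volterra q (fun y ρ => W y ρ - W' y ρ) x r = volterra q W x r - volterra q W' x r := by
  have h0 : 0 ≤ x + r / 2 := by positivity
  simp only [volterra]
  rw [← intervalIntegral.integral_sub (intervalIntegrable_mul_incr hq hW x r h0)
    (intervalIntegrable_mul_incr hq hW' x r h0)]
  congr 1
  ext y
  rw [← mul_sub]
  congr 1
  simp only [incr, prim_sub hW hW']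
  abel

lemma continuous_volterra (hq : LocallyIntegrableOn q (Ici 0))
    (hW : Continuous fun p : ℝ × ℝ => W p.1 p.2) :
    Continuous fun p : ℝ × ℝ => volterra q W (max p.1 0) (max p.2 0) := by
  rw [continuous_iff_continuousAt]
  intro p₀
  set B := max p₀.1 0 + max p₀.2 0 / 2 + 1 with hB
  have hB0 : 0 ≤ B := by positivity
  have hG : Continuous fun p : (ℝ × ℝ) × ℝ => incr W (max p.1.1 0) (max p.1.2 0) p.2 :=
    (continuous_incr hW).comp (f := fun p : (ℝ × ℝ) × ℝ => ((max p.1.1 0, max p.1.2 0), p.2))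
      (by fun_prop)
  obtain ⟨C, hC⟩ := ((isCompact_closedBall p₀ 1).prod
    (isCompact_Icc (a := 0) (b := B))).exists_bound_of_continuousOn hG.continuousOn
  have hcont : ContinuousAt
      (fun p : ℝ × ℝ => ∫ y in (0 : ℝ)..B, q y * incr W (max p.1 0) (max p.2 0) y) p₀ := by
    refine intervalIntegral.continuousAt_of_dominated_interval
      (bound := fun y => ‖q y‖ * C) ?_ ?_ ?_ ?_
    · refine .of_forall fun p => ?_
      have := intervalIntegrable_mul_incr hq hW (max p.1 0) (max p.2 0) hB0
      rw [intervalIntegrable_iff] at this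
      exact this.aestronglyMeasurable
    · filter_upwards [Metric.closedBall_mem_nhds p₀ one_pos] with p hp
      refine .of_forall fun y hy => ?_
      rw [uIoc_of_le hB0] at hy
      refine (norm_mul_le _ _).trans ?_
      gcongr
      exact hC (p, y) ⟨hp, Ioc_subset_Icc_self hy⟩
    · exact (intervalIntegrable_of_locallyIntegrableOn hq le_rfl hB0).norm.mul_const C
    · refine .of_forall fun y _ => ?_
      exact (continuous_const.mul (hG.comp (Continuous.prodMk_left y))).continuousAt
  refine hcont.congr ?_
  have hopen : Continuous fun p : ℝ × ℝ => max p.1 0 + max p.2 0 / 2 := by fun_prop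
  filter_upwards [hopen.continuousAt.eventually_lt (continuousAt_const (y := B)) (by
    simp only [hB]; linarith)] with p hp
  exact (volterra_eq hq hW (le_max_right _ _) (le_max_right _ _) hp.le).symm

/-- The exponent of the weight `wt`: one plus the integral of `‖q‖` over the interval `[0, b]`,
which contains all arguments of `q` in the equation at the points with `x + r / 2 = b`. -/
def lam {F : Type*} [NormedAddCommGroup F] (q : ℝ → F) (b : ℝ) : ℝ :=
  1 + ∫ y in (0 : ℝ)..max b 0, ‖q y‖

lemma one_le_lam {F : Type*} [NormedAddCommGroup F] {q : ℝ → F} (b : ℝ) : 1 ≤ lam q b :=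
  le_add_of_nonneg_right (intervalIntegral.integral_nonneg (le_max_right _ _)
    fun _ _ => norm_nonneg _)

lemma lam_mono {F : Type*} [NormedAddCommGroup F] {q : ℝ → F}
    (hq : LocallyIntegrableOn q (Ici 0)) {a b : ℝ} (hab : a ≤ b) :
    lam q a ≤ lam q b := by
  unfold lam
  gcongr
  refine intervalIntegral.integral_mono_interval le_rfl (le_max_right _ _)
    (max_le_max_right 0 hab) (.of_forall fun _ => norm_nonneg _)
    (intervalIntegrable_of_locallyIntegrableOn hq le_rfl (le_max_right _ _)).norm

lemma continuous_primitive_of_locallyIntegrableOn {F : Type*} [NormedAddCommGroup F]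
    [NormedSpace ℝ F] {q : ℝ → F} (hq : LocallyIntegrableOn q (Ici 0)) :
    Continuous fun b => ∫ y in (0 : ℝ)..max b 0, q y := by
  rw [continuous_iff_continuousAt]
  intro b₀
  have h := intervalIntegral.continuousOn_primitive_interval (a := 0) (b := max b₀ 0 + 1)
    (μ := volume) (f := q) (by
      rw [uIcc_of_le (by positivity)]
      exact hq.integrableOn_compact_subset (fun s hs => hs.1) isCompact_Icc)
  rw [uIcc_of_le (by positivity)] at h
  have hm : Continuous fun b : ℝ => max b 0 := by fun_prop
  have hev : ∀ᶠ b in nhds b₀, max b 0 ∈ Icc 0 (max b₀ 0 + 1) := by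
    filter_upwards [hm.continuousAt.eventually_lt (continuousAt_const (y := max b₀ 0 + 1))
      (by linarith)] with b hb using ⟨le_max_right _ _, hb.le⟩
  exact (h _ ⟨le_max_right _ _, by linarith⟩).tendsto.comp
    (tendsto_nhdsWithin_iff.2 ⟨hm.continuousAt, hev⟩)

lemma continuous_lam {F : Type*} [NormedAddCommGroup F] {q : ℝ → F}
    (hq : LocallyIntegrableOn q (Ici 0)) : Continuous (lam q) :=
  continuous_const.add (continuous_primitive_of_locallyIntegrableOn hq.norm)

/-- The weight `λ e^{λ r}` with `λ = lam q (x + r / 2)`, with respect to which half of the operator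
`volterra q` is a contraction: the integral of the weight in `r` produces the factor `λ⁻¹`, which
compensates the integral of `‖q‖`. The exponent varies with the point, so that one weight serves the
whole quadrant although `q` is summable only locally. -/
def wt {F : Type*} [NormedAddCommGroup F] (q : ℝ → F) (x r : ℝ) : ℝ :=
  lam q (x + r / 2) * Real.exp (lam q (x + r / 2) * r)

lemma wt_pos {F : Type*} [NormedAddCommGroup F] {q : ℝ → F} (x r : ℝ) : 0 < wt q x r :=
  mul_pos (one_pos.trans_le (one_le_lam _)) (Real.exp_pos _)

lemma continuous_wt {F : Type*} [NormedAddCommGroup F] {q : ℝ → F}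
    (hq : LocallyIntegrableOn q (Ici 0)) :
    Continuous fun p : ℝ × ℝ => wt q p.1 p.2 := by
  have := continuous_lam hq
  unfold wt
  fun_prop

lemma lam_le_wt {F : Type*} [NormedAddCommGroup F] {q : ℝ → F} {x r : ℝ} (hr : 0 ≤ r) :
    lam q (x + r / 2) ≤ wt q x r := by
  have := one_le_lam (q := q) (x + r / 2)
  exact le_mul_of_one_le_right (by linarith) (Real.one_le_exp (by positivity))

/-- The contraction estimate. The values of `W` that enter lie in `y + ρ / 2 ≤ x + r / 2`, so the
estimate needs a bound for `W` there only. -/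
lemma norm_volterra_le (hq : LocallyIntegrableOn q (Ici 0))
    (hW : Continuous fun p : ℝ × ℝ => W p.1 p.2) {x r M : ℝ} (hx : 0 ≤ x) (hr : 0 ≤ r) (hM : 0 ≤ M)
    (hb : ∀ y ρ, 0 ≤ y → 0 ≤ ρ → y + ρ / 2 ≤ x + r / 2 → ‖W y ρ‖ ≤ M * wt q y ρ) :
    ‖volterra q W x r‖ ≤ M * wt q x r := by
  set b := x + r / 2 with hbdef
  have hb0 : 0 ≤ b := by positivity
  set l := lam q b with hl
  have hl1 : 1 ≤ l := one_le_lam _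
  have hqi := intervalIntegrable_of_locallyIntegrableOn hq le_rfl hb0
  have key : ∀ y ∈ Ioc 0 b, ‖incr W x r y‖ ≤ M * Real.exp (l * r) := by
    intro y hy
    set lo := max (r - 2 * y) 0 with hlo
    set hi := max (r - 2 * max 0 (y - x)) 0 with hhi
    have hlohi : lo ≤ hi := by
      refine max_le_max_right 0 ?_
      have : max 0 (y - x) ≤ y := max_le hy.1.le (by linarith)
      linarith
    have hhir : hi ≤ r := max_le (by linarith [le_max_left 0 (y - x)]) hr
    have hyhi : y + hi / 2 ≤ b := by
      rcases le_total y x with h | h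
      · linarith
      · have : hi = r - 2 * (y - x) := by
          rw [hhi, max_eq_right (sub_nonneg.2 h), max_eq_left]
          linarith [hy.2]
        linarith
    have e1 : incr W x r y = ∫ ρ in lo..hi, W y ρ := by
      have hc := hW.comp (Continuous.prodMk_right y)
      exact intervalIntegral.integral_interval_sub_left (hc.intervalIntegrable _ _)
        (hc.intervalIntegrable _ _)
    have e2 : ∫ ρ in lo..hi, M * (l * Real.exp (l * ρ)) =
        M * (Real.exp (l * hi) - Real.exp (l * lo)) := by
      rw [intervalIntegral.integral_const_mul]
      congr 1
      refine intervalIntegral.integral_eq_sub_of_hasDerivAt (f := fun ρ => Real.exp (l * ρ))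
        (fun ρ _ => ?_) (Continuous.intervalIntegrable (by fun_prop) _ _)
      have := ((hasDerivAt_id ρ).const_mul l).exp
      simpa [mul_comm] using this
    rw [e1]
    calc ‖∫ ρ in lo..hi, W y ρ‖ ≤ ∫ ρ in lo..hi, M * (l * Real.exp (l * ρ)) := by
          refine intervalIntegral.norm_integral_le_of_norm_le hlohi (.of_forall fun ρ hρ => ?_)
            (Continuous.intervalIntegrable (by fun_prop) _ _)
          have hρ0 : 0 ≤ ρ := (le_max_right _ _).trans hρ.1.le
          have hyρ : y + ρ / 2 ≤ b := by linarith [hρ.2]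
          refine (hb y ρ hy.1.le hρ0 hyρ).trans ?_
          have := lam_mono hq hyρ
          have := one_le_lam (q := q) (y + ρ / 2)
          unfold wt
          gcongr
      _ = M * (Real.exp (l * hi) - Real.exp (l * lo)) := e2
      _ ≤ M * Real.exp (l * r) := by
          gcongr
          have : Real.exp (l * hi) ≤ Real.exp (l * r) := by gcongr
          linarith [Real.exp_pos (l * lo)]
  calc ‖volterra q W x r‖ ≤ ∫ y in (0 : ℝ)..b, ‖q y‖ * (M * Real.exp (l * r)) := by
        refine intervalIntegral.norm_integral_le_of_norm_le hb0 (.of_forall fun y hy => ?_)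
          (hqi.norm.mul_const _)
        refine (norm_mul_le _ _).trans ?_
        gcongr
        exact key y hy
    _ = (∫ y in (0 : ℝ)..b, ‖q y‖) * (M * Real.exp (l * r)) :=
        intervalIntegral.integral_mul_const _ _
    _ ≤ l * (M * Real.exp (l * r)) := by
        gcongr
        rw [hl, lam, max_eq_left hb0]
        linarith
    _ = M * wt q x r := by rw [wt, ← hbdef, ← hl]; ring

/-- `W` solves the Goursat problem in the variables `x` and `r = t - x`, that is, `w(x, t) = W(x, t
- x)` solves it in the variables `x` and `t`. In these variables the domain is the quadrant `x, r ≥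
0`. -/
def IsVolterraKernel (q : ℝ → 𝔸) (W : ℝ → ℝ → 𝔸) : Prop :=
  ∀ x r, 0 ≤ x → 0 ≤ r →
    W x r = -(1 / 2 : ℝ) • (∫ y in (r / 2)..(r / 2 + x), q y) - (1 / 2 : ℝ) • volterra q W x r

/-- Uniqueness on the quadrant. On the compact triangle `y + ρ / 2 ≤ x + r / 2` the weighted norm of
the difference attains its maximum, and the contraction estimate makes it zero. -/
lemma IsVolterraKernel.eq (hq : LocallyIntegrableOn q (Ici 0)) {W' : ℝ → ℝ → 𝔸}
    (hW : Continuous fun p : ℝ × ℝ => W p.1 p.2) (hW' : Continuous fun p : ℝ × ℝ => W' p.1 p.2)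
    (h : IsVolterraKernel q W) (h' : IsVolterraKernel q W') {x r : ℝ} (hx : 0 ≤ x) (hr : 0 ≤ r) :
    W x r = W' x r := by
  set K : Set (ℝ × ℝ) := {p | 0 ≤ p.1 ∧ 0 ≤ p.2 ∧ p.1 + p.2 / 2 ≤ x + r / 2} with hK
  have hKc : IsCompact K := by
    refine (isCompact_Icc (a := ((0 : ℝ), (0 : ℝ)))
      (b := (x + r / 2, 2 * (x + r / 2)))).of_isClosed_subset ?_ ?_
    · exact (isClosed_le continuous_const continuous_fst).inter
        ((isClosed_le continuous_const continuous_snd).inter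
          (isClosed_le (continuous_fst.add (continuous_snd.div_const 2)) continuous_const))
    · rintro ⟨y, ρ⟩ ⟨h1, h2, h3⟩
      simp only at h1 h2 h3
      exact ⟨⟨h1, h2⟩, ⟨by simp only; linarith, by simp only; linarith⟩⟩
  have hc : Continuous fun p : ℝ × ℝ => ‖W p.1 p.2 - W' p.1 p.2‖ / wt q p.1 p.2 :=
    (hW.sub hW').norm.div (continuous_wt hq) fun p => (wt_pos _ _).ne'
  obtain ⟨p, hp, hmax⟩ := hKc.exists_isMaxOn ⟨(x, r), hx, hr, le_rfl⟩ hc.continuousOn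
  set M := ‖W p.1 p.2 - W' p.1 p.2‖ / wt q p.1 p.2 with hM
  have hM0 : 0 ≤ M := div_nonneg (norm_nonneg _) (wt_pos _ _).le
  have hbound : ∀ y ρ, 0 ≤ y → 0 ≤ ρ → y + ρ / 2 ≤ x + r / 2 →
      ‖W y ρ - W' y ρ‖ ≤ M * wt q y ρ := fun y ρ h1 h2 h3 =>
    (div_le_iff₀ (wt_pos _ _)).1 (hmax (show (y, ρ) ∈ K from ⟨h1, h2, h3⟩))
  have hv := norm_volterra_le hq (hW.sub hW') hp.1 hp.2.1 hM0
    (fun y ρ h1 h2 h3 => hbound y ρ h1 h2 (h3.trans hp.2.2))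
  have he : W p.1 p.2 - W' p.1 p.2 =
      -((1 / 2 : ℝ) • volterra q (fun y ρ => W y ρ - W' y ρ) p.1 p.2) := by
    rw [volterra_sub hq hW hW' hp.1 hp.2.1, h _ _ hp.1 hp.2.1, h' _ _ hp.1 hp.2.1, smul_sub]
    abel
  have h3 : ‖W p.1 p.2 - W' p.1 p.2‖ ≤ 1 / 2 * (M * wt q p.1 p.2) := by
    rw [he, norm_neg, norm_smul, Real.norm_of_nonneg (by norm_num)]
    gcongr
  have h4 : ‖W p.1 p.2 - W' p.1 p.2‖ = M * wt q p.1 p.2 :=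
    (div_mul_cancel₀ _ (wt_pos _ _).ne').symm
  have h5 : M * wt q p.1 p.2 ≤ 0 := by linarith
  have h6 : M = 0 := le_antisymm (nonpos_of_mul_nonpos_left h5 (wt_pos _ _)) hM0
  have := hbound x r hx hr le_rfl
  rw [h6, zero_mul] at this
  exact sub_eq_zero.1 (norm_le_zero_iff.1 this)

/-- Continuity of the free term of the integral equation, continued from the quadrant to the plane.
-/
lemma continuous_free (hq : LocallyIntegrableOn q (Ici 0)) :
    Continuous fun p : ℝ × ℝ => ∫ y in (max p.2 0 / 2)..(max p.2 0 / 2 + max p.1 0), q y := by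
  have h := continuous_primitive_of_locallyIntegrableOn hq
  have h1 : (fun p : ℝ × ℝ => ∫ y in (max p.2 0 / 2)..(max p.2 0 / 2 + max p.1 0), q y) =
      fun p => (∫ y in (0 : ℝ)..max (max p.2 0 / 2 + max p.1 0) 0, q y) -
        ∫ y in (0 : ℝ)..max (max p.2 0 / 2) 0, q y := by
    ext p
    have h1 : 0 ≤ max p.2 0 / 2 := by positivity
    have h2 : 0 ≤ max p.2 0 / 2 + max p.1 0 := by positivity
    rw [max_eq_left h1, max_eq_left h2, intervalIntegral.integral_interval_sub_left
      (intervalIntegrable_of_locallyIntegrableOn hq le_rfl h2)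
      (intervalIntegrable_of_locallyIntegrableOn hq le_rfl h1)]
  rw [h1]
  exact (h.comp (f := fun p : ℝ × ℝ => max p.2 0 / 2 + max p.1 0) (by fun_prop)).sub
    (h.comp (f := fun p : ℝ × ℝ => max p.2 0 / 2) (by fun_prop))

lemma norm_free_le (hq : LocallyIntegrableOn q (Ici 0)) {x r : ℝ} (hx : 0 ≤ x) (hr : 0 ≤ r) :
    ‖∫ y in (r / 2)..(r / 2 + x), q y‖ ≤ wt q x r := by
  have hb : 0 ≤ x + r / 2 := by positivity
  refine le_trans ?_ (lam_le_wt hr)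
  refine (intervalIntegral.norm_integral_le_integral_norm (by linarith)).trans ?_
  rw [lam, max_eq_left hb, add_comm (r / 2) x]
  have : ∫ y in (r / 2)..(x + r / 2), ‖q y‖ ≤ ∫ y in (0 : ℝ)..(x + r / 2), ‖q y‖ :=
    intervalIntegral.integral_mono_interval (by positivity) (by linarith) le_rfl
      (.of_forall fun _ => norm_nonneg _)
      (intervalIntegrable_of_locallyIntegrableOn hq le_rfl hb).norm
  linarith

open scoped BoundedContinuousFunction in
/-- Existence of the kernel. Banach's fixed point theorem is applied to the quotient of `W` by the
weight, in the space of bounded continuous functions on the plane; the functions are continued from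
the quadrant by taking positive parts of the variables. -/
lemma exists_isVolterraKernel [CompleteSpace 𝔸] (hq : LocallyIntegrableOn q (Ici 0)) :
    ∃ W : ℝ → ℝ → 𝔸, Continuous (fun p : ℝ × ℝ => W p.1 p.2) ∧ IsVolterraKernel q W := by
  let ν : ℝ × ℝ → ℝ := fun p => wt q (max p.1 0) (max p.2 0)
  have hν : Continuous ν := (continuous_wt hq).comp (f := fun p : ℝ × ℝ => (max p.1 0, max p.2 0))
    (by fun_prop)
  have hν0 : ∀ p, 0 < ν p := fun p => wt_pos _ _
  let K : (ℝ × ℝ →ᵇ 𝔸) → ℝ → ℝ → 𝔸 := fun Z y ρ => ν (y, ρ) • Z (y, ρ)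
  have hK : ∀ Z, Continuous fun p : ℝ × ℝ => K Z p.1 p.2 := fun Z => hν.smul Z.continuous
  have hKb : ∀ (Z : ℝ × ℝ →ᵇ 𝔸) {M : ℝ}, ‖Z‖ ≤ M → ∀ y ρ, 0 ≤ y → 0 ≤ ρ →
      ‖K Z y ρ‖ ≤ M * wt q y ρ := fun Z M hM y ρ hy hρ => by
    have h1 : ν (y, ρ) = wt q y ρ := by simp [ν, max_eq_left hy, max_eq_left hρ]
    rw [norm_smul, Real.norm_of_nonneg (hν0 _).le, h1, mul_comm]
    exact mul_le_mul_of_nonneg_right ((Z.norm_coe_le_norm _).trans hM) (wt_pos _ _).le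
  let R : (ℝ × ℝ →ᵇ 𝔸) → ℝ × ℝ → 𝔸 := fun Z p => (ν p)⁻¹ •
    (-(1 / 2 : ℝ) • (∫ y in (max p.2 0 / 2)..(max p.2 0 / 2 + max p.1 0), q y) -
      (1 / 2 : ℝ) • volterra q (K Z) (max p.1 0) (max p.2 0))
  have hRc : ∀ Z, Continuous (R Z) := fun Z =>
    (hν.inv₀ fun p => (hν0 p).ne').smul
      ((continuous_const.smul (continuous_free hq)).sub
        (continuous_const.smul (continuous_volterra hq (hK Z))))
  have hRb : ∀ Z p, ‖R Z p‖ ≤ 1 / 2 + 1 / 2 * ‖Z‖ := fun Z p => by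
    have h1 := norm_free_le hq (le_max_right p.1 0) (le_max_right p.2 0)
    have h2 := norm_volterra_le hq (hK Z) (le_max_right p.1 0) (le_max_right p.2 0)
      (norm_nonneg Z) (fun y ρ hy hρ _ => hKb Z le_rfl y ρ hy hρ)
    rw [norm_smul, norm_inv, Real.norm_of_nonneg (hν0 p).le, inv_mul_le_iff₀ (hν0 p)]
    refine (norm_sub_le _ _).trans ?_
    rw [norm_smul, norm_smul, norm_neg, Real.norm_of_nonneg (by norm_num : (0 : ℝ) ≤ 1 / 2)]
    have : ν p = wt q (max p.1 0) (max p.2 0) := rfl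
    rw [← this] at h1 h2
    linarith
  let Φ : (ℝ × ℝ →ᵇ 𝔸) → (ℝ × ℝ →ᵇ 𝔸) := fun Z =>
    BoundedContinuousFunction.ofNormedAddCommGroup (R Z) (hRc Z) _ (hRb Z)
  have hΦ : ContractingWith (1 / 2) Φ := by
    refine ⟨by norm_num, LipschitzWith.of_dist_le_mul fun Z Z' => ?_⟩
    rw [BoundedContinuousFunction.dist_le (by positivity)]
    intro p
    have hsub : (fun y ρ => K Z y ρ - K Z' y ρ) = K (Z - Z') := by
      ext y ρ
      simp [K, smul_sub]
    have h2 := norm_volterra_le hq (hK (Z - Z')) (le_max_right p.1 0) (le_max_right p.2 0)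
      (norm_nonneg (Z - Z')) (fun y ρ hy hρ _ => hKb (Z - Z') le_rfl y ρ hy hρ)
    have h3 := volterra_sub hq (hK Z) (hK Z') (le_max_right p.1 0) (le_max_right p.2 0)
    rw [hsub] at h3
    have h4 : Φ Z p - Φ Z' p = (ν p)⁻¹ • (-((1 / 2 : ℝ) •
        volterra q (K (Z - Z')) (max p.1 0) (max p.2 0))) := by
      rw [h3]
      change R Z p - R Z' p = _
      simp only [R]
      rw [← smul_sub]
      congr 1
      rw [smul_sub]
      abel
    rw [dist_eq_norm, h4, norm_smul, norm_inv, Real.norm_of_nonneg (hν0 p).le,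
      inv_mul_le_iff₀ (hν0 p), norm_neg, norm_smul, Real.norm_of_nonneg (by norm_num), dist_eq_norm]
    have : ν p = wt q (max p.1 0) (max p.2 0) := rfl
    rw [← this] at h2
    push_cast
    linarith
  have hfix := hΦ.fixedPoint_isFixedPt
  set Z := ContractingWith.fixedPoint Φ hΦ with hZ
  refine ⟨K Z, hK Z, fun x r hx hr => ?_⟩
  have h1 : Z (x, r) = R Z (x, r) := by
    conv_lhs => rw [← hfix.eq]
    rfl
  change ν (x, r) • Z (x, r) = _
  rw [h1]
  simp only [R, max_eq_left hx, max_eq_left hr]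
  rw [smul_inv_smul₀ (hν0 _).ne']

end Kernel

/-! ### The Goursat problem as a Volterra equation -/

/-- A bilinear expression in a summable function of one variable and a bounded function of two is
summable on a rectangle. -/
lemma integrable_bilin_prod {E F G : Type*} [NormedAddCommGroup E] [NormedSpace ℝ E]
    [NormedAddCommGroup F] [NormedSpace ℝ F] [NormedAddCommGroup G] [NormedSpace ℝ G]
    (B : E →L[ℝ] F →L[ℝ] G) {q : ℝ → E} {k : ℝ × ℝ → F} {a b C : ℝ}
    (hq : IntegrableOn q (Ioc 0 b))
    (hk : AEStronglyMeasurable k ((volume.restrict (Ioc 0 a)).prod (volume.restrict (Ioc 0 b))))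
    (hC : ∀ p ∈ Ioc 0 a ×ˢ Ioc 0 b, ‖k p‖ ≤ C) :
    Integrable (fun p : ℝ × ℝ => B (q p.2) (k p))
      ((volume.restrict (Ioc 0 a)).prod (volume.restrict (Ioc 0 b))) := by
  have hq2 : Integrable (fun p : ℝ × ℝ => q p.2)
      ((volume.restrict (Ioc 0 a)).prod (volume.restrict (Ioc 0 b))) := Integrable.comp_snd hq _
  refine Integrable.mono' ((hq2.norm.mul_const C).const_mul ‖B‖)
    (B.aestronglyMeasurable_comp₂ hq2.aestronglyMeasurable hk) ?_
  rw [Measure.prod_restrict]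
  refine (ae_restrict_iff' (measurableSet_Ioc.prod measurableSet_Ioc)).2 (.of_forall fun p hp => ?_)
  refine (B.le_opNorm₂ _ _).trans ?_
  rw [mul_assoc]
  gcongr
  exact hC p hp

lemma integrable_bilin_prod_of_continuous {E F G : Type*} [NormedAddCommGroup E] [NormedSpace ℝ E]
    [NormedAddCommGroup F] [NormedSpace ℝ F] [NormedAddCommGroup G] [NormedSpace ℝ G]
    (B : E →L[ℝ] F →L[ℝ] G) {q : ℝ → E} {k : ℝ × ℝ → F} {a b : ℝ}
    (hq : IntegrableOn q (Ioc 0 b)) (hk : Continuous k) :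
    Integrable (fun p : ℝ × ℝ => B (q p.2) (k p))
      ((volume.restrict (Ioc 0 a)).prod (volume.restrict (Ioc 0 b))) := by
  obtain ⟨C, hC⟩ := ((isCompact_Icc (a := (0 : ℝ)) (b := a)).prod
    (isCompact_Icc (a := (0 : ℝ)) (b := b))).exists_bound_of_continuousOn hk.continuousOn
  refine integrable_bilin_prod B hq ?_ (C := C) fun p hp => hC p
    ⟨Ioc_subset_Icc_self hp.1, Ioc_subset_Icc_self hp.2⟩
  rw [Measure.prod_restrict]
  exact hk.continuousOn.aestronglyMeasurable_of_subset_isCompact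
    ((isCompact_Icc (a := (0 : ℝ)) (b := a)).prod (isCompact_Icc (a := (0 : ℝ)) (b := b)))
    (measurableSet_Ioc.prod measurableSet_Ioc)
    (prod_mono Ioc_subset_Icc_self Ioc_subset_Icc_self)

lemma intervalIntegral_eq_indicator {F : Type*} [NormedAddCommGroup F] [NormedSpace ℝ F]
    {g : ℝ → F} {a b c d : ℝ} (hac : a ≤ c) (hcd : c ≤ d) (hdb : d ≤ b) {S : Set ℝ}
    (hS : MeasurableSet S) (h : Ioc a b ∩ S = Ioc c d) :
    ∫ s in a..b, S.indicator g s = ∫ s in c..d, g s := by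
  rw [intervalIntegral.integral_of_le (hac.trans (hcd.trans hdb)),
    intervalIntegral.integral_of_le hcd, setIntegral_indicator hS, h]

section Kernel

variable {𝔸 : Type*} [NormedRing 𝔸] [NormedAlgebra ℝ 𝔸] [CompleteSpace 𝔸] {q : ℝ → 𝔸}

/-- The double integral over a characteristic rectangle in the variables `y = (η₁ - ξ₁) / 2` and
`ρ = ξ₁`. Integrating over `ρ` first, where `q(y)` is a constant factor, gives `volterra`. -/
lemma goursat_integral_eq (hq : LocallyIntegrableOn q (Ici 0)) {w W : ℝ → ℝ → 𝔸}
    (hW : Continuous fun p : ℝ × ℝ => W p.1 p.2)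
    (hwW : ∀ y ρ, 0 ≤ y → 0 ≤ ρ → w y (y + ρ) = W y ρ) {x r : ℝ} (hx : 0 ≤ x) (hr : 0 ≤ r) :
    ∫ ξ₁ in (0 : ℝ)..r, ∫ η₁ in r..(r + 2 * x),
      q ((η₁ - ξ₁) / 2) * w ((η₁ - ξ₁) / 2) ((η₁ + ξ₁) / 2) = (2 : ℝ) • volterra q W x r := by
  set b := x + r / 2 with hb
  have hb0 : 0 ≤ b := by positivity
  have hqi : IntegrableOn q (Ioc 0 b) :=
    (intervalIntegrable_iff_integrableOn_Ioc_of_le hb0).1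
      (intervalIntegrable_of_locallyIntegrableOn hq le_rfl hb0)
  set S : Set (ℝ × ℝ) := {p | r - 2 * p.2 < p.1 ∧ p.1 ≤ r + 2 * x - 2 * p.2} with hS
  have hSm : MeasurableSet S :=
    (measurableSet_lt (f := fun p : ℝ × ℝ => r - 2 * p.2) (g := fun p => p.1)
      (by fun_prop) (by fun_prop)).inter
      (measurableSet_le (f := fun p : ℝ × ℝ => p.1) (g := fun p => r + 2 * x - 2 * p.2)
        (by fun_prop) (by fun_prop))
  set k : ℝ × ℝ → 𝔸 := S.indicator fun p => q p.2 * W p.2 p.1 with hk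
  have hki : Integrable k ((volume.restrict (Ioc 0 r)).prod (volume.restrict (Ioc 0 b))) :=
    (integrable_bilin_prod_of_continuous (ContinuousLinearMap.mul ℝ 𝔸) hqi
      (hW.comp continuous_swap)).indicator hSm
  have h1 : ∀ ξ₁ ∈ Ioc 0 r, ∫ η₁ in r..(r + 2 * x),
      q ((η₁ - ξ₁) / 2) * w ((η₁ - ξ₁) / 2) ((η₁ + ξ₁) / 2) =
      (2 : ℝ) • ∫ y in (0 : ℝ)..b, k (ξ₁, y) := by
    intro ξ₁ hξ
    have e1 : ∫ η₁ in r..(r + 2 * x),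
        q ((η₁ - ξ₁) / 2) * w ((η₁ - ξ₁) / 2) ((η₁ + ξ₁) / 2) =
        ∫ η₁ in r..(r + 2 * x), (fun y => q y * W y ξ₁) (η₁ / 2 - ξ₁ / 2) := by
      refine intervalIntegral.integral_congr fun η hη => ?_
      rw [uIcc_of_le (by linarith)] at hη
      have hy : 0 ≤ (η - ξ₁) / 2 := by linarith [hη.1, hξ.2]
      have e2 := hwW _ ξ₁ hy hξ.1.le
      rw [show (η - ξ₁) / 2 + ξ₁ = (η + ξ₁) / 2 by ring] at e2
      simp only [e2, ← sub_div]
    rw [e1, intervalIntegral.integral_comp_div_sub (fun y => q y * W y ξ₁) two_ne_zero]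
    congr 1
    have e3 := intervalIntegral_eq_indicator (g := fun y => q y * W y ξ₁) (a := 0) (b := b)
      (c := r / 2 - ξ₁ / 2) (d := (r + 2 * x) / 2 - ξ₁ / 2)
      (S := (fun y => (ξ₁, y)) ⁻¹' S) (by linarith [hξ.2]) (by linarith)
      (by linarith [hξ.1]) (measurable_prodMk_left hSm) (by
        ext y
        simp only [hS, mem_inter_iff, mem_Ioc, mem_preimage, mem_ofPred_eq]
        constructor
        · rintro ⟨⟨h1, h2⟩, h3, h4⟩
          constructor <;> linarith
        · rintro ⟨h1, h2⟩
          refine ⟨⟨?_, ?_⟩, ?_, ?_⟩ <;> linarith [hξ.1, hξ.2])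
    rw [← e3]
    rfl
  have h2 : ∀ y ∈ Ioc 0 b, ∫ ξ₁ in (0 : ℝ)..r, k (ξ₁, y) = q y * incr W x r y := by
    intro y hy
    have hc := hW.comp (Continuous.prodMk_right y)
    have e1 : incr W x r y = ∫ ρ in (max (r - 2 * y) 0)..(max (r - 2 * max 0 (y - x)) 0), W y ρ :=
      intervalIntegral.integral_interval_sub_left (hc.intervalIntegrable _ _)
        (hc.intervalIntegrable _ _)
    have hmin : max (r - 2 * max 0 (y - x)) 0 = min r (r + 2 * x - 2 * y) := by
      rcases le_total y x with h | h
      · rw [max_eq_left (a := (0 : ℝ)) (by linarith), min_eq_left (by linarith), max_eq_left] <;>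
          linarith
      · rw [max_eq_right (a := (0 : ℝ)) (by linarith), min_eq_right (by linarith), max_eq_left] <;>
          linarith [hy.2]
    have e2 := (ContinuousLinearMap.mul ℝ 𝔸 (q y)).intervalIntegral_comp_comm
      (hc.intervalIntegrable (μ := volume) (max (r - 2 * y) 0) (min r (r + 2 * x - 2 * y)))
    simp only [ContinuousLinearMap.mul_apply', Function.comp_apply] at e2
    rw [e1, hmin, ← e2]
    have hlo : max (r - 2 * y) 0 ≤ min r (r + 2 * x - 2 * y) := by
      refine max_le (le_min ?_ ?_) (le_min hr ?_) <;> linarith [hy.1, hy.2]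
    rw [← intervalIntegral_eq_indicator (a := 0) (b := r) (le_max_right _ _) hlo (min_le_left _ _)
      (S := (fun ρ => (ρ, y)) ⁻¹' S) (measurable_prodMk_right hSm) (by
        ext ρ
        simp only [hS, mem_inter_iff, mem_Ioc, mem_preimage, mem_ofPred_eq, max_lt_iff, le_min_iff]
        tauto)]
    rfl
  have h3 : ∫ ξ₁ in (0 : ℝ)..r, ∫ η₁ in r..(r + 2 * x),
      q ((η₁ - ξ₁) / 2) * w ((η₁ - ξ₁) / 2) ((η₁ + ξ₁) / 2) =
      ∫ ξ₁ in (0 : ℝ)..r, (2 : ℝ) • ∫ y in (0 : ℝ)..b, k (ξ₁, y) := by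
    rw [intervalIntegral.integral_of_le hr, intervalIntegral.integral_of_le hr]
    exact setIntegral_congr_fun measurableSet_Ioc h1
  have h4 : volterra q W x r = ∫ y in (0 : ℝ)..b, ∫ ξ₁ in (0 : ℝ)..r, k (ξ₁, y) := by
    rw [volterra, intervalIntegral.integral_of_le hb0, intervalIntegral.integral_of_le hb0]
    exact setIntegral_congr_fun measurableSet_Ioc fun y hy => (h2 y hy).symm
  rw [h3, intervalIntegral.integral_smul, h4]
  congr 1
  simp only [intervalIntegral.integral_of_le hr, intervalIntegral.integral_of_le hb0]
  exact integral_integral_swap hki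

end Kernel

section Goursat

variable {n : ℕ} {q : ℝ → Matrix (Fin n) (Fin n) ℂ}

lemma IsVolterraKernel.isGoursatKernel (hq : LocallyIntegrableOn q (Ici 0))
    {W : ℝ → ℝ → Matrix (Fin n) (Fin n) ℂ} (hW : Continuous fun p : ℝ × ℝ => W p.1 p.2)
    (h : IsVolterraKernel q W) : IsGoursatKernel q fun x t => W x (t - x) := by
  refine ⟨(hW.comp (continuous_fst.prodMk (continuous_snd.sub continuous_fst))).continuousOn,
    fun ξ η hξ hξη => ?_⟩
  have hx : 0 ≤ (η - ξ) / 2 := by linarith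
  have h1 := goursat_integral_eq hq hW (w := fun x t => W x (t - x))
    (fun y ρ _ _ => by simp only [add_sub_cancel_left]) hx hξ
  rw [show ξ + 2 * ((η - ξ) / 2) = η by ring] at h1
  have h2 := h _ _ hx hξ
  rw [show ξ / 2 + (η - ξ) / 2 = η / 2 by ring] at h2
  rw [h1, show (η + ξ) / 2 - (η - ξ) / 2 = ξ by ring, h2, smul_smul]
  norm_num

/-- A generalized solution on the wedge is continued by taking positive parts of the variables,
since `IsVolterraKernel.eq` requires continuity on the whole plane. -/
lemma IsGoursatKernel.isVolterraKernel (hq : LocallyIntegrableOn q (Ici 0))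
    {w : ℝ → ℝ → Matrix (Fin n) (Fin n) ℂ} (h : IsGoursatKernel q w) :
    Continuous (fun p : ℝ × ℝ => w (max p.1 0) (max p.1 0 + max p.2 0)) ∧
    IsVolterraKernel q fun x r => w (max x 0) (max x 0 + max r 0) := by
  have hc : Continuous (fun p : ℝ × ℝ => w (max p.1 0) (max p.1 0 + max p.2 0)) :=
    h.cont.comp_continuous (f := fun p : ℝ × ℝ => (max p.1 0, max p.1 0 + max p.2 0))
      (by fun_prop) fun p => ⟨le_max_right _ _, le_add_of_nonneg_right (le_max_right _ _)⟩
  refine ⟨hc, fun x r hx hr => ?_⟩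
  have h1 := goursat_integral_eq hq (W := fun x r => w (max x 0) (max x 0 + max r 0)) hc (w := w)
    (fun y ρ hy hρ => by simp only [max_eq_left hy, max_eq_left hρ]) hx hr
  have h2 := h.eq r (r + 2 * x) hr (by linarith)
  rw [h1, show (r + 2 * x - r) / 2 = x by ring, show (r + 2 * x + r) / 2 = x + r by ring,
    show (r + 2 * x) / 2 = r / 2 + x by ring, smul_smul] at h2
  simp only [max_eq_left hx, max_eq_left hr]
  rw [h2]
  norm_num

end Goursat

/-! ### Duhamel's formula -/

section Duhamel

variable {𝔸 : Type*} [NormedRing 𝔸] [NormedAlgebra ℝ 𝔸]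
  {E : Type*} [NormedAddCommGroup E] [NormedSpace ℝ E]
  {B : 𝔸 →L[ℝ] E →L[ℝ] E} {q : ℝ → 𝔸} {W : ℝ → ℝ → 𝔸} {g G : ℝ → E}

/-- The function `g(σ) + ∫₀^σ W(x, r) g(σ - r) dr`, which is `u(x, t)` for `σ = t - x` and the
control `g`. The product of a matrix and a vector is replaced by a bilinear map `B`. -/
def sol (B : 𝔸 →L[ℝ] E →L[ℝ] E) (W : ℝ → ℝ → 𝔸) (g : ℝ → E) (x σ : ℝ) : E :=
  g σ + ∫ r in (0 : ℝ)..σ, B (W x r) (g (σ - r))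

lemma sol_of_nonpos (hg0 : ∀ t ≤ 0, g t = 0) {x σ : ℝ} (hσ : σ ≤ 0) : sol B W g x σ = 0 := by
  rw [sol, hg0 σ hσ, zero_add]
  refine intervalIntegral.integral_zero_ae (.of_forall fun r hr => ?_)
  rw [uIoc_comm, uIoc_of_le hσ] at hr
  rw [hg0 _ (by linarith [hr.1]), map_zero]

lemma continuous_sol (hW : Continuous fun p : ℝ × ℝ => W p.1 p.2) (hg : Continuous g) :
    Continuous fun p : ℝ × ℝ => sol B W g p.1 p.2 := by
  refine (hg.comp continuous_snd).add ?_
  refine intervalIntegral.continuous_parametric_intervalIntegral_of_continuous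
    (f := fun (p : ℝ × ℝ) r => B (W p.1 r) (g (p.2 - r))) ?_ continuous_snd
  have h1 : Continuous fun z : (ℝ × ℝ) × ℝ => W z.1.1 z.2 :=
    hW.comp (f := fun z : (ℝ × ℝ) × ℝ => (z.1.1, z.2)) (by fun_prop)
  exact (B.continuous.comp h1).clm_apply (hg.comp (by fun_prop))

/-- The limits of the integral in `sol` may be taken independent of `σ`. -/
lemma sol_eq (hW : Continuous fun p : ℝ × ℝ => W p.1 p.2) (hg : Continuous g)
    (hg0 : ∀ t ≤ 0, g t = 0) {x σ R : ℝ} (hσ : σ ≤ R) :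
    sol B W g x σ = g σ + ∫ r in (0 : ℝ)..R, B (W x r) (g (σ - r)) := by
  have hc : Continuous fun r => B (W x r) (g (σ - r)) :=
    (B.continuous.comp (hW.comp (Continuous.prodMk_right x))).clm_apply (hg.comp (by fun_prop))
  rw [sol, ← intervalIntegral.integral_add_adjacent_intervals (a := 0) (b := σ) (c := R)
    (hc.intervalIntegrable _ _) (hc.intervalIntegrable _ _)]
  have : ∫ r in σ..R, B (W x r) (g (σ - r)) = 0 := by
    refine intervalIntegral.integral_zero_ae (.of_forall fun r hr => ?_)
    rw [uIoc_of_le hσ] at hr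
    rw [hg0 _ (by linarith [hr.1]), map_zero]
  rw [this, add_zero]

/-- Since `W` enters by convolution, differentiation in time is differentiation of the control; the
kernel, which is only continuous, is not differentiated. -/
lemma hasDerivAt_sol (hW : Continuous fun p : ℝ × ℝ => W p.1 p.2) (hg : Continuous g)
    (hG : ∀ t, HasDerivAt G (g t) t) (hg0 : ∀ t ≤ 0, g t = 0) (hG0 : ∀ t ≤ 0, G t = 0) (x σ : ℝ) :
    HasDerivAt (sol B W G x) (sol B W g x σ) σ := by
  have hGc : Continuous G := continuous_iff_continuousAt.2 fun t => (hG t).continuousAt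
  set R := |σ| + 1 with hR
  have hR0 : 0 ≤ R := by positivity
  have hσR : σ < R := by linarith [le_abs_self σ]
  have hc : ∀ {g : ℝ → E}, Continuous g → Continuous fun p : ℝ × ℝ => B (W x p.2) (g (p.1 - p.2)) :=
    fun hg => (B.continuous.comp (hW.comp (f := fun p : ℝ × ℝ => (x, p.2))
      (by fun_prop))).clm_apply (hg.comp (by fun_prop))
  obtain ⟨C, hC⟩ := ((isCompact_closedBall σ 1).prod
    (isCompact_Icc (a := 0) (b := R))).exists_bound_of_continuousOn (hc hg).continuousOn
  have hint := (intervalIntegral.hasDerivAt_integral_of_dominated_loc_of_deriv_le (μ := volume)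
    (F := fun σ r => B (W x r) (G (σ - r))) (F' := fun σ r => B (W x r) (g (σ - r)))
    (a := 0) (b := R) (bound := fun _ => C) (x₀ := σ)
    (Metric.closedBall_mem_nhds σ one_pos)
    (.of_forall fun s => ((hc hGc).comp (Continuous.prodMk_right s)).aestronglyMeasurable)
    (((hc hGc).comp (Continuous.prodMk_right σ)).intervalIntegrable _ _)
    ((hc hg).comp (Continuous.prodMk_right σ)).aestronglyMeasurable
    (.of_forall fun r hr s hs => hC (s, r) ⟨hs, by
      rw [uIoc_of_le hR0] at hr; exact Ioc_subset_Icc_self hr⟩)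
    intervalIntegrable_const
    (.of_forall fun r _ s _ => by
      have h1 := (hG (s - r)).scomp s ((hasDerivAt_id s).sub_const r)
      rw [one_smul] at h1
      exact (B (W x r)).hasFDerivAt.comp_hasDerivAt s h1)).2
  have h2 := (hG σ).add hint
  rw [sol_eq hW hg hg0 hσR.le]
  refine h2.congr_of_eventuallyEq ?_
  filter_upwards [Iio_mem_nhds hσR] with s hs
  exact sol_eq hW hGc hG0 (le_of_lt hs)

variable [CompleteSpace E]

/-- Integration by parts in `r`, which moves the primitive from the kernel to the control, together
with the shift by `c`. -/
lemma integral_prim_eq [CompleteSpace 𝔸] (hW : Continuous fun p : ℝ × ℝ => W p.1 p.2)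
    (hg : Continuous g)
    (hG : ∀ t, HasDerivAt G (g t) t) (hG0 : ∀ t ≤ 0, G t = 0) (y : ℝ) {σ c : ℝ}
    (hσ : 0 ≤ σ) (hc : 0 ≤ c) :
    ∫ r in (0 : ℝ)..σ, B (prim W y (r - c)) (g (σ - r)) =
      ∫ ρ in (0 : ℝ)..(σ - c), B (W y ρ) (G (σ - c - ρ)) := by
  have hWy : Continuous (W y) := hW.comp (Continuous.prodMk_right y)
  have hPc : Continuous (prim W y) := (continuous_prim hW).comp (Continuous.prodMk_right y)
  have hGc : Continuous G := continuous_iff_continuousAt.2 fun t => (hG t).continuousAt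
  rcases le_total σ c with h | h
  · rw [intervalIntegral.integral_zero_ae (.of_forall fun r hr => ?_),
      intervalIntegral.integral_zero_ae (.of_forall fun r hr => ?_)]
    · rw [uIoc_comm, uIoc_of_le (by linarith)] at hr
      rw [hG0 _ (by linarith [hr.1]), map_zero]
    · rw [uIoc_of_le hσ] at hr
      rw [prim_of_nonpos (by linarith [hr.2])]
      simp
  · set s := σ - c with hs
    have hs0 : 0 ≤ s := sub_nonneg.2 h
    have hi : Continuous fun r => B (prim W y (r - c)) (g (σ - r)) :=
      (B.continuous.comp (hPc.comp (by fun_prop))).clm_apply (hg.comp (by fun_prop))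
    rw [← intervalIntegral.integral_add_adjacent_intervals (a := 0) (b := c) (c := σ)
      (hi.intervalIntegrable _ _) (hi.intervalIntegrable _ _),
      intervalIntegral.integral_zero_ae (.of_forall fun r hr => by
        rw [uIoc_of_le hc] at hr
        rw [prim_of_nonpos (by linarith [hr.2])]
        simp), zero_add]
    have e1 : ∫ r in c..σ, B (prim W y (r - c)) (g (σ - r)) =
        ∫ r in (0 : ℝ)..s, B (prim W y r) (g (s - r)) := by
      have := intervalIntegral.integral_comp_sub_right (a := c) (b := σ)
        (fun r => B (prim W y r) (g (s - r))) c
      rw [sub_self] at this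
      rw [← this]
      refine intervalIntegral.integral_congr fun r _ => ?_
      simp only [hs]
      congr 2
      ring
    rw [e1]
    set P : ℝ → 𝔸 := fun r => ∫ ρ in (0 : ℝ)..r, W y ρ with hP
    have hPP : ∀ r, 0 ≤ r → prim W y r = P r := fun r hr => by rw [prim, max_eq_left hr]
    have hPd : ∀ r, HasDerivAt P (W y r) r := fun r =>
      (hWy.integral_hasStrictDerivAt 0 r).hasDerivAt
    have hPc' : Continuous P := continuous_iff_continuousAt.2 fun t => (hPd t).continuousAt
    have e2 : ∫ r in (0 : ℝ)..s, B (prim W y r) (g (s - r)) =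
        ∫ r in (0 : ℝ)..s, B (P r) (g (s - r)) := by
      refine intervalIntegral.integral_congr fun r hr => ?_
      rw [uIcc_of_le hs0] at hr
      simp only [hPP r hr.1]
    have c1 : Continuous fun r => B (W y r) (G (s - r)) :=
      (B.continuous.comp hWy).clm_apply (hGc.comp (by fun_prop))
    have c2 : Continuous fun r => B (P r) (g (s - r)) :=
      (B.continuous.comp hPc').clm_apply (hg.comp (by fun_prop))
    have e3 : ∫ r in (0 : ℝ)..s, (B (W y r) (G (s - r)) - B (P r) (g (s - r))) =
        B (P s) (G (s - s)) - B (P 0) (G (s - 0)) := by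
      refine intervalIntegral.integral_eq_sub_of_hasDerivAt
        (f := fun r => B (P r) (G (s - r))) (fun r _ => ?_) ((c1.sub c2).intervalIntegrable _ _)
      have d1 : HasDerivAt (fun r => B (P r)) (B (W y r)) r :=
        B.hasFDerivAt.comp_hasDerivAt r (hPd r)
      have d2 := (hG (s - r)).scomp r ((hasDerivAt_id r).const_sub s)
      refine (d1.clm_apply d2).congr_deriv ?_
      simp [sub_eq_add_neg]
    rw [intervalIntegral.integral_sub (c1.intervalIntegrable _ _) (c2.intervalIntegrable _ _),
      sub_self, hG0 0 le_rfl] at e3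
    rw [e2]
    have hP0 : P 0 = 0 := by simp [hP]
    rw [hP0] at e3
    simp only [map_zero, _root_.zero_apply, sub_self] at e3
    exact (sub_eq_zero.1 e3).symm

/-- The integral of `g (σ - r)` over `r ∈ [c, σ]` is `G (σ - c)`, also for `c > σ`, when both
vanish. -/
lemma integral_indicator_Ici_eq (hg : Continuous g)
    (hG : ∀ t, HasDerivAt G (g t) t) (hG0 : ∀ t ≤ 0, G t = 0) {σ c : ℝ} (hσ : 0 ≤ σ) (hc : 0 ≤ c) :
    IntervalIntegrable (fun r => (Ici c).indicator (fun r => g (σ - r)) r) volume 0 σ ∧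
    ∫ r in (0 : ℝ)..σ, (Ici c).indicator (fun r => g (σ - r)) r = G (σ - c) := by
  have hgc : Continuous fun r => g (σ - r) := hg.comp (by fun_prop)
  refine ⟨?_, ?_⟩
  · rw [intervalIntegrable_iff]
    exact (intervalIntegrable_iff.1 (hgc.intervalIntegrable 0 σ)).indicator measurableSet_Ici
  rcases lt_or_ge σ c with h | h
  · rw [hG0 _ (by linarith), intervalIntegral.integral_zero_ae (.of_forall fun r hr => ?_)]
    rw [uIoc_of_le hσ] at hr
    exact indicator_of_notMem (fun hh => by linarith [hr.2, mem_Ici.1 hh]) _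
  · rw [intervalIntegral.integral_of_le hσ, setIntegral_indicator measurableSet_Ici]
    have h1 : ∫ r in (Ioc 0 σ ∩ Ici c), g (σ - r) = ∫ r in Ioc c σ, g (σ - r) := by
      refine setIntegral_congr_set ?_
      have : (Ioc c σ : Set ℝ) =ᵐ[volume] Icc c σ := Ioc_ae_eq_Icc
      refine Filter.EventuallyEq.trans ?_ this.symm
      have h0 : ∀ᵐ r : ℝ, r ≠ 0 := by simp [ae_iff]
      filter_upwards [h0] with r hr
      refine propext ⟨fun hh => ⟨hh.2, hh.1.2⟩, fun hh => ⟨⟨?_, hh.2⟩, hh.1⟩⟩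
      exact lt_of_le_of_ne (hc.trans hh.1) (Ne.symm hr)
    rw [h1, ← intervalIntegral.integral_of_le h,
      intervalIntegral.integral_eq_sub_of_hasDerivAt (f := fun r => -G (σ - r))
        (fun r _ => ?_) (hgc.intervalIntegrable _ _)]
    · simp [hG0 0 le_rfl]
    · have d2 := ((hG (σ - r)).scomp r ((hasDerivAt_id r).const_sub σ)).neg
      refine d2.congr_deriv ?_
      simp

/-- Duhamel's formula: `u(x, t) = sol g x (t - x)` satisfies `u(x, t) = g(t - x) - ½ ∫ q(y) ∫ u(y,
τ) dτ dy`, with the inner integral over the slice at `y` of the backward characteristic domain of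
`(x, t)`, reflected at `x = 0`. The primitive of `u` in time is `sol G` for the primitive `G` of
`g`. The formula is the convolution of the equation `IsVolterraKernel` with `g`. -/
lemma sol_eq_duhamel [CompleteSpace 𝔸] (hB : ∀ a b v, B (a * b) v = B a (B b v))
    (hq : LocallyIntegrableOn q (Ici 0))
    (hW : Continuous fun p : ℝ × ℝ => W p.1 p.2) (hV : IsVolterraKernel q W)
    (hg : Continuous g) (hG : ∀ t, HasDerivAt G (g t) t) (hg0 : ∀ t ≤ 0, g t = 0)
    (hG0 : ∀ t ≤ 0, G t = 0) {x σ b : ℝ} (hx : 0 ≤ x) (hb0 : 0 ≤ b) (hb : x + σ / 2 ≤ b) :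
    sol B W g x σ = g σ - (1 / 2 : ℝ) • ∫ y in (0 : ℝ)..b,
      B (q y) (sol B W G y (σ - 2 * max 0 (y - x)) - sol B W G y (σ - 2 * y)) := by
  have hGc : Continuous G := continuous_iff_continuousAt.2 fun t => (hG t).continuousAt
  rcases le_total σ 0 with hσ | hσ
  · rw [sol_of_nonpos hg0 hσ, hg0 σ hσ, intervalIntegral.integral_zero_ae]
    · simp
    · refine .of_forall fun y hy => ?_
      rw [uIoc_of_le hb0] at hy
      rw [sol_of_nonpos hG0 (by linarith [le_max_left 0 (y - x)]),
        sol_of_nonpos hG0 (by linarith [hy.1])]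
      simp
  have hqi := intervalIntegrable_of_locallyIntegrableOn hq le_rfl hb0
  have hqo : IntegrableOn q (Ioc 0 b) := (intervalIntegrable_iff_integrableOn_Ioc_of_le hb0).1 hqi
  set S : Set (ℝ × ℝ) := {p | p.1 / 2 < p.2 ∧ p.2 ≤ p.1 / 2 + x} with hS
  have hSm : MeasurableSet S :=
    (measurableSet_lt (f := fun p : ℝ × ℝ => p.1 / 2) (g := fun p => p.2)
      (by fun_prop) (by fun_prop)).inter
      (measurableSet_le (f := fun p : ℝ × ℝ => p.2) (g := fun p => p.1 / 2 + x)
        (by fun_prop) (by fun_prop))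
  -- `k₁` stems from the free term of the equation of the kernel, `k₂` from the integral operator
  set k₁ : ℝ × ℝ → E := S.indicator fun p => B (q p.2) (g (σ - p.1)) with hk₁
  set k₂ : ℝ × ℝ → E := fun p => B (q p.2) (B (incr W x p.1 p.2) (g (σ - p.1))) with hk₂
  have hincr : Continuous fun p : ℝ × ℝ => incr W x p.1 p.2 :=
    (continuous_incr hW).comp (f := fun p : ℝ × ℝ => ((x, p.1), p.2)) (by fun_prop)
  have hgσ : Continuous fun r => g (σ - r) := hg.comp (by fun_prop)
  have i₁ : Integrable k₁ ((volume.restrict (Ioc 0 σ)).prod (volume.restrict (Ioc 0 b))) :=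
    (integrable_bilin_prod_of_continuous B hqo (hgσ.comp continuous_fst)).indicator hSm
  have i₂ : Integrable k₂ ((volume.restrict (Ioc 0 σ)).prod (volume.restrict (Ioc 0 b))) :=
    integrable_bilin_prod_of_continuous B hqo
      ((B.continuous.comp hincr).clm_apply (hgσ.comp continuous_fst))
  have h1 : ∀ r ∈ Ioc 0 σ, B (W x r) (g (σ - r)) =
      -(1 / 2 : ℝ) • ∫ y in (0 : ℝ)..b, (k₁ (r, y) + k₂ (r, y)) := by
    intro r hr
    have hrb : x + r / 2 ≤ b := by linarith [hr.2]
    have hii := intervalIntegrable_mul_incr hq hW x r hb0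
    have hi1 : IntervalIntegrable (fun y => k₁ (r, y)) volume 0 b := by
      rw [intervalIntegrable_iff_integrableOn_Ioc_of_le hb0]
      have : IntegrableOn (fun y => B (q y) (g (σ - r))) (Ioc 0 b) :=
        (B.flip (g (σ - r))).integrable_comp hqo
      exact this.indicator (measurable_prodMk_left hSm)
    have hi2 : IntervalIntegrable (fun y => k₂ (r, y)) volume 0 b := by
      rw [intervalIntegrable_iff_integrableOn_Ioc_of_le hb0]
      have := (B.flip (g (σ - r))).integrable_comp
        ((intervalIntegrable_iff_integrableOn_Ioc_of_le hb0).1 hii)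
      simp only [ContinuousLinearMap.flip_apply, hB] at this
      exact this
    have e1 : B (∫ y in (r / 2)..(r / 2 + x), q y) (g (σ - r)) = ∫ y in (0 : ℝ)..b, k₁ (r, y) := by
      have h3 := (B.flip (g (σ - r))).intervalIntegral_comp_comm
        (intervalIntegrable_of_locallyIntegrableOn hq (a := r / 2) (b := r / 2 + x)
          (by linarith [hr.1]) (by linarith [hr.1]))
      simp only [ContinuousLinearMap.flip_apply] at h3
      rw [← h3, ← intervalIntegral_eq_indicator (a := 0) (b := b) (S := (fun y => (r, y)) ⁻¹' S)
        (by linarith [hr.1]) (by linarith) (by linarith) (measurable_prodMk_left hSm) (by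
          ext y
          simp only [hS, mem_inter_iff, mem_Ioc, mem_preimage, mem_ofPred_eq]
          constructor
          · rintro ⟨_, h⟩; exact h
          · rintro ⟨h1, h2⟩
            exact ⟨⟨by linarith [hr.1], by linarith⟩, h1, h2⟩)]
      rfl
    have e2 : B (volterra q W x r) (g (σ - r)) = ∫ y in (0 : ℝ)..b, k₂ (r, y) := by
      have h3 := (B.flip (g (σ - r))).intervalIntegral_comp_comm hii
      simp only [ContinuousLinearMap.flip_apply, hB] at h3
      rw [volterra_eq hq hW hx hr.1.le hrb, ← h3]
    rw [hV x r hx hr.1.le, intervalIntegral.integral_add hi1 hi2, ← e1, ← e2]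
    simp only [map_sub, map_smul, _root_.sub_apply, _root_.smul_apply]
    module
  have h2 : ∀ y ∈ Ioc 0 b, ∫ r in (0 : ℝ)..σ, (k₁ (r, y) + k₂ (r, y)) =
      B (q y) (sol B W G y (σ - 2 * max 0 (y - x)) - sol B W G y (σ - 2 * y)) := by
    intro y hy
    set c := 2 * max 0 (y - x) with hc
    have hc0 : 0 ≤ c := by positivity
    have hd0 : 0 ≤ 2 * y := by linarith [hy.1]
    obtain ⟨j1, e1⟩ := integral_indicator_Ici_eq hg hG hG0 hσ hc0
    obtain ⟨j2, e2⟩ := integral_indicator_Ici_eq hg hG hG0 hσ hd0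
    have hPc : Continuous (prim W y) := (continuous_prim hW).comp (Continuous.prodMk_right y)
    have c3 : ∀ c, Continuous fun r => B (prim W y (r - c)) (g (σ - r)) := fun c =>
      (B.continuous.comp (hPc.comp (by fun_prop))).clm_apply hgσ
    have j3 := (c3 c).intervalIntegrable (μ := volume) 0 σ
    have j4 := (c3 (2 * y)).intervalIntegrable (μ := volume) 0 σ
    have e3 := integral_prim_eq (B := B) hW hg hG hG0 y hσ hc0
    have e4 := integral_prim_eq (B := B) hW hg hG hG0 y hσ hd0
    have e5 : sol B W G y (σ - c) - sol B W G y (σ - 2 * y) = ∫ r in (0 : ℝ)..σ,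
        (((Ici c).indicator (fun r => g (σ - r)) r - (Ici (2 * y)).indicator (fun r => g (σ - r)) r)
        + (B (prim W y (r - c)) (g (σ - r)) - B (prim W y (r - 2 * y)) (g (σ - r)))) := by
      rw [intervalIntegral.integral_add (j1.sub j2) (j3.sub j4),
        intervalIntegral.integral_sub j1 j2, intervalIntegral.integral_sub j3 j4, e1, e2, e3, e4]
      simp only [sol]
      abel
    rw [e5, ← ContinuousLinearMap.intervalIntegral_comp_comm _ ((j1.sub j2).add (j3.sub j4))]
    refine intervalIntegral.integral_congr_ae (.of_forall fun r hr => ?_)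
    rw [uIoc_of_le hσ] at hr
    simp only [map_add]
    congr 1
    · by_cases hrS : (r, y) ∈ S
      · obtain ⟨h1, h2⟩ := hrS
        simp only at h1 h2
        rw [hk₁, indicator_of_mem (show (r, y) ∈ S from ⟨h1, h2⟩), indicator_of_mem,
          indicator_of_notMem, sub_zero]
        · exact fun hh => by linarith [mem_Ici.1 hh]
        · have : max 0 (y - x) ≤ r / 2 := max_le (by linarith [hr.1]) (by linarith)
          exact mem_Ici.2 (by linarith)
      · rw [hk₁, indicator_of_notMem hrS]
        symm
        rw [← map_zero (B (q y))]
        congr 1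
        rw [sub_eq_zero]
        by_cases h1 : r / 2 < y
        · have h2 : r / 2 + x < y := not_le.1 fun h2 => hrS ⟨h1, h2⟩
          rw [indicator_of_notMem, indicator_of_notMem]
          · exact fun hh => by linarith [mem_Ici.1 hh]
          · exact fun hh => by linarith [mem_Ici.1 hh, le_max_right 0 (y - x)]
        · have : max 0 (y - x) ≤ y := max_le hy.1.le (by linarith)
          rw [indicator_of_mem, indicator_of_mem]
          · exact mem_Ici.2 (by linarith)
          · exact mem_Ici.2 (by linarith)
    · simp only [hk₂, incr, map_sub, _root_.sub_apply, hc]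
  have h3 : ∫ r in (0 : ℝ)..σ, B (W x r) (g (σ - r)) =
      ∫ r in (0 : ℝ)..σ, -(1 / 2 : ℝ) • ∫ y in (0 : ℝ)..b, (k₁ (r, y) + k₂ (r, y)) := by
    rw [intervalIntegral.integral_of_le hσ, intervalIntegral.integral_of_le hσ]
    exact setIntegral_congr_fun measurableSet_Ioc h1
  have h4 : ∫ y in (0 : ℝ)..b,
      B (q y) (sol B W G y (σ - 2 * max 0 (y - x)) - sol B W G y (σ - 2 * y)) =
      ∫ y in (0 : ℝ)..b, ∫ r in (0 : ℝ)..σ, (k₁ (r, y) + k₂ (r, y)) := by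
    rw [intervalIntegral.integral_of_le hb0, intervalIntegral.integral_of_le hb0]
    exact setIntegral_congr_fun measurableSet_Ioc fun y hy => (h2 y hy).symm
  rw [sol, h3, intervalIntegral.integral_smul, h4, neg_smul, ← sub_eq_add_neg]
  congr 2
  simp only [intervalIntegral.integral_of_le hσ, intervalIntegral.integral_of_le hb0]
  exact integral_integral_swap (i₁.add i₂)

end Duhamel

/-! ### The wave equation for the function given by the kernel -/

section Wave

variable {E : Type*} [NormedAddCommGroup E] [NormedSpace ℝ E] [CompleteSpace E]

/-- Taylor's formula of first order with the integral form of the remainder. -/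
lemma taylor_integral {R R₁ R₂ : ℝ → E} (h : ∀ s, HasDerivAt R (R₁ s) s)
    (h₁ : ∀ s, HasDerivAt R₁ (R₂ s) s) (h₂ : Continuous R₂) (a x : ℝ) :
    R x = R a + (x - a) • R₁ a + ∫ s in a..x, (x - s) • R₂ s := by
  have hd : ∀ s, HasDerivAt (fun s => R s + (x - s) • R₁ s) ((x - s) • R₂ s) s := fun s => by
    have := (h s).add (((hasDerivAt_id s).const_sub x).smul (h₁ s))
    refine this.congr_deriv ?_
    simp only [id_eq]
    module
  have hc : Continuous fun s => (x - s) • R₂ s := by fun_prop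
  rw [intervalIntegral.integral_eq_sub_of_hasDerivAt (fun s _ => hd s) (hc.intervalIntegrable _ _)]
  simp

/-- The second order expansion of the reflected travelling waves `P(m - |x - y|) - P(m - x - y)`. -/
lemma reflected_expansion {P P₁ P₂ : ℝ → E} (h : ∀ s, HasDerivAt P (P₁ s) s)
    (h₁ : ∀ s, HasDerivAt P₁ (P₂ s) s) (h₂ : Continuous P₂) {x y : ℝ} (m : ℝ) (hx : 0 ≤ x)
    (hy : 0 ≤ y) :
    P (m - |x - y|) - P (m - x - y) = (2 * x) • P₁ (m - y) - (2 * max 0 (x - y)) • P₁ m +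
      ∫ s in (0 : ℝ)..x, (x - s) • (P₂ (m - |s - y|) - P₂ (m - s - y)) := by
  have hp : ∀ c s : ℝ, HasDerivAt (fun s : ℝ => c + s) 1 s := fun c s =>
    (hasDerivAt_id s).const_add c
  have hm : ∀ c s : ℝ, HasDerivAt (fun s : ℝ => c - s) (-1) s := fun c s =>
    (hasDerivAt_id s).const_sub c
  -- the incoming wave, continued smoothly across `s = y`
  have dA : ∀ s, HasDerivAt (fun s => P (m - y + s)) (P₁ (m - y + s)) s := fun s => by
    exact ((h (m - y + s)).scomp s (hp (m - y) s)).congr_deriv (by simp)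
  have dA₁ : ∀ s, HasDerivAt (fun s => P₁ (m - y + s)) (P₂ (m - y + s)) s := fun s => by
    exact ((h₁ (m - y + s)).scomp s (hp (m - y) s)).congr_deriv (by simp)
  have dB : ∀ c s, HasDerivAt (fun s => P (c - s)) (-P₁ (c - s)) s := fun c s => by
    exact ((h (c - s)).scomp s (hm c s)).congr_deriv (by simp)
  have dB₁ : ∀ c s, HasDerivAt (fun s => -P₁ (c - s)) (P₂ (c - s)) s := fun c s => by
    exact ((h₁ (c - s)).scomp s (hm c s)).neg.congr_deriv (by simp)
  have tA := taylor_integral dA dA₁ (h₂.comp (by fun_prop)) 0 x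
  have tB := taylor_integral (dB (m - y)) (dB₁ (m - y)) (h₂.comp (by fun_prop)) 0 x
  have cA : Continuous fun s => (x - s) • P₂ (m - y + s) :=
    (continuous_const.sub continuous_id).smul (h₂.comp (by fun_prop))
  have cB : ∀ c, Continuous fun s => (x - s) • P₂ (c - s) := fun c =>
    (continuous_const.sub continuous_id).smul (h₂.comp (by fun_prop))
  have cC : Continuous fun s => (x - s) • P₂ (m - |s - y|) :=
    (continuous_const.sub continuous_id).smul (h₂.comp (by fun_prop))
  have e0 : ∫ s in (0 : ℝ)..x, (x - s) • (P₂ (m - |s - y|) - P₂ (m - s - y)) =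
      (∫ s in (0 : ℝ)..x, (x - s) • P₂ (m - |s - y|)) -
        ∫ s in (0 : ℝ)..x, (x - s) • P₂ (m - y - s) := by
    rw [← intervalIntegral.integral_sub (cC.intervalIntegrable _ _)
      ((cB (m - y)).intervalIntegrable _ _)]
    refine intervalIntegral.integral_congr fun s _ => ?_
    simp only [smul_sub, sub_right_comm m y s]
  have key : P (m - |x - y|) = P (m - y) + x • P₁ (m - y) - (2 * max 0 (x - y)) • P₁ m +
      ∫ s in (0 : ℝ)..x, (x - s) • P₂ (m - |s - y|) := by
    rcases le_total x y with hxy | hxy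
    · have e1 : ∫ s in (0 : ℝ)..x, (x - s) • P₂ (m - |s - y|) =
          ∫ s in (0 : ℝ)..x, (x - s) • P₂ (m - y + s) := by
        refine intervalIntegral.integral_congr fun s hs => ?_
        rw [uIcc_of_le hx] at hs
        rw [abs_of_nonpos (by linarith [hs.2])]
        congr 2
        ring
      rw [e1, max_eq_left (by linarith), abs_of_nonpos (by linarith),
        show m - -(x - y) = m - y + x by ring, tA]
      simp
    · -- past `y` the outgoing wave replaces the incoming one; the difference vanishes at `y`
      have tD := taylor_integral (R := fun s => P (m + y - s) - P (m - y + s))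
        (fun s => (dB (m + y) s).sub (dA s)) (fun s => (dB₁ (m + y) s).sub (dA₁ s))
        ((h₂.comp (by fun_prop)).sub (h₂.comp (by fun_prop))) y x
      have e1 : ∫ s in (0 : ℝ)..x, (x - s) • P₂ (m - |s - y|) =
          (∫ s in (0 : ℝ)..x, (x - s) • P₂ (m - y + s)) +
          ∫ s in y..x, (x - s) • (P₂ (m + y - s) - P₂ (m - y + s)) := by
        rw [← intervalIntegral.integral_add_adjacent_intervals (cC.intervalIntegrable 0 y)
          (cC.intervalIntegrable y x), ← intervalIntegral.integral_add_adjacent_intervals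
          (cA.intervalIntegrable 0 y) (cA.intervalIntegrable y x)]
        have f1 : ∫ s in (0 : ℝ)..y, (x - s) • P₂ (m - |s - y|) =
            ∫ s in (0 : ℝ)..y, (x - s) • P₂ (m - y + s) := by
          refine intervalIntegral.integral_congr fun s hs => ?_
          rw [uIcc_of_le hy] at hs
          rw [abs_of_nonpos (by linarith [hs.2])]
          congr 2
          ring
        have f2 : ∫ s in y..x, (x - s) • (P₂ (m + y - s) - P₂ (m - y + s)) =
            (∫ s in y..x, (x - s) • P₂ (m - |s - y|)) -
              ∫ s in y..x, (x - s) • P₂ (m - y + s) := by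
          rw [← intervalIntegral.integral_sub (cC.intervalIntegrable _ _)
            (cA.intervalIntegrable _ _)]
          refine intervalIntegral.integral_congr fun s hs => ?_
          rw [uIcc_of_le hxy] at hs
          rw [abs_of_nonneg (by linarith [hs.1]), smul_sub]
          congr 3
          ring
        rw [f1, f2]
        abel
      rw [e1, max_eq_right (by linarith), abs_of_nonneg (by linarith)]
      simp only [show m + y - y = m by ring, show m - y + y = m by ring, sub_self, zero_add] at tD
      simp only [sub_zero, add_zero] at tA
      rw [show m - (x - y) = m + y - x by ring, ← sub_add_cancel (P (m + y - x)) (P (m - y + x)),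
        tD, tA]
      module
  rw [e0, key, show m - x - y = m - y - x by ring, tB]
  simp only [sub_zero]
  module

lemma intervalIntegrable_bilin {E F G : Type*} [NormedAddCommGroup E] [NormedSpace ℝ E]
    [NormedAddCommGroup F] [NormedSpace ℝ F] [NormedAddCommGroup G] [NormedSpace ℝ G]
    (B : E →L[ℝ] F →L[ℝ] G) {q : ℝ → E} {φ : ℝ → F} {a b : ℝ}
    (hq : IntervalIntegrable q volume a b) (hφ : Continuous φ) :
    IntervalIntegrable (fun y => B (q y) (φ y)) volume a b := by
  obtain ⟨C, hC⟩ := isCompact_uIcc.exists_bound_of_continuousOn (hφ.continuousOn (s := uIcc a b))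
  rw [intervalIntegrable_iff] at hq ⊢
  refine Integrable.mono' ((hq.norm.mul_const C).const_mul ‖B‖)
    (B.aestronglyMeasurable_comp₂ hq.aestronglyMeasurable hφ.aestronglyMeasurable) ?_
  refine (ae_restrict_iff' measurableSet_uIoc).2 (.of_forall fun y hy => ?_)
  refine (B.le_opNorm₂ _ _).trans ?_
  rw [mul_assoc]
  gcongr
  exact hC y (uIoc_subset_uIcc hy)

variable {𝔸 : Type*} [NormedRing 𝔸] [NormedAlgebra ℝ 𝔸] [CompleteSpace 𝔸]
  {B : 𝔸 →L[ℝ] E →L[ℝ] E} {q : ℝ → 𝔸} {W : ℝ → ℝ → 𝔸} {g g₁ g₂ : ℝ → E}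

/-- The twice integrated form of `u_xx = q u + u_tt` for `u(x, t) = sol g x (t - x)`, where
`u_tt` is `sol g₂`. Duhamel's formula for `g` contains `q` multiplied by reflected travelling waves,
whose second order expansion in `x` contains their second derivatives; integrated against `q`, these
are what Duhamel's formula for `g₂` contains. So `u` is never differentiated in `x`. -/
lemma sol_eq_integral (hB : ∀ a b v, B (a * b) v = B a (B b v))
    (hq : LocallyIntegrableOn q (Ici 0))
    (hW : Continuous fun p : ℝ × ℝ => W p.1 p.2) (hV : IsVolterraKernel q W)
    (hg : ∀ t, HasDerivAt g (g₁ t) t) (hg₁ : ∀ t, HasDerivAt g₁ (g₂ t) t) (hg₂ : Continuous g₂)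
    (g_0 : ∀ t ≤ 0, g t = 0) (g₁_0 : ∀ t ≤ 0, g₁ t = 0) (g₂_0 : ∀ t ≤ 0, g₂ t = 0) (t : ℝ) :
    ∃ c : E, ∀ x, 0 ≤ x → sol B W g x (t - x) = g t + x • c +
      ∫ s in (0 : ℝ)..x, (x - s) • (B (q s) (sol B W g s (t - s)) + sol B W g₂ s (t - s)) := by
  have cg : Continuous g := continuous_iff_continuousAt.2 fun t => (hg t).continuousAt
  have cg₁ : Continuous g₁ := continuous_iff_continuousAt.2 fun t => (hg₁ t).continuousAt
  set G : ℝ → E := fun t => ∫ s in (0 : ℝ)..t, g s with hGdef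
  have hG : ∀ t, HasDerivAt G (g t) t := fun t => (cg.integral_hasStrictDerivAt 0 t).hasDerivAt
  have cG : Continuous G := continuous_iff_continuousAt.2 fun t => (hG t).continuousAt
  have G_0 : ∀ t ≤ 0, G t = 0 := fun t ht =>
    intervalIntegral.integral_zero_ae (.of_forall fun s hs => by
      rw [uIoc_comm, uIoc_of_le ht] at hs
      exact g_0 s hs.2)
  -- the constant is `u_x(0, t)`; the integrand vanishes for `2 * y ≥ t`, and taking `|t|`
  -- for the upper limit avoids negative arguments of `q`
  refine ⟨-g₁ t - ∫ y in (0 : ℝ)..|t|, B (q y) (sol B W g y (t - 2 * y)), fun x hx => ?_⟩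
  set b := x + |t| with hb
  have hb0 : 0 ≤ b := by positivity
  have hqi := intervalIntegrable_of_locallyIntegrableOn hq le_rfl hb0
  have hqo : IntegrableOn q (Ioc 0 b) := (intervalIntegrable_iff_integrableOn_Ioc_of_le hb0).1 hqi
  have cs := continuous_sol (B := B) hW cg
  have cs₁ := continuous_sol (B := B) hW cg₁
  have cs₂ := continuous_sol (B := B) hW hg₂
  -- the integrand of Duhamel's formula for `sol g₂`
  set k : ℝ × ℝ → E := fun p =>
    sol B W g₁ p.2 (t - p.2 - |p.1 - p.2|) - sol B W g₁ p.2 (t - p.2 - p.1 - p.2) with hk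
  have ck : Continuous k :=
    (cs₁.comp (f := fun p : ℝ × ℝ => (p.2, t - p.2 - |p.1 - p.2|)) (by fun_prop)).sub
      (cs₁.comp (f := fun p : ℝ × ℝ => (p.2, t - p.2 - p.1 - p.2)) (by fun_prop))
  have shift : ∀ s y : ℝ, t - s - 2 * max 0 (y - s) = t - y - |s - y| := fun s y => by
    rcases le_total s y with h | h
    · rw [max_eq_right (by linarith), abs_of_nonpos (by linarith)]; ring
    · rw [max_eq_left (by linarith), abs_of_nonneg (by linarith)]; ring
  have shift' : ∀ s y : ℝ, t - s - 2 * y = t - y - s - y := fun s y => by ring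
  have hbs : ∀ s, 0 ≤ s → s ≤ x → s + (t - s) / 2 ≤ b := fun s h0 h1 => by
    have := le_abs_self t
    have := abs_nonneg t
    rw [hb]; linarith
  have duh₂ : ∀ s, 0 ≤ s → s ≤ x → sol B W g₂ s (t - s) =
      g₂ (t - s) - (1 / 2 : ℝ) • ∫ y in (0 : ℝ)..b, B (q y) (k (s, y)) := fun s h0 h1 => by
    rw [sol_eq_duhamel hB hq hW hV hg₂ hg₁ g₂_0 g₁_0 h0 hb0 (hbs s h0 h1)]
    simp only [shift, shift', hk]
  have duh : sol B W g x (t - x) = g (t - x) - (1 / 2 : ℝ) • ∫ y in (0 : ℝ)..b,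
      B (q y) (sol B W G y (t - y - |x - y|) - sol B W G y (t - y - x - y)) := by
    rw [sol_eq_duhamel hB hq hW hV cg hG g_0 G_0 hx hb0 (hbs x hx le_rfl)]
    simp only [shift, shift']
  have ci : Continuous fun y => ∫ s in (0 : ℝ)..x, (x - s) • k (s, y) :=
    intervalIntegral.continuous_parametric_intervalIntegral_of_continuous
      (f := fun y s => (x - s) • k (s, y)) (by
        exact (continuous_const.sub continuous_snd).smul (ck.comp continuous_swap)) continuous_const
  have i1 := intervalIntegrable_bilin B hqi (φ := fun y => sol B W g y (t - 2 * y))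
    (cs.comp (f := fun y : ℝ => (y, t - 2 * y)) (by fun_prop))
  have cg' : Continuous fun y => sol B W g y (t - y) :=
    cs.comp (f := fun y : ℝ => (y, t - y)) (by fun_prop)
  have cm : Continuous fun y => (max 0 (x - y)) • sol B W g y (t - y) :=
    (continuous_const.max (continuous_const.sub continuous_id)).smul cg'
  have i2 := intervalIntegrable_bilin B hqi cm
  have i3 := intervalIntegrable_bilin B hqi ci
  have cg₂' : Continuous fun s => sol B W g₂ s (t - s) :=
    cs₂.comp (f := fun y : ℝ => (y, t - y)) (by fun_prop)
  have hsplit : ∫ y in (0 : ℝ)..b,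
      B (q y) (sol B W G y (t - y - |x - y|) - sol B W G y (t - y - x - y)) =
      (2 * x) • (∫ y in (0 : ℝ)..b, B (q y) (sol B W g y (t - 2 * y))) -
      (2 : ℝ) • (∫ y in (0 : ℝ)..b, B (q y) ((max 0 (x - y)) • sol B W g y (t - y))) +
      ∫ y in (0 : ℝ)..b, B (q y) (∫ s in (0 : ℝ)..x, (x - s) • k (s, y)) := by
    have j1 : IntervalIntegrable (fun y => (2 * x) • B (q y) (sol B W g y (t - 2 * y)))
      volume 0 b := i1.smul _
    have j2 : IntervalIntegrable (fun y => (2 : ℝ) • B (q y) ((max 0 (x - y)) •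
      sol B W g y (t - y))) volume 0 b := i2.smul _
    rw [← intervalIntegral.integral_smul, ← intervalIntegral.integral_smul,
      ← intervalIntegral.integral_sub j1 j2, ← intervalIntegral.integral_add (j1.sub j2) i3]
    refine intervalIntegral.integral_congr fun y hy => ?_
    rw [uIcc_of_le hb0] at hy
    have := reflected_expansion (P := sol B W G y) (P₁ := sol B W g y) (P₂ := sol B W g₁ y)
      (fun s => hasDerivAt_sol hW cg hG g_0 G_0 y s)
      (fun s => hasDerivAt_sol hW cg₁ hg g₁_0 g_0 y s)
      (cs₁.comp (Continuous.prodMk_right y)) (t - y) hx hy.1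
    simp only [this, hk, map_add, map_sub, map_smul]
    rw [show t - y - y = t - 2 * y by ring, mul_smul 2 (max 0 (x - y))]
  have e1 : ∫ y in (0 : ℝ)..b, B (q y) (sol B W g y (t - 2 * y)) =
      ∫ y in (0 : ℝ)..|t|, B (q y) (sol B W g y (t - 2 * y)) := by
    have hsub : uIcc 0 |t| ⊆ uIcc 0 b := by
      rw [uIcc_of_le (abs_nonneg t), uIcc_of_le hb0]
      exact Icc_subset_Icc_right (by linarith)
    rw [← sub_eq_zero, intervalIntegral.integral_interval_sub_left i1 (i1.mono_set hsub)]
    refine intervalIntegral.integral_zero_ae (.of_forall fun y hy => ?_)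
    rw [uIoc_of_le (by linarith)] at hy
    rw [sol_of_nonpos g_0 (by linarith [hy.1, le_abs_self t, abs_nonneg t]), map_zero]
  have hxb : x ≤ b := by linarith [abs_nonneg t]
  have i2' : IntervalIntegrable (fun s => (x - s) • B (q s) (sol B W g s (t - s))) volume 0 x :=
    (intervalIntegrable_bilin B (intervalIntegrable_of_locallyIntegrableOn hq le_rfl hx)
      (φ := fun s => (x - s) • sol B W g s (t - s))
      ((continuous_const.sub continuous_id).smul cg')).congr fun s _ => by simp only [map_smul]
  have e2 : ∫ y in (0 : ℝ)..b, B (q y) ((max 0 (x - y)) • sol B W g y (t - y)) =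
      ∫ s in (0 : ℝ)..x, (x - s) • B (q s) (sol B W g s (t - s)) := by
    have hsub : uIcc 0 x ⊆ uIcc 0 b := by
      rw [uIcc_of_le hx, uIcc_of_le hb0]
      exact Icc_subset_Icc_right hxb
    have hsub' : uIcc x b ⊆ uIcc 0 b := by
      rw [uIcc_of_le hxb, uIcc_of_le hb0]
      exact Icc_subset_Icc_left hx
    rw [← intervalIntegral.integral_add_adjacent_intervals (i2.mono_set hsub) (i2.mono_set hsub'),
      intervalIntegral.integral_zero_ae (a := x) (.of_forall fun y hy => by
        rw [uIoc_of_le hxb] at hy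
        rw [max_eq_left (by linarith [hy.1]), zero_smul, map_zero]), add_zero]
    refine intervalIntegral.integral_congr fun y hy => ?_
    rw [uIcc_of_le hx] at hy
    simp only [max_eq_right (sub_nonneg.2 hy.2), map_smul]
  have e3 : ∫ y in (0 : ℝ)..b, B (q y) (∫ s in (0 : ℝ)..x, (x - s) • k (s, y)) =
      ∫ s in (0 : ℝ)..x, (x - s) • (2 : ℝ) • (g₂ (t - s) - sol B W g₂ s (t - s)) := by
    have f1 : ∀ y, B (q y) (∫ s in (0 : ℝ)..x, (x - s) • k (s, y)) =
        ∫ s in (0 : ℝ)..x, B (q y) ((x - s) • k (s, y)) := fun y => by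
      refine ((B (q y)).intervalIntegral_comp_comm (Continuous.intervalIntegrable ?_ _ _)).symm
      exact (continuous_const.sub continuous_id).smul (ck.comp (Continuous.prodMk_left y))
    have f2 : ∫ s in (0 : ℝ)..x, (x - s) • (2 : ℝ) • (g₂ (t - s) - sol B W g₂ s (t - s)) =
        ∫ s in (0 : ℝ)..x, ∫ y in (0 : ℝ)..b, B (q y) ((x - s) • k (s, y)) := by
      refine intervalIntegral.integral_congr fun s hs => ?_
      rw [uIcc_of_le hx] at hs
      simp only [duh₂ s hs.1 hs.2, sub_sub_cancel, map_smul, intervalIntegral.integral_smul]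
      module
    rw [f2]
    simp only [f1]
    simp only [intervalIntegral.integral_of_le hx, intervalIntegral.integral_of_le hb0]
    refine (integral_integral_swap ?_).symm
    exact integrable_bilin_prod_of_continuous B hqo
      ((continuous_const.sub continuous_fst).smul ck)
  have tay := taylor_integral (R := fun s => g (t - s)) (R₁ := fun s => -g₁ (t - s))
    (R₂ := fun s => g₂ (t - s))
    (fun s => ((hg (t - s)).scomp s ((hasDerivAt_id s).const_sub t)).congr_deriv (by simp))
    (fun s => ((hg₁ (t - s)).scomp s ((hasDerivAt_id s).const_sub t)).neg.congr_deriv (by simp))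
    (hg₂.comp (by fun_prop)) 0 x
  have c4 : Continuous fun s => (x - s) • sol B W g₂ s (t - s) :=
    (continuous_const.sub continuous_id).smul cg₂'
  have c5 : Continuous fun s => (x - s) • g₂ (t - s) :=
    (continuous_const.sub continuous_id).smul (hg₂.comp (by fun_prop))
  have e4 : ∫ s in (0 : ℝ)..x, (x - s) • (B (q s) (sol B W g s (t - s)) + sol B W g₂ s (t - s)) =
      (∫ s in (0 : ℝ)..x, (x - s) • B (q s) (sol B W g s (t - s))) +
      ∫ s in (0 : ℝ)..x, (x - s) • sol B W g₂ s (t - s) := by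
    rw [← intervalIntegral.integral_add i2' (c4.intervalIntegrable _ _)]
    simp only [smul_add]
  have e5 : ∫ s in (0 : ℝ)..x, (x - s) • (2 : ℝ) • (g₂ (t - s) - sol B W g₂ s (t - s)) =
      (2 : ℝ) • ((∫ s in (0 : ℝ)..x, (x - s) • g₂ (t - s)) -
      ∫ s in (0 : ℝ)..x, (x - s) • sol B W g₂ s (t - s)) := by
    rw [← intervalIntegral.integral_sub (c5.intervalIntegrable _ _) (c4.intervalIntegrable _ _),
      ← intervalIntegral.integral_smul]
    refine intervalIntegral.integral_congr fun s _ => ?_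
    module
  simp only [sub_zero] at tay
  rw [duh, hsplit, e1, e2, e3, e5, e4, tay]
  module

end Wave

/-! ### Differentiation in `L₂` and continuation of controls -/

variable {n : ℕ}

/-- The `L₂` norm of a bounded function that vanishes outside `[0, R]`. -/
lemma norm_le_of_support {v : Hil n} {h : ℝ → Vec n} {R C : ℝ} (hv : v =ᵐ[mu] h)
    (hC : ∀ x ∈ Icc 0 R, ‖h x‖ ≤ C) (h0 : ∀ x, 0 ≤ x → R < x → h x = 0) (hC0 : 0 ≤ C) :
    ‖v‖ ≤ C * mu.real (Icc 0 R) ^ (1 / (2 : ENNReal).toReal) := by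
  have hfin : mu (Icc 0 R) ≠ ⊤ :=
    ((Measure.restrict_apply_le _ _).trans_lt measure_Icc_lt_top).ne
  have h1 : ‖v‖ ≤ ‖indicatorConstLp 2 (measurableSet_Icc (a := 0) (b := R)) hfin C‖ := by
    refine Lp.norm_le_norm_of_ae_le ?_
    filter_upwards [hv, indicatorConstLp_coeFn (p := 2) (hs := measurableSet_Icc (a := 0) (b := R))
      (hμs := hfin) (c := C), ae_restrict_mem measurableSet_Ici] with x e1 e2 hx
    rw [e1, e2]
    by_cases hxR : x ≤ R
    · rw [indicator_of_mem (show x ∈ Icc 0 R from ⟨hx, hxR⟩), Real.norm_of_nonneg hC0]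
      exact hC x ⟨hx, hxR⟩
    · rw [h0 x hx (not_le.1 hxR), norm_zero]
      exact norm_nonneg _
  rwa [norm_indicatorConstLp (by simp) (by simp), Real.norm_of_nonneg hC0] at h1

/-- Differentiation with respect to a parameter in `L₂`, for functions with compact support that are
continuously differentiable in the parameter. -/
lemma hasDerivAt_Lp {φ φ₁ : ℝ → ℝ → Vec n} {u u₁ : ℝ → Hil n}
    (hc : Continuous fun p : ℝ × ℝ => φ₁ p.1 p.2)
    (hd : ∀ x t, HasDerivAt (φ x) (φ₁ x t) t)
    (h0 : ∀ x t, 0 ≤ x → t ≤ x → φ x t = 0) (h0₁ : ∀ x t, 0 ≤ x → t ≤ x → φ₁ x t = 0)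
    (hu : ∀ t, u t =ᵐ[mu] fun x => φ x t) (hu₁ : ∀ t, u₁ t =ᵐ[mu] fun x => φ₁ x t) (t : ℝ) :
    HasDerivAt u (u₁ t) t := by
  rw [hasDerivAt_iff_isLittleO, Asymptotics.isLittleO_iff]
  intro ε hε
  set R := |t| + 1 with hR
  set K := mu.real (Icc 0 R) ^ (1 / (2 : ENNReal).toReal) with hK
  have hK0 : 0 ≤ K := by positivity
  set ε' := ε / (K + 1) with hε'
  have hε0 : 0 < ε' := by positivity
  have hεK : ε' * K ≤ ε := by
    rw [hε', div_mul_eq_mul_div, div_le_iff₀ (by positivity)]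
    nlinarith
  have huc : UniformContinuousOn (fun p : ℝ × ℝ => φ₁ p.1 p.2) (Icc 0 R ×ˢ Icc (t - 1) (t + 1)) :=
    (isCompact_Icc.prod isCompact_Icc).uniformContinuousOn_of_continuous hc.continuousOn
  obtain ⟨δ, hδ, H⟩ := Metric.uniformContinuousOn_iff_le.1 huc ε' hε0
  filter_upwards [Metric.ball_mem_nhds t (lt_min hδ one_pos)] with s hs
  have hs' : |s - t| < min δ 1 := by simpa [Real.dist_eq] using hs
  have hae : (u s - u t - (s - t) • u₁ t : Hil n) =ᵐ[mu]
      fun x => φ x s - φ x t - (s - t) • φ₁ x t := by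
    filter_upwards [Lp.coeFn_sub (u s - u t) ((s - t) • u₁ t), Lp.coeFn_sub (u s) (u t),
      Lp.coeFn_smul (s - t) (u₁ t), hu s, hu t, hu₁ t] with x e1 e2 e3 e4 e5 e6
    rw [e1, Pi.sub_apply, e2, Pi.sub_apply, e3, Pi.smul_apply, e4, e5, e6]
  have hb := norm_le_of_support (R := R) (C := ε' * |s - t|) hae (fun x hx => ?_)
    (fun x hx hxR => ?_) (by positivity)
  · refine hb.trans ?_
    rw [Real.norm_eq_abs, ← hK]
    calc ε' * |s - t| * K = ε' * K * |s - t| := by ring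
      _ ≤ ε * |s - t| := by gcongr
  · have hm : ∀ r ∈ uIcc t s, |r - t| ≤ |s - t| := fun r hr => by
      rcases le_total t s with h | h
      · rw [uIcc_of_le h] at hr
        rw [abs_of_nonneg (sub_nonneg.2 hr.1), abs_of_nonneg (sub_nonneg.2 h)]
        linarith [hr.2]
      · rw [uIcc_of_ge h] at hr
        rw [abs_of_nonpos (sub_nonpos.2 hr.2), abs_of_nonpos (sub_nonpos.2 h)]
        linarith [hr.1]
    have := (convex_uIcc t s).norm_image_sub_le_of_norm_hasDerivWithin_le
      (f := fun r => φ x r - r • φ₁ x t) (f' := fun r => φ₁ x r - (1 : ℝ) • φ₁ x t) (C := ε')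
      (fun r _ => ((hd x r).sub ((hasDerivAt_id r).smul_const (φ₁ x t))).hasDerivWithinAt)
      (fun r hr => by
        have h1 := (hm r hr).trans hs'.le
        have h2 := abs_le.1 (h1.trans (min_le_right _ _))
        rw [one_smul, ← dist_eq_norm]
        refine H (x, r) ⟨hx, ⟨by linarith [h2.1], by linarith [h2.2]⟩⟩ (x, t)
          ⟨hx, ⟨by linarith, by linarith⟩⟩ ?_
        rw [Prod.dist_eq, dist_self, Real.dist_eq]
        exact max_le hδ.le (h1.trans (min_le_left _ _)))
      left_mem_uIcc right_mem_uIcc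
    rw [Real.norm_eq_abs] at this
    refine le_trans (le_of_eq ?_) this
    congr 1
    module
  · have h2 := abs_le.1 (hs'.le.trans (min_le_right _ _))
    have := le_abs_self t
    rw [h0 x s hx (by linarith [h2.2]), h0 x t hx (by linarith), h0₁ x t hx (by linarith)]
    simp

/-- A control, continued by zero to the left, extends beyond `T` to a twice continuously
differentiable function on the line: its second derivative is continued by constants, and integrated
twice. -/
lemma IsControl.exists_extension {T : ℝ} {f : ℝ → Vec n} (hT : 0 < T) (hf : IsControl T f) :
    ∃ g g₁ g₂ : ℝ → Vec n, (∀ t, HasDerivAt g (g₁ t) t) ∧ (∀ t, HasDerivAt g₁ (g₂ t) t) ∧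
      Continuous g₂ ∧ (∀ t ≤ 0, g t = 0) ∧ (∀ t ≤ 0, g₁ t = 0) ∧ (∀ t ≤ 0, g₂ t = 0) ∧
      ∀ t ≤ T, zeroExt f t = g t := by
  obtain ⟨hs, δ, hδ, hz⟩ := hf
  have hud := uniqueDiffOn_Icc hT
  set f₁ := derivWithin f (Icc 0 T) with hf₁
  set f₂ := derivWithin f₁ (Icc 0 T) with hf₂
  have s1 : ContDiffOn ℝ ∞ f₁ (Icc 0 T) := hs.derivWithin hud (by simp)
  have s2 : ContDiffOn ℝ ∞ f₂ (Icc 0 T) := s1.derivWithin hud (by simp)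
  have d0 : ∀ t ∈ Icc 0 T, HasDerivWithinAt f (f₁ t) (Icc 0 T) t := fun t ht =>
    ((hs.differentiableOn (by simp)) t ht).hasDerivWithinAt
  have d1 : ∀ t ∈ Icc 0 T, HasDerivWithinAt f₁ (f₂ t) (Icc 0 T) t := fun t ht =>
    ((s1.differentiableOn (by simp)) t ht).hasDerivWithinAt
  have hzd : ∀ {h h₁ : ℝ → Vec n}, (∀ t ∈ Icc 0 T, HasDerivWithinAt h (h₁ t) (Icc 0 T) t) →
      (∀ t ∈ Icc 0 T, t < δ → h t = 0) → ∀ t ∈ Icc 0 T, t < δ → h₁ t = 0 := by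
    intro h h₁ hd hz t ht htδ
    refine (hud t ht).eq_deriv _ (hd t ht)
      ((hasDerivWithinAt_const t (Icc 0 T) (0 : Vec n)).congr_of_eventuallyEq ?_ (hz t ht htδ))
    filter_upwards [self_mem_nhdsWithin, mem_nhdsWithin_of_mem_nhds (Iio_mem_nhds htδ)]
      with s h1 h2 using hz s h1 h2
  have z1 := hzd d0 hz
  have z2 := hzd d1 z1
  have T0 : (0 : ℝ) ∈ Icc 0 T := ⟨le_rfl, hT.le⟩
  set g₂ : ℝ → Vec n := fun t => f₂ (max 0 (min T t)) with hg₂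
  have hmem : ∀ t, max 0 (min T t) ∈ Icc 0 T := fun t =>
    ⟨le_max_left _ _, max_le hT.le (min_le_left _ _)⟩
  have cg₂ : Continuous g₂ := s2.continuousOn.comp_continuous (by fun_prop) hmem
  have g₂_0 : ∀ t ≤ 0, g₂ t = 0 := fun t ht => by
    simp only [hg₂]
    rw [min_eq_right (by linarith), max_eq_left ht]
    exact z2 0 T0 hδ
  have hprim0 : ∀ {h : ℝ → Vec n}, (∀ t ≤ 0, h t = 0) → ∀ t ≤ 0, ∫ s in (0 : ℝ)..t, h s = 0 :=
    fun hh t ht => intervalIntegral.integral_zero_ae (.of_forall fun s hs => by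
      rw [uIoc_comm, uIoc_of_le ht] at hs
      exact hh s hs.2)
  set g₁ : ℝ → Vec n := fun t => ∫ s in (0 : ℝ)..t, g₂ s with hg₁
  have dg₁ : ∀ t, HasDerivAt g₁ (g₂ t) t := fun t =>
    (cg₂.integral_hasStrictDerivAt 0 t).hasDerivAt
  have cg₁ : Continuous g₁ := continuous_iff_continuousAt.2 fun t => (dg₁ t).continuousAt
  set g : ℝ → Vec n := fun t => ∫ s in (0 : ℝ)..t, g₁ s with hg
  have g₁_0 := hprim0 g₂_0
  have g_0 := hprim0 g₁_0
  have hint : ∀ {h h₁ k : ℝ → Vec n}, (∀ t ∈ Icc 0 T, HasDerivWithinAt h (h₁ t) (Icc 0 T) t) →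
      h 0 = 0 → Continuous k → (∀ t ∈ Icc 0 T, h₁ t = k t) →
      ∀ t ∈ Icc 0 T, h t = ∫ s in (0 : ℝ)..t, k s := by
    intro h h₁ k hd hh0 hk hk' t ht
    rw [intervalIntegral.integral_eq_sub_of_hasDerivAt_of_le (f := h) ht.1
      (fun s hs => ((hd s ⟨hs.1, hs.2.trans ht.2⟩).continuousWithinAt).mono
        (Icc_subset_Icc_right ht.2)) (fun s hs => ?_) (hk.intervalIntegrable _ _), hh0, sub_zero]
    have hs1 : s ∈ Icc 0 T := ⟨hs.1.le, hs.2.le.trans ht.2⟩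
    rw [← hk' s hs1]
    exact (hd s hs1).hasDerivAt (Icc_mem_nhds hs.1 (hs.2.trans_le ht.2))
  have e1 : ∀ t ∈ Icc 0 T, f₁ t = g₁ t := hint d1 (z1 0 T0 hδ) cg₂ fun t ht => by
    simp only [hg₂]
    rw [min_eq_right ht.2, max_eq_right ht.1]
  have e0 : ∀ t ∈ Icc 0 T, f t = g t := hint d0 (hz 0 T0 hδ) cg₁ e1
  refine ⟨g, g₁, g₂, fun t => (cg₁.integral_hasStrictDerivAt 0 t).hasDerivAt, dg₁, cg₂, g_0, g₁_0,
    g₂_0, fun t ht => ?_⟩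
  unfold zeroExt
  split_ifs with h
  · exact e0 t ⟨h, ht⟩
  · exact (g_0 t (not_le.1 h).le).symm

/-- The action of matrices on vectors as a real bilinear map, continuous for the operator norm. -/
def actReal (n : ℕ) : Matrix (Fin n) (Fin n) ℂ →L[ℝ] Vec n →L[ℝ] Vec n :=
  LinearMap.mkContinuous₂ (LinearMap.mk₂ ℝ (fun A v => act A v)
    (fun _ _ _ => by simp) (fun c A v => by
      have h := map_smul (Matrix.toEuclideanCLM (n := Fin n) (𝕜 := ℂ)) (algebraMap ℝ ℂ c) A
      rw [algebraMap_smul] at h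
      refine (congrArg (fun L => L v) h).trans ?_
      rw [_root_.smul_apply, algebraMap_smul])
    (fun _ _ _ => map_add _ _ _) (fun c A v => by
      rw [← algebraMap_smul ℂ c v, map_smul, algebraMap_smul])) 1
    (fun A v => by
      rw [one_mul]
      exact (act A).le_opNorm v)

@[simp] lemma actReal_apply (A : Matrix (Fin n) (Fin n) ℂ) (v : Vec n) :
    actReal n A v = act A v := rfl

variable {q : ℝ → Matrix (Fin n) (Fin n) ℂ} {W : ℝ → ℝ → Matrix (Fin n) (Fin n) ℂ}

/-- The substitution `r = s - x` in the formula for the solution. For `t ≤ T` only values of the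
control at times before `T` enter, so the way it is extended beyond `T` is irrelevant. -/
lemma uBeta_eq_sol {T : ℝ} {f g : ℝ → Vec n} (hT : 0 ≤ T) (hfg : ∀ t ≤ T, zeroExt f t = g t)
    {x t : ℝ} (hx : 0 ≤ x) (ht : t ≤ T) :
    uBeta (fun x t => W x (t - x)) f x t = sol (actReal n) W g x (t - x) := by
  have h1 := intervalIntegral.integral_comp_sub_right (a := x) (b := t)
    (fun r => act (W x r) (zeroExt f (t - x - r))) x
  rw [sub_self] at h1
  have h2 : ∫ s in x..t, act (W x (s - x)) (zeroExt f (t - s)) =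
      ∫ s in x..t, act (W x (s - x)) (zeroExt f (t - x - (s - x))) := by
    refine intervalIntegral.integral_congr fun s _ => ?_
    simp only [sub_sub_sub_cancel_right]
  rw [uBeta, sol, hfg _ (by linarith), h2, h1]
  congr 1
  refine intervalIntegral.integral_congr_ae (.of_forall fun r hr => ?_)
  rw [hfg, actReal_apply]
  rcases le_total 0 (t - x) with h | h
  · rw [uIoc_of_le h] at hr; linarith [hr.1]
  · rw [uIoc_comm, uIoc_of_le h] at hr; linarith [hr.1]

lemma locallyIntegrableOn_act_sol (hq : LocallyIntegrableOn q (Ici 0)) {φ ψ : ℝ → Vec n}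
    (hφ : Continuous φ) (hψ : Continuous ψ) :
    LocallyIntegrableOn (fun s => actReal n (q s) (φ s) + ψ s) (Ici 0) := by
  refine LocallyIntegrableOn.add (fun x hx => ?_) (hψ.locallyIntegrable.locallyIntegrableOn _)
  have hx1 : (0 : ℝ) ≤ x + 1 := by linarith [mem_Ici.1 hx]
  refine ⟨Icc 0 (x + 1), ?_, (intervalIntegrable_iff_integrableOn_Icc_of_le hx1).1
    (intervalIntegrable_bilin (actReal n)
      (intervalIntegrable_of_locallyIntegrableOn hq le_rfl hx1) hφ)⟩
  filter_upwards [self_mem_nhdsWithin, mem_nhdsWithin_of_mem_nhds (Iio_mem_nhds (lt_add_one x))]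
    with s h1 h2 using ⟨h1, h2.le⟩

/-- The function given by the kernel is a solution, with the expected derivatives. -/
lemma uBeta_isSolution (hq : LocallyIntegrableOn q (Ici 0))
    (hherm : ∀ᵐ x ∂mu, (q x).IsHermitian)
    (hW : Continuous fun p : ℝ × ℝ => W p.1 p.2) (hV : IsVolterraKernel q W)
    {T : ℝ} {f : ℝ → Vec n} (hT : 0 < T) (hf : IsControl T f) :
    ∃ (u u₁ u₂ : ℝ → Hil n) (ut utt : ℝ → ℝ → Vec n),
      IsSolution q T f (uBeta (fun x t => W x (t - x)) f) u u₁ u₂ ∧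
      (∀ x t : ℝ, 0 ≤ x → t ∈ Icc 0 T →
        HasDerivWithinAt (fun s => uBeta (fun x t => W x (t - x)) f x s) (ut x t) (Icc 0 T) t ∧
        HasDerivWithinAt (fun s => ut x s) (utt x t) (Icc 0 T) t) ∧
      (∀ t ∈ Icc 0 T, HasDerivWithinAt u₁ (u₂ t) (Icc 0 T) t) ∧
      (∀ t ∈ Icc 0 T, u₁ t =ᵐ[mu] fun x => ut x t) ∧
      (∀ t ∈ Icc 0 T, u₂ t =ᵐ[mu] fun x => utt x t) := by
  obtain ⟨g, g₁, g₂, dg, dg₁, cg₂, g_0, g₁_0, g₂_0, hfg⟩ := hf.exists_extension hT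
  have cg : Continuous g := continuous_iff_continuousAt.2 fun t => (dg t).continuousAt
  have cg₁ : Continuous g₁ := continuous_iff_continuousAt.2 fun t => (dg₁ t).continuousAt
  set S : (ℝ → Vec n) → ℝ → ℝ → Vec n := fun g x t => sol (actReal n) W g x (t - x) with hS
  have cS : ∀ {g : ℝ → Vec n}, Continuous g → Continuous fun p : ℝ × ℝ => S g p.1 p.2 := fun hg =>
    (continuous_sol (B := actReal n) hW hg).comp (f := fun p : ℝ × ℝ => (p.1, p.2 - p.1))
      (by fun_prop)
  have S0 : ∀ {g : ℝ → Vec n}, (∀ t ≤ 0, g t = 0) → ∀ x t, t ≤ x → S g x t = 0 :=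
    fun hg x t h => sol_of_nonpos hg (by linarith)
  have dS : ∀ {g g₁ : ℝ → Vec n}, Continuous g₁ → (∀ t, HasDerivAt g (g₁ t) t) →
      (∀ t ≤ 0, g t = 0) → (∀ t ≤ 0, g₁ t = 0) → ∀ x t, HasDerivAt (S g x) (S g₁ x t) t :=
    fun hc hd h0 h1 x t => by
      have := (hasDerivAt_sol (B := actReal n) hW hc hd h1 h0 x (t - x)).scomp t
        ((hasDerivAt_id t).sub_const x)
      rwa [one_smul] at this
  have mS : ∀ {g : ℝ → Vec n}, Continuous g → (∀ t ≤ 0, g t = 0) → ∀ t,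
      MemLp (fun x => S g x t) 2 mu := fun hc h0 t =>
    memLp_of_continuousOn (b := t) ((cS hc).comp (Continuous.prodMk_left t)).continuousOn
      fun x _ hx => S0 h0 x t hx.le
  set u : ℝ → Hil n := fun t => (mS cg g_0 t).toLp _ with hu
  set u₁ : ℝ → Hil n := fun t => (mS cg₁ g₁_0 t).toLp _ with hu₁
  set u₂ : ℝ → Hil n := fun t => (mS cg₂ g₂_0 t).toLp _ with hu₂
  have ru : ∀ t, u t =ᵐ[mu] fun x => S g x t := fun t => (mS cg g_0 t).coeFn_toLp
  have ru₁ : ∀ t, u₁ t =ᵐ[mu] fun x => S g₁ x t := fun t => (mS cg₁ g₁_0 t).coeFn_toLp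
  have ru₂ : ∀ t, u₂ t =ᵐ[mu] fun x => S g₂ x t := fun t => (mS cg₂ g₂_0 t).coeFn_toLp
  have du : ∀ t, HasDerivAt u (u₁ t) t := hasDerivAt_Lp (cS cg₁) (dS cg₁ dg g_0 g₁_0)
    (fun x t _ h => S0 g_0 x t h) (fun x t _ h => S0 g₁_0 x t h) ru ru₁
  have du₁ : ∀ t, HasDerivAt u₁ (u₂ t) t := hasDerivAt_Lp (cS cg₂) (dS cg₂ dg₁ g₁_0 g₂_0)
    (fun x t _ h => S0 g₁_0 x t h) (fun x t _ h => S0 g₂_0 x t h) ru₁ ru₂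
  have hU : ∀ {x t}, 0 ≤ x → t ≤ T → uBeta (fun x t => W x (t - x)) f x t = S g x t :=
    fun hx ht => uBeta_eq_sol hT.le hfg hx ht
  have rep : ∀ t ≤ T, u t =ᵐ[mu] fun x => uBeta (fun x t => W x (t - x)) f x t := fun t ht => by
    filter_upwards [ru t, ae_restrict_mem measurableSet_Ici] with x h1 hx
    rw [h1, hU hx ht]
  have hw : ∀ t ≤ T, ∃ y₁, IsW21Loc (fun x => uBeta (fun x t => W x (t - x)) f x t) y₁
      (fun s => actReal n (q s) (S g s t) + S g₂ s t) := fun t ht => by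
    obtain ⟨c, hc⟩ := sol_eq_integral (B := actReal n) (fun a b v => by simp) hq hW hV dg dg₁ cg₂
      g_0 g₁_0 g₂_0 t
    exact ⟨_, isW21Loc_of_eq_integral (a := g t) (c := c)
      (locallyIntegrableOn_act_sol hq ((cS cg).comp (Continuous.prodMk_left t))
        ((cS cg₂).comp (Continuous.prodMk_left t)))
      fun x hx => (hU hx ht).trans (hc x hx)⟩
  have hmax : ∀ t ≤ T, MaxRel q (u t) (-u₂ t)
      (fun x => uBeta (fun x t => W x (t - x)) f x t) := fun t ht => by
    obtain ⟨y₁, hy⟩ := hw t ht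
    refine ⟨y₁, _, hy, rep t ht, ?_⟩
    filter_upwards [Lp.coeFn_neg (u₂ t), ru₂ t, ae_restrict_mem measurableSet_Ici] with x h1 h2 hx
    rw [h1, Pi.neg_apply, h2, hU hx ht, actReal_apply]
    abel
  refine ⟨u, u₁, u₂, S g₁, S g₂, ⟨fun t ht => rep t ht.2, fun t _ => (du t).hasDerivWithinAt,
    fun t _ => (du₁ t).continuousAt.continuousWithinAt, fun t _ => du₁ t,
    fun t ht => mem_adjoint_domain hherm (hmax t ht.2),
    fun t ht => mem_Lmax_domain.2 ⟨_, _, hmax t ht.2⟩, fun t ht => ?_, fun t ht => ?_,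
    fun x hx => ?_, ?_, fun t ht => ?_⟩, fun x t hx ht => ⟨?_, ?_⟩,
    fun t _ => (du₁ t).hasDerivWithinAt, fun t _ => ru₁ t, fun t _ => ru₂ t⟩
  · obtain ⟨y₁, hy⟩ := hw t ht.2
    exact ⟨y₁, _, hy⟩
  · obtain ⟨y₁, hy⟩ := hw t ht.2.le
    filter_upwards [ru₂ t, hy.ae_deriv_deriv, ae_restrict_mem measurableSet_Ici] with x h1 h2 hx
    rw [h1, hU hx ht.2.le]
    have h3 : deriv (fun x₁ => deriv
      (fun x₂ => uBeta (fun x t => W x (t - x)) f x₂ t) x₁) x = _ := h2.deriv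
    rw [h3, actReal_apply]
    abel
  · rw [hU hx hT.le, S0 g_0 x 0 hx]
  · rw [Lp.eq_zero_iff_ae_eq_zero]
    filter_upwards [ru₁ 0, ae_restrict_mem measurableSet_Ici] with x h1 hx
    rw [h1, S0 g₁_0 x 0 hx, Pi.zero_apply]
  · obtain ⟨c, hc⟩ := sol_eq_integral (B := actReal n) (fun a b v => by simp) hq hW hV dg dg₁ cg₂
      g_0 g₁_0 g₂_0 t
    have h1 := hfg t ht.2
    rw [zeroExt, if_pos ht.1] at h1
    rw [hU le_rfl ht.2, h1]
    simpa [hS] using hc 0 le_rfl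
  · exact ((dS cg₁ dg g_0 g₁_0 x t).hasDerivWithinAt).congr (fun s hs => hU hx hs.2) (hU hx ht.2)
  · exact (dS cg₂ dg₁ g₁_0 g₂_0 x t).hasDerivWithinAt

end HalfLine

end

theorem theorem4p1 (n : ℕ) (q : ℝ → Matrix (Fin n) (Fin n) ℂ)
    (hq : LocallyIntegrableOn q (Ici (0 : ℝ)) volume)
    (hherm : ∀ᵐ x ∂(volume.restrict (Ici (0 : ℝ))), (q x).IsHermitian)
    (hpos : HalfLine.PosDef (HalfLine.L0 q)) :
    ∃ w : ℝ → ℝ → Matrix (Fin n) (Fin n) ℂ,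
      HalfLine.IsGoursatKernel q w ∧
      (∀ w' : ℝ → ℝ → Matrix (Fin n) (Fin n) ℂ, HalfLine.IsGoursatKernel q w' →
        ∀ x t : ℝ, 0 ≤ x → x ≤ t → w' x t = w x t) ∧
      ∀ (T : ℝ) (f : ℝ → HalfLine.Vec n), 0 < T → HalfLine.IsControl T f →
        -- the function given by the kernel formula is a solution, and its derivatives in `t` as a
        -- Hilbert-space-valued function are given by its partial derivatives
        (∃ (u u₁ u₂ : ℝ → HalfLine.Hil n) (ut utt : ℝ → ℝ → HalfLine.Vec n),
          HalfLine.IsSolution q T f (HalfLine.uBeta w f) u u₁ u₂ ∧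
          (∀ x t : ℝ, 0 ≤ x → t ∈ Icc 0 T →
            HasDerivWithinAt (fun s => HalfLine.uBeta w f x s) (ut x t) (Icc 0 T) t ∧
            HasDerivWithinAt (fun s => ut x s) (utt x t) (Icc 0 T) t) ∧
          (∀ t ∈ Icc 0 T, HasDerivWithinAt u₁ (u₂ t) (Icc 0 T) t) ∧
          (∀ t ∈ Icc 0 T, u₁ t =ᵐ[HalfLine.mu] fun x => ut x t) ∧
          (∀ t ∈ Icc 0 T, u₂ t =ᵐ[HalfLine.mu] fun x => utt x t)) ∧
        -- and there is no other solution
        (∀ (U : ℝ → ℝ → HalfLine.Vec n) (u u₁ u₂ : ℝ → HalfLine.Hil n),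
          HalfLine.IsSolution q T f U u u₁ u₂ →
          ∀ x t : ℝ, 0 ≤ x → t ∈ Icc 0 T → U x t = HalfLine.uBeta w f x t) := by
  obtain ⟨W, hW, hV⟩ := HalfLine.exists_isVolterraKernel hq
  refine ⟨fun x t => W x (t - x), hV.isGoursatKernel hq hW, fun w' hw' x t hx hxt => ?_,
    fun T f hT hf => ?_⟩
  · obtain ⟨hc, hv⟩ := hw'.isVolterraKernel hq
    have := hv.eq hq hc hW hV hx (sub_nonneg.2 hxt)
    simpa [max_eq_left hx, max_eq_left (sub_nonneg.2 hxt)] using this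
  · have hsol := HalfLine.uBeta_isSolution hq hherm hW hV hT hf
    refine ⟨hsol, fun U u u₁ u₂ hU x t hx ht => ?_⟩
    obtain ⟨v, v₁, v₂, _, _, hv, _⟩ := hsol
    exact hU.eq_of_isSolution hherm hpos hT hv hx ht
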